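/- **Symmetry dimensions of the autonomous Painlevé–Gambier equations.** Let $\mathbb F=\mathbb R$ or $\mathbb C$. For a second order ODE $y''=F(x,y,y')$ and an open set $U\subset\mathbb F^2$ over which $F$ is regular, let $L(U)$ be its Lie algebra of point symmetries over $U$: the vector fields $\hat X=\xi(x,y)\partial_x+\phi(x,y)\partial_y$, smooth on $U$ (holomorphic if $\mathbb F=\mathbb C$), whose second prolongation annihilates $y''-F(x,y,y')$ on the locus $y''=F(x,y,y')$. Consider the following autonomous equations $I_k$ ($k$ is the number in Ince's list, and all parameters lie in $\mathbb F$), each with a number $N$: - $I_1$: $y''=0$, $N=8$. - $I_2$: $y''=6y^2$, $N=2$. - $I_3$: $y''=6y^2+\frac12$, $N=1$. - $I_7$: $y''=2y^3$, $N=2$. - $I_8$: $y''=2y^3+\beta y+\gamma$, $(\beta,\gamma)\neq(0,0)$, $N=1$. - $I_{11}$: $y''=\frac{y'^2}{y}$, $N=8$. - $I_{12}$: $y''=\frac{y'^2}{y}+\alpha y^3+\beta y^2+\gamma+\frac{\delta}{y}$, at least two of $\alpha,\beta,\gamma,\delta$ nonzero, $N=1$. - $I_{17}$: $y''=\frac{m-1}{m}\frac{y'^2}{y}$,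 $m\ge2$ an integer, $N=8$. - $I_{18}$: $y''=\frac{y'^2}{2y}+4y^2$, $N=2$. - $I_{19}$: $y''=\frac{y'^2}{2y}+4y^2+2y$, $N=1$. - $I_{21}$: $y''=\frac{3y'^2}{4y}+3y^2$, $N=2$. - $I_{22}$: $y''=\frac{3y'^2}{4y}-1$, $N=3$. - $I_{23}$: $y''=\frac{3y'^2}{4y}+3y^2+\alpha y+\beta$, $(\alpha,\beta)\ne(0,0)$, $N=1$. - $I_{29}$: $y''=\frac{y'^2}{2y}+\frac32y^3$, $N=2$. - $I_{30}$: $y''=\frac{y'^2}{2y}+\frac32y^3+4\alpha y^2+2\beta y-\frac{\gamma^2}{2y}$, $(\alpha,\beta,\gamma)\neq0$, $N=1$. - $I_{32}$: $y''=\frac{y'^2}{2y}-\frac1{2y}$, $N=3$. - $I_{33}$: $y''=\frac{y'^2}{2y}+4y^2+\alpha y-\frac1{2y}$, $N=1$. - $I_{37}$: $y''=\left(\frac1{2y}+\frac1{y-1}\right)y'^2$, $N=8$. - $I_{38}$: $y''=\left(\frac1{2y}+\frac1{y-1}\right)y'^2+y(y-1)\left[\alpha(y-1)+\beta\frac{y-1}{y^2}+\frac{\gamma}{y-1}+\frac{\delta}{(y-1)^2}\right]$,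 $(\alpha,\beta,\gamma,\delta)\ne0$, $N=1$. - $I_{41}$: $y''=\frac23\left(\frac1y+\frac1{y-1}\right)y'^2$, $N=8$. - $I_{43}$: $y''=\frac34\left(\frac1y+\frac1{y-1}\right)y'^2$, $N=8$. - $I_{44}$: $y''=\frac34\left(\frac1y+\frac1{y-1}\right)y'^2+y(y-1)\left[\frac{\alpha}{y}+\frac{\beta}{y-1}+2\gamma(2y-1)\right]$, $(\alpha,\beta,\gamma)\ne0$, $N=1$. - $I_{49}$: $y''=\frac12\left(\frac1y+\frac1{y-1}+\frac1{y-a}\right)y'^2+y(y-1)(y-a)\left[\alpha+\frac{\beta}{y^2}+\frac{\gamma}{(y-1)^2}+\frac{\delta}{(y-a)^2}\right]$, $a\ne0,1$, $(\alpha,\beta,\gamma,\delta)\neq0$, $N=1$. Then, for each of these equations and every nonempty convex open set $U\subset\mathbb F^2$ that contains no point $(x,y)$ at which $y$ is a pole of the right-hand side (that is, $y\ne0$; $y\neq 0,1$; $y\ne0,1,a$, respectively, according to the denominators shown above): $N\in\{1,2,3,8\}$, $\partial_x\in L(U)$ and $\dim_{\mathbb F}L(U)=N$. Moreover, if $N=8$,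 then $L(U)$, with the commutator of vector fields, is isomorphic to $\mathfrak{sl}(3,\mathbb F)$, and near every point of $U$ an invertible smooth point transformation $(x,y)\mapsto(t,u)$ takes the equation into $\ddot u(t)=0$. -/

import Mathlib

open scoped ContDiff

/-- A second order ordinary differential equation `y'' = rhs x y y'`, together with the set
`domain` of points `(x, y)` over which its right-hand side is regular. -/
structure SecondOrderODE (𝕜 : Type*) where
  rhs : 𝕜 → 𝕜 → 𝕜 → 𝕜
  domain : Set (𝕜 × 𝕜)

namespace SecondOrderODE

section Symmetry

variable {𝕜 : Type*} [RCLike 𝕜]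

/-- The total derivative `D_x g = g_x + p g_y` of a function `g` of `z = (x, y)`;
here `p` stands for `y'`. -/
noncomputable def totalDeriv₀ (g : 𝕜 × 𝕜 → 𝕜) (z : 𝕜 × 𝕜) (p : 𝕜) : 𝕜 :=
  fderiv 𝕜 g z (1, p)

/-- The total derivative `D_x h = h_x + p h_y + q h_p` of a function `h` of `z = (x, y)` and
`p = y'`; here `q` stands for `y''`. -/
noncomputable def totalDeriv₁ (h : 𝕜 × 𝕜 → 𝕜 → 𝕜) (z : 𝕜 × 𝕜) (p q : 𝕜) : 𝕜 :=
  fderiv 𝕜 (fun w => h w p) z (1, p) + q * deriv (h z) p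

/-- For the vector field `X = ξ ∂_x + φ ∂_y`, with `ξ = (X ·).1` and `φ = (X ·).2`, the coefficient
`φ¹ = D_x φ - p D_x ξ` of `∂_p` in the first prolongation of `X`. -/
noncomputable def prolong₁ (X : 𝕜 × 𝕜 → 𝕜 × 𝕜) (z : 𝕜 × 𝕜) (p : 𝕜) : 𝕜 :=
  totalDeriv₀ (fun w => (X w).2) z p - p * totalDeriv₀ (fun w => (X w).1) z p

/-- The coefficient `φ² = D_x φ¹ - q D_x ξ` of `∂_q` in the second prolongation of `X`. -/
noncomputable def prolong₂ (X : 𝕜 × 𝕜 → 𝕜 × 𝕜) (z : 𝕜 × 𝕜) (p q : 𝕜) : 𝕜 :=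
  totalDeriv₁ (prolong₁ X) z p q - q * totalDeriv₀ (fun w => (X w).1) z p

/-- The vector field `X` satisfies the determining equations of `q = F(x, y, p)` over `z = (x, y)`:
the second prolongation `ξ ∂_x + φ ∂_y + φ¹ ∂_p + φ² ∂_q` of `X` annihilates `q - F(x, y, p)` on
the locus `q = F(x, y, p)`, for every `p`. -/
def InfinitesimalCriterion (E : SecondOrderODE 𝕜) (X : 𝕜 × 𝕜 → 𝕜 × 𝕜) (z : 𝕜 × 𝕜) : Prop :=
  ∀ p : 𝕜, prolong₂ X z p (E.rhs z.1 z.2 p) =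
    fderiv 𝕜 (fun w : 𝕜 × 𝕜 => E.rhs w.1 w.2 p) z (X z) +
      prolong₁ X z p * deriv (E.rhs z.1 z.2) p

theorem prolong₁_add {X Y : 𝕜 × 𝕜 → 𝕜 × 𝕜} {z : 𝕜 × 𝕜} (hX : DifferentiableAt 𝕜 X z)
    (hY : DifferentiableAt 𝕜 Y z) (p : 𝕜) :
    prolong₁ (X + Y) z p = prolong₁ X z p + prolong₁ Y z p := by
  have h1 : fderiv 𝕜 (fun w => ((X + Y) w).1) z
      = fderiv 𝕜 (fun w => (X w).1) z + fderiv 𝕜 (fun w => (Y w).1) z :=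
    fderiv_add hX.fst hY.fst
  have h2 : fderiv 𝕜 (fun w => ((X + Y) w).2) z
      = fderiv 𝕜 (fun w => (X w).2) z + fderiv 𝕜 (fun w => (Y w).2) z :=
    fderiv_add hX.snd hY.snd
  simp only [prolong₁, totalDeriv₀, h1, h2, add_apply]
  ring

theorem prolong₁_smul {X : 𝕜 × 𝕜 → 𝕜 × 𝕜} {z : 𝕜 × 𝕜} (hX : DifferentiableAt 𝕜 X z)
    (c p : 𝕜) : prolong₁ (c • X) z p = c * prolong₁ X z p := by
  have h1 : fderiv 𝕜 (fun w => ((c • X) w).1) z = c • fderiv 𝕜 (fun w => (X w).1) z :=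
    fderiv_const_smul hX.fst c
  have h2 : fderiv 𝕜 (fun w => ((c • X) w).2) z = c • fderiv 𝕜 (fun w => (X w).2) z :=
    fderiv_const_smul hX.snd c
  simp only [prolong₁, totalDeriv₀, h1, h2, smul_apply, smul_eq_mul]
  ring

theorem differentiableAt_prolong₁ {X : 𝕜 × 𝕜 → 𝕜 × 𝕜} {z : 𝕜 × 𝕜} (hX : ContDiffAt 𝕜 ∞ X z)
    (p : 𝕜) : DifferentiableAt 𝕜 (fun w => prolong₁ X w p) z := by
  have key : ∀ g : 𝕜 × 𝕜 → 𝕜, ContDiffAt 𝕜 ∞ g z →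
      DifferentiableAt 𝕜 (fun w => fderiv 𝕜 g w (1, p)) z := fun g hg =>
    ((hg.fderiv_right (m := 1) (by norm_cast)).differentiableAt (by simp)).clm_apply
      (differentiableAt_const _)
  exact (key _ hX.snd).sub ((key _ hX.fst).const_mul p)

theorem differentiable_prolong₁_right (X : 𝕜 × 𝕜 → 𝕜 × 𝕜) (z : 𝕜 × 𝕜) :
    Differentiable 𝕜 (prolong₁ X z) := by
  have h : Differentiable 𝕜 (fun p : 𝕜 => ((1 : 𝕜), p)) := by fun_prop
  have key : ∀ g : 𝕜 × 𝕜 → 𝕜, Differentiable 𝕜 (fun p : 𝕜 => fderiv 𝕜 g z (1, p)) := fun g =>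
    (fderiv 𝕜 g z).differentiable.comp h
  exact (key _).sub (differentiable_id.mul (key _))

/-- The symmetry algebra over the open set `U`: the smooth vector fields `X` on `U` (real smooth
for `𝕜 = ℝ`, holomorphic for `𝕜 = ℂ`), stored as functions that vanish off `U`, whose second
prolongation leaves the equation invariant. -/
def symmetryAlgebra (E : SecondOrderODE 𝕜) (U : TopologicalSpace.Opens (𝕜 × 𝕜)) :
    Submodule 𝕜 (𝕜 × 𝕜 → 𝕜 × 𝕜) where
  carrier := {X | (∀ z ∉ U, X z = 0) ∧ ContDiffOn 𝕜 ∞ X (U : Set (𝕜 × 𝕜)) ∧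
    ∀ z ∈ U, E.InfinitesimalCriterion X z}
  zero_mem' := by
    refine ⟨fun _ _ => rfl, contDiffOn_const, fun z _ p => ?_⟩
    have h0 : prolong₁ (0 : 𝕜 × 𝕜 → 𝕜 × 𝕜) = 0 := by
      funext w p
      simp [prolong₁, totalDeriv₀]
    simp [prolong₂, totalDeriv₁, totalDeriv₀, h0]
  add_mem' := by
    rintro X Y ⟨hX0, hX, hXE⟩ ⟨hY0, hY, hYE⟩
    refine ⟨fun z hz => by simp [hX0 z hz, hY0 z hz], hX.add hY, fun z hz p => ?_⟩
    have hXa : ∀ w ∈ U, ContDiffAt 𝕜 ∞ X w := fun w hw => hX.contDiffAt (U.isOpen.mem_nhds hw)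
    have hYa : ∀ w ∈ U, ContDiffAt 𝕜 ∞ Y w := fun w hw => hY.contDiffAt (U.isOpen.mem_nhds hw)
    have hd : ∀ w ∈ U, prolong₁ (X + Y) w = fun p => prolong₁ X w p + prolong₁ Y w p :=
      fun w hw => funext fun p => prolong₁_add ((hXa w hw).differentiableAt (by simp))
        ((hYa w hw).differentiableAt (by simp)) p
    have hf : fderiv 𝕜 (fun w => prolong₁ (X + Y) w p) z
        = fderiv 𝕜 (fun w => prolong₁ X w p) z + fderiv 𝕜 (fun w => prolong₁ Y w p) z := by
      rw [← fderiv_add (differentiableAt_prolong₁ (hXa z hz) p)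
        (differentiableAt_prolong₁ (hYa z hz) p)]
      refine Filter.EventuallyEq.fderiv_eq ?_
      filter_upwards [U.isOpen.mem_nhds hz] with w hw
      simp [hd w hw]
    have hg : deriv (prolong₁ (X + Y) z) p = deriv (prolong₁ X z) p + deriv (prolong₁ Y z) p := by
      rw [hd z hz]
      exact deriv_add (differentiable_prolong₁_right X z p) (differentiable_prolong₁_right Y z p)
    have h1 : fderiv 𝕜 (fun w => ((X + Y) w).1) z
        = fderiv 𝕜 (fun w => (X w).1) z + fderiv 𝕜 (fun w => (Y w).1) z :=
      fderiv_add ((hXa z hz).differentiableAt (by simp)).fst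
        ((hYa z hz).differentiableAt (by simp)).fst
    have hx := hXE z hz p
    have hy := hYE z hz p
    simp only [prolong₂, totalDeriv₁, totalDeriv₀] at hx hy ⊢
    rw [hf, hg, h1, hd z hz]
    simp only [add_apply, Pi.add_apply, map_add]
    linear_combination hx + hy
  smul_mem' := by
    rintro c X ⟨hX0, hX, hXE⟩
    refine ⟨fun z hz => by simp [hX0 z hz], contDiffOn_const.smul hX, fun z hz p => ?_⟩
    have hXa : ∀ w ∈ U, ContDiffAt 𝕜 ∞ X w := fun w hw => hX.contDiffAt (U.isOpen.mem_nhds hw)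
    have hd : ∀ w ∈ U, prolong₁ (c • X) w = fun p => c * prolong₁ X w p :=
      fun w hw => funext fun p => prolong₁_smul ((hXa w hw).differentiableAt (by simp)) c p
    have hf : fderiv 𝕜 (fun w => prolong₁ (c • X) w p) z
        = c • fderiv 𝕜 (fun w => prolong₁ X w p) z := by
      rw [← fderiv_const_smul (differentiableAt_prolong₁ (hXa z hz) p) c]
      refine Filter.EventuallyEq.fderiv_eq ?_
      filter_upwards [U.isOpen.mem_nhds hz] with w hw
      simp [hd w hw]
    have hg : deriv (prolong₁ (c • X) z) p = c * deriv (prolong₁ X z) p := by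
      rw [hd z hz]
      exact deriv_const_mul c (differentiable_prolong₁_right X z p)
    have h1 : fderiv 𝕜 (fun w => ((c • X) w).1) z = c • fderiv 𝕜 (fun w => (X w).1) z :=
      fderiv_const_smul ((hXa z hz).differentiableAt (by simp)).fst c
    have hx := hXE z hz p
    simp only [prolong₂, totalDeriv₁, totalDeriv₀] at hx ⊢
    rw [hf, hg, h1, hd z hz]
    simp only [smul_apply, Pi.smul_apply, map_smul, smul_eq_mul]
    linear_combination c * hx

open Classical in
/-- The vector field `∂_x` on `U`. -/
noncomputable def translationField (U : TopologicalSpace.Opens (𝕜 × 𝕜)) : 𝕜 × 𝕜 → 𝕜 × 𝕜 :=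
  fun z => if z ∈ U then (1, 0) else 0

/-- The symmetry algebra over `U`, with the commutator of vector fields, is isomorphic to the
Lie algebra `sl(3, 𝕜)`. -/
def SymmetryAlgebraIsoSl3 (E : SecondOrderODE 𝕜) (U : TopologicalSpace.Opens (𝕜 × 𝕜)) : Prop :=
  ∃ e : LieAlgebra.SpecialLinear.sl (Fin 3) 𝕜 ≃ₗ[𝕜] E.symmetryAlgebra U,
    ∀ A B : LieAlgebra.SpecialLinear.sl (Fin 3) 𝕜,
      (e ⁅A, B⁆ : 𝕜 × 𝕜 → 𝕜 × 𝕜) = VectorField.lieBracket 𝕜 (e A : 𝕜 × 𝕜 → 𝕜 × 𝕜) (e B)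

/-- For the change of variables `t = T(x, y)`, `u = V(x, y)`, the first derivative
`du/dt = D_x V / D_x T` as a function of `(x, y, y')`. -/
noncomputable def newDeriv₁ (T V : 𝕜 × 𝕜 → 𝕜) (z : 𝕜 × 𝕜) (p : 𝕜) : 𝕜 :=
  totalDeriv₀ V z p / totalDeriv₀ T z p

/-- The second derivative `d²u/dt² = D_x (du/dt) / D_x T` as a function of `(x, y, y', y'')`. -/
noncomputable def newDeriv₂ (T V : 𝕜 × 𝕜 → 𝕜) (z : 𝕜 × 𝕜) (p q : 𝕜) : 𝕜 :=
  totalDeriv₁ (newDeriv₁ T V) z p q / totalDeriv₀ T z p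

/-- Near `z₀`, an invertible smooth point transformation `(x, y) ↦ (t, u)` takes the equation into
`d²u/dt² = 0`. (Directions `p` with `D_x T = 0`, at most one over each point, are those that have
no slope `du/dt`.) -/
def LinearizableAt (E : SecondOrderODE 𝕜) (z₀ : 𝕜 × 𝕜) : Prop :=
  ∃ Φ : OpenPartialHomeomorph (𝕜 × 𝕜) (𝕜 × 𝕜), z₀ ∈ Φ.source ∧ Φ.source ⊆ E.domain ∧
    ContDiffOn 𝕜 ∞ Φ Φ.source ∧ ContDiffOn 𝕜 ∞ Φ.symm Φ.target ∧
    ∀ z ∈ Φ.source, ∀ p q : 𝕜, totalDeriv₀ (fun w => (Φ w).1) z p ≠ 0 →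
      (q = E.rhs z.1 z.2 p ↔ newDeriv₂ (fun w => (Φ w).1) (fun w => (Φ w).2) z p q = 0)

end Symmetry

end SecondOrderODE

/-! The autonomous equations among the fifty canonical equations of Painlevé and Gambier, numbered
as in Ince's list; `p` stands for `y'`. -/

namespace Ince

section Equations

variable {𝕜 : Type*} [RCLike 𝕜]

def I1 : SecondOrderODE 𝕜 where
  rhs := fun _ _ _ => 0
  domain := Set.univ

def I2 : SecondOrderODE 𝕜 where
  rhs := fun _ y _ => 6 * y ^ 2
  domain := Set.univ

noncomputable def I3 : SecondOrderODE 𝕜 where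
  rhs := fun _ y _ => 6 * y ^ 2 + 1 / 2
  domain := Set.univ

def I7 : SecondOrderODE 𝕜 where
  rhs := fun _ y _ => 2 * y ^ 3
  domain := Set.univ

def I8 (β γ : 𝕜) : SecondOrderODE 𝕜 where
  rhs := fun _ y _ => 2 * y ^ 3 + β * y + γ
  domain := Set.univ

noncomputable def I11 : SecondOrderODE 𝕜 where
  rhs := fun _ y p => p ^ 2 / y
  domain := {z | z.2 ≠ 0}

noncomputable def I12 (α β γ δ : 𝕜) : SecondOrderODE 𝕜 where
  rhs := fun _ y p => p ^ 2 / y + α * y ^ 3 + β * y ^ 2 + γ + δ / y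
  domain := {z | z.2 ≠ 0}

noncomputable def I17 (m : ℕ) : SecondOrderODE 𝕜 where
  rhs := fun _ y p => ((m : 𝕜) - 1) / (m : 𝕜) * (p ^ 2 / y)
  domain := {z | z.2 ≠ 0}

noncomputable def I18 : SecondOrderODE 𝕜 where
  rhs := fun _ y p => p ^ 2 / (2 * y) + 4 * y ^ 2
  domain := {z | z.2 ≠ 0}

noncomputable def I19 : SecondOrderODE 𝕜 where
  rhs := fun _ y p => p ^ 2 / (2 * y) + 4 * y ^ 2 + 2 * y
  domain := {z | z.2 ≠ 0}

noncomputable def I21 : SecondOrderODE 𝕜 where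
  rhs := fun _ y p => 3 / 4 * (p ^ 2 / y) + 3 * y ^ 2
  domain := {z | z.2 ≠ 0}

noncomputable def I22 : SecondOrderODE 𝕜 where
  rhs := fun _ y p => 3 / 4 * (p ^ 2 / y) - 1
  domain := {z | z.2 ≠ 0}

noncomputable def I23 (α β : 𝕜) : SecondOrderODE 𝕜 where
  rhs := fun _ y p => 3 / 4 * (p ^ 2 / y) + 3 * y ^ 2 + α * y + β
  domain := {z | z.2 ≠ 0}

noncomputable def I29 : SecondOrderODE 𝕜 where
  rhs := fun _ y p => p ^ 2 / (2 * y) + 3 / 2 * y ^ 3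
  domain := {z | z.2 ≠ 0}

noncomputable def I30 (α β γ : 𝕜) : SecondOrderODE 𝕜 where
  rhs := fun _ y p =>
    p ^ 2 / (2 * y) + 3 / 2 * y ^ 3 + 4 * α * y ^ 2 + 2 * β * y - γ ^ 2 / (2 * y)
  domain := {z | z.2 ≠ 0}

noncomputable def I32 : SecondOrderODE 𝕜 where
  rhs := fun _ y p => p ^ 2 / (2 * y) - 1 / (2 * y)
  domain := {z | z.2 ≠ 0}

noncomputable def I33 (α : 𝕜) : SecondOrderODE 𝕜 where
  rhs := fun _ y p => p ^ 2 / (2 * y) + 4 * y ^ 2 + α * y - 1 / (2 * y)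
  domain := {z | z.2 ≠ 0}

noncomputable def I37 : SecondOrderODE 𝕜 where
  rhs := fun _ y p => (1 / (2 * y) + 1 / (y - 1)) * p ^ 2
  domain := {z | z.2 ≠ 0 ∧ z.2 ≠ 1}

noncomputable def I38 (α β γ δ : 𝕜) : SecondOrderODE 𝕜 where
  rhs := fun _ y p => (1 / (2 * y) + 1 / (y - 1)) * p ^ 2 +
    y * (y - 1) * (α * (y - 1) + β * (y - 1) / y ^ 2 + γ / (y - 1) + δ / (y - 1) ^ 2)
  domain := {z | z.2 ≠ 0 ∧ z.2 ≠ 1}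

noncomputable def I41 : SecondOrderODE 𝕜 where
  rhs := fun _ y p => 2 / 3 * (1 / y + 1 / (y - 1)) * p ^ 2
  domain := {z | z.2 ≠ 0 ∧ z.2 ≠ 1}

noncomputable def I43 : SecondOrderODE 𝕜 where
  rhs := fun _ y p => 3 / 4 * (1 / y + 1 / (y - 1)) * p ^ 2
  domain := {z | z.2 ≠ 0 ∧ z.2 ≠ 1}

noncomputable def I44 (α β γ : 𝕜) : SecondOrderODE 𝕜 where
  rhs := fun _ y p => 3 / 4 * (1 / y + 1 / (y - 1)) * p ^ 2 +
    y * (y - 1) * (α / y + β / (y - 1) + 2 * γ * (2 * y - 1))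
  domain := {z | z.2 ≠ 0 ∧ z.2 ≠ 1}

noncomputable def I49 (a α β γ δ : 𝕜) : SecondOrderODE 𝕜 where
  rhs := fun _ y p => 1 / 2 * (1 / y + 1 / (y - 1) + 1 / (y - a)) * p ^ 2 +
    y * (y - 1) * (y - a) * (α + β / y ^ 2 + γ / (y - 1) ^ 2 + δ / (y - a) ^ 2)
  domain := {z | z.2 ≠ 0 ∧ z.2 ≠ 1 ∧ z.2 ≠ a}

/-- The table of the autonomous equations and of the dimensions assigned to them. In the families
with parameters, the values for which the equation degenerates (to an equation with a larger
symmetry algebra, such as `I7` inside `I8` or `I11` inside `I12`) are left out. -/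
inductive AutonomousTable : SecondOrderODE 𝕜 → ℕ → Prop
  | I1 : AutonomousTable I1 8
  | I2 : AutonomousTable I2 2
  | I3 : AutonomousTable I3 1
  | I7 : AutonomousTable I7 2
  | I8 (β γ : 𝕜) (h : β ≠ 0 ∨ γ ≠ 0) : AutonomousTable (I8 β γ) 1
  | I11 : AutonomousTable I11 8
  | I12 (α β γ δ : 𝕜)
      (h : (α ≠ 0 ∧ β ≠ 0) ∨ (α ≠ 0 ∧ γ ≠ 0) ∨ (α ≠ 0 ∧ δ ≠ 0) ∨
        (β ≠ 0 ∧ γ ≠ 0) ∨ (β ≠ 0 ∧ δ ≠ 0) ∨ (γ ≠ 0 ∧ δ ≠ 0)) :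
      AutonomousTable (I12 α β γ δ) 1
  | I17 (m : ℕ) (hm : 2 ≤ m) : AutonomousTable (I17 m) 8
  | I18 : AutonomousTable I18 2
  | I19 : AutonomousTable I19 1
  | I21 : AutonomousTable I21 2
  | I22 : AutonomousTable I22 3
  | I23 (α β : 𝕜) (h : α ≠ 0 ∨ β ≠ 0) : AutonomousTable (I23 α β) 1
  | I29 : AutonomousTable I29 2
  | I30 (α β γ : 𝕜) (h : α ≠ 0 ∨ β ≠ 0 ∨ γ ≠ 0) : AutonomousTable (I30 α β γ) 1
  | I32 : AutonomousTable I32 3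
  | I33 (α : 𝕜) : AutonomousTable (I33 α) 1
  | I37 : AutonomousTable I37 8
  | I38 (α β γ δ : 𝕜) (h : α ≠ 0 ∨ β ≠ 0 ∨ γ ≠ 0 ∨ δ ≠ 0) : AutonomousTable (I38 α β γ δ) 1
  | I41 : AutonomousTable I41 8
  | I43 : AutonomousTable I43 8
  | I44 (α β γ : 𝕜) (h : α ≠ 0 ∨ β ≠ 0 ∨ γ ≠ 0) : AutonomousTable (I44 α β γ) 1
  | I49 (a α β γ δ : 𝕜) (ha₀ : a ≠ 0) (ha₁ : a ≠ 1)
      (h : α ≠ 0 ∨ β ≠ 0 ∨ γ ≠ 0 ∨ δ ≠ 0) : AutonomousTable (I49 a α β γ δ) 1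

end Equations

end Ince

/-! Every equation of the table has the form y'' = a(y) y'² + b(y) with a, b rational in y. For ξ
∂_x + φ ∂_y the invariance condition is a cubic polynomial in p = y', so it splits into the four
equations of `IsSymm`. The argument turns on the function B = b' - a b.

Cross differentiation gives ξ_xxy = B ξ_y, and comparison with ξ_yy = -a ξ_y gives B' ξ_y = 0
(`IsSymm.dy_mul_dy_eq_zero`). If B is not constant, then ξ and ψ = φ_y - a φ depend on x alone, 2
ψ_x = ξ_xx, and φ B' + 2 ξ_x B = ψ_xx. Hence on each vertical line φ is a rational function of y
that solves w' = a w + ψ with ψ constant. The residues of a at its finite poles exclude poles of w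
(`dvd_of_rational_solution`), and its behaviour at infinity excludes degree two or more
(`natDegree_le_one_of_solution`), so φ is affine in y (`RationalCoeffs.exists_affine`). The rest is
comparison of coefficients.

If a has poles at 0 and at 1, the affine function vanishes at both points; then φ = 0, ξ_x = 0, and
only ∂_x remains. If a = s/y, then φ = l y, and each power y^d in B with d ≠ 0 forces l d = -2 ξ_x.
Two such powers leave only ∂_x. A single one gives the weight μ = -2/d with φ = μ y ξ_x, and 2 μ (1
- s) ξ_xx = ξ_xx. Away from the resonance 2 μ (1 - s) = 1 this leaves ∂_x and a scaling, and a
constant term in B destroys the scaling. At the resonance, and without a constant term, ξ may be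
quadratic in x, which gives dimension 3. The case a = 0 is similar.

If b = 0, the coordinate h(y) with h' = exp(-∫ a) satisfies h_xx = h' (y'' - a y'²), so the equation
becomes that of straight lines. Its symmetries are the projective vector fields in (x, h), a copy of
sl(3) (`FlatFrame.exists_proj_of_isSymm`, `FlatFrame.lieBracket_proj`).

Convexity of U makes U and its vertical slices connected and supplies primitives. -/

namespace PlaneSymmetry

/-! ### Smooth functions on U as an algebra with the derivations ∂_x and ∂_y. -/

open TopologicalSpace SecondOrderODE

variable {𝕜 : Type*} [RCLike 𝕜] {U : Opens (𝕜 × 𝕜)}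

open Classical in
/-- Extension by zero of a function on `U`. -/
noncomputable def extendZero (f : U → 𝕜) : 𝕜 × 𝕜 → 𝕜 :=
  fun z => if h : z ∈ U then f ⟨z, h⟩ else 0

theorem extendZero_coe (f : U → 𝕜) (z : U) : extendZero f z = f z := by
  simp [extendZero]

theorem extendZero_of_mem (f : U → 𝕜) {z : 𝕜 × 𝕜} (hz : z ∈ U) :
    extendZero f z = f ⟨z, hz⟩ := by
  simp [extendZero, hz]

theorem extendZero_of_notMem (f : U → 𝕜) {z : 𝕜 × 𝕜} (hz : z ∉ U) : extendZero f z = 0 := by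
  simp [extendZero, hz]

theorem extendZero_restrict_eqOn (F : 𝕜 × 𝕜 → 𝕜) :
    Set.EqOn (extendZero (fun z : U => F z)) F U := fun z hz => by
  simp [extendZero_of_mem _ hz]

/-- The algebra of smooth functions on `U`. -/
def smoothAlg (U : Opens (𝕜 × 𝕜)) : Subalgebra 𝕜 (U → 𝕜) where
  carrier := {f | ContDiffOn 𝕜 ∞ (extendZero f) U}
  mul_mem' {f g} hf hg := (ContDiffOn.mul hf hg).congr fun z hz => by
    simp [extendZero_of_mem _ hz]
  add_mem' {f g} hf hg := (ContDiffOn.add hf hg).congr fun z hz => by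
    simp [extendZero_of_mem _ hz]
  algebraMap_mem' c := (contDiffOn_const (c := c)).congr fun z hz => by
    simp [extendZero_of_mem _ hz]

/-- Smooth functions on `U`. -/
abbrev SmoothFun (U : Opens (𝕜 × 𝕜)) : Type _ := smoothAlg U

namespace SmoothFun

/-- A smooth function on `U`, extended by zero to the plane. -/
noncomputable def ext (f : SmoothFun U) : 𝕜 × 𝕜 → 𝕜 := extendZero f.1

theorem contDiffOn (f : SmoothFun U) : ContDiffOn 𝕜 ∞ f.ext U := f.2

theorem contDiffAt (f : SmoothFun U) {z : 𝕜 × 𝕜} (hz : z ∈ U) : ContDiffAt 𝕜 ∞ f.ext z :=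
  f.contDiffOn.contDiffAt (U.isOpen.mem_nhds hz)

theorem differentiableAt (f : SmoothFun U) {z : 𝕜 × 𝕜} (hz : z ∈ U) :
    DifferentiableAt 𝕜 f.ext z :=
  (f.contDiffAt hz).differentiableAt (by simp)

theorem ext_of_mem (f : SmoothFun U) {z : 𝕜 × 𝕜} (hz : z ∈ U) : f.ext z = f.1 ⟨z, hz⟩ :=
  extendZero_of_mem _ hz

@[simp] theorem ext_coe (f : SmoothFun U) (z : U) : f.ext z = f.1 z := extendZero_coe _ z

/-- Restriction to `U` of a function that is smooth there. -/
def ofContDiffOn (F : 𝕜 × 𝕜 → 𝕜) (hF : ContDiffOn 𝕜 ∞ F U) : SmoothFun U :=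
  ⟨fun z => F z, hF.congr (extendZero_restrict_eqOn F)⟩

@[simp] theorem ofContDiffOn_apply (F : 𝕜 × 𝕜 → 𝕜) (hF : ContDiffOn 𝕜 ∞ F U) (z : U) :
    (ofContDiffOn F hF).1 z = F z := rfl

theorem ext_ofContDiffOn (F : 𝕜 × 𝕜 → 𝕜) (hF : ContDiffOn 𝕜 ∞ F U) :
    Set.EqOn (ofContDiffOn F hF).ext F U := extendZero_restrict_eqOn F

theorem fderiv_ext_ofContDiffOn (F : 𝕜 × 𝕜 → 𝕜) (hF : ContDiffOn 𝕜 ∞ F U) {z : 𝕜 × 𝕜}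
    (hz : z ∈ U) : fderiv 𝕜 (ofContDiffOn F hF).ext z = fderiv 𝕜 F z :=
  ((ext_ofContDiffOn F hF).eventuallyEq_of_mem (U.isOpen.mem_nhds hz)).fderiv_eq

theorem contDiffOn_fderiv (f : SmoothFun U) (v : 𝕜 × 𝕜) :
    ContDiffOn 𝕜 ∞ (fun z => fderiv 𝕜 f.ext z v) U := fun z hz =>
  (((f.contDiffAt hz).fderiv_right (m := ∞) (by simp)).clm_apply
    contDiffAt_const).contDiffWithinAt

theorem fderiv_ext_add (f g : SmoothFun U) {z : 𝕜 × 𝕜} (hz : z ∈ U) :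
    fderiv 𝕜 (f + g).ext z = fderiv 𝕜 f.ext z + fderiv 𝕜 g.ext z := by
  rw [← fderiv_add (f.differentiableAt hz) (g.differentiableAt hz)]
  refine Filter.EventuallyEq.fderiv_eq ?_
  filter_upwards [U.isOpen.mem_nhds hz] with w hw
  simp [ext_of_mem _ hw]

theorem fderiv_ext_mul (f g : SmoothFun U) {z : 𝕜 × 𝕜} (hz : z ∈ U) :
    fderiv 𝕜 (f * g).ext z = f.ext z • fderiv 𝕜 g.ext z + g.ext z • fderiv 𝕜 f.ext z := by
  rw [← fderiv_mul (f.differentiableAt hz) (g.differentiableAt hz)]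
  refine Filter.EventuallyEq.fderiv_eq ?_
  filter_upwards [U.isOpen.mem_nhds hz] with w hw
  simp [ext_of_mem _ hw]

theorem fderiv_ext_smul (c : 𝕜) (f : SmoothFun U) {z : 𝕜 × 𝕜} (hz : z ∈ U) :
    fderiv 𝕜 (c • f).ext z = c • fderiv 𝕜 f.ext z := by
  rw [← fderiv_const_smul (f.differentiableAt hz)]
  refine Filter.EventuallyEq.fderiv_eq ?_
  filter_upwards [U.isOpen.mem_nhds hz] with w hw
  simp [ext_of_mem _ hw]

/-- The directional derivative along a constant vector, as a derivation of the smooth functions. -/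
noncomputable def dirDeriv (U : Opens (𝕜 × 𝕜)) (v : 𝕜 × 𝕜) : Derivation 𝕜 (SmoothFun U) (SmoothFun U) :=
  Derivation.mk'
    { toFun := fun f => ofContDiffOn (fun z => fderiv 𝕜 f.ext z v) (f.contDiffOn_fderiv v)
      map_add' := fun f g => Subtype.ext <| funext fun z => by
        simp [fderiv_ext_add f g z.2]
      map_smul' := fun c f => Subtype.ext <| funext fun z => by
        simp [fderiv_ext_smul c f z.2] }
    fun f g => Subtype.ext <| funext fun z => by
      simp [fderiv_ext_mul f g z.2]

theorem dirDeriv_apply (v : 𝕜 × 𝕜) (f : SmoothFun U) (z : U) :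
    (dirDeriv U v f).1 z = fderiv 𝕜 f.ext z v := rfl

theorem dirDeriv_comm (v w : 𝕜 × 𝕜) (f : SmoothFun U) :
    dirDeriv U v (dirDeriv U w f) = dirDeriv U w (dirDeriv U v f) := by
  have key : ∀ (v w : 𝕜 × 𝕜) (z : U),
      (dirDeriv U v (dirDeriv U w f)).1 z = fderiv 𝕜 (fderiv 𝕜 f.ext) z v w := by
    intro v w z
    rw [dirDeriv_apply]
    have h1 : fderiv 𝕜 (dirDeriv U w f).ext z = fderiv 𝕜 (fun z => fderiv 𝕜 f.ext z w) z :=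
      fderiv_ext_ofContDiffOn _ _ z.2
    have h2 : DifferentiableAt 𝕜 (fderiv 𝕜 f.ext) z :=
      ((f.contDiffAt z.2).fderiv_right (m := 1) (by norm_cast)).differentiableAt (by simp)
    rw [h1, fderiv_clm_apply h2 (differentiableAt_const _)]
    simp
  refine Subtype.ext <| funext fun z => ?_
  rw [key, key]
  exact ((f.contDiffAt z.2).isSymmSndFDerivAt (by simp; norm_cast)) v w

/-- The partial derivative `∂_x`. -/
noncomputable def dx (f : SmoothFun U) : SmoothFun U := dirDeriv U (1, 0) f

/-- The partial derivative `∂_y`. -/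
noncomputable def dy (f : SmoothFun U) : SmoothFun U := dirDeriv U (0, 1) f

@[simp] theorem dx_add (f g : SmoothFun U) : dx (f + g) = dx f + dx g := map_add (dirDeriv U (1, 0)) f g

@[simp] theorem dx_sub (f g : SmoothFun U) : dx (f - g) = dx f - dx g := map_sub (dirDeriv U (1, 0)) f g

@[simp] theorem dx_neg (f : SmoothFun U) : dx (-f) = -dx f := map_neg (dirDeriv U (1, 0)) f

@[simp] theorem dx_mul (f g : SmoothFun U) : dx (f * g) = f * dx g + g * dx f :=
  (dirDeriv U (1, 0)).leibniz f g

@[simp] theorem dx_pow (f : SmoothFun U) (n : ℕ) : dx (f ^ n) = n * f ^ (n - 1) * dx f := by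
  rw [dx, Derivation.leibniz_pow, nsmul_eq_mul, smul_eq_mul, mul_assoc]; rfl

@[simp] theorem dx_zero : dx (0 : SmoothFun U) = 0 := map_zero (dirDeriv U (1, 0))

@[simp] theorem dx_one : dx (1 : SmoothFun U) = 0 := (dirDeriv U (1, 0)).map_one_eq_zero

@[simp] theorem dx_ofNat (n : ℕ) [n.AtLeastTwo] : dx (ofNat(n) : SmoothFun U) = 0 :=
  (dirDeriv U (1, 0)).map_natCast n

@[simp] theorem dx_algebraMap (c : 𝕜) : dx (algebraMap 𝕜 (SmoothFun U) c) = 0 :=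
  (dirDeriv U (1, 0)).map_algebraMap c

@[simp] theorem dy_add (f g : SmoothFun U) : dy (f + g) = dy f + dy g := map_add (dirDeriv U (0, 1)) f g

@[simp] theorem dy_sub (f g : SmoothFun U) : dy (f - g) = dy f - dy g := map_sub (dirDeriv U (0, 1)) f g

@[simp] theorem dy_neg (f : SmoothFun U) : dy (-f) = -dy f := map_neg (dirDeriv U (0, 1)) f

@[simp] theorem dy_mul (f g : SmoothFun U) : dy (f * g) = f * dy g + g * dy f :=
  (dirDeriv U (0, 1)).leibniz f g

@[simp] theorem dy_pow (f : SmoothFun U) (n : ℕ) : dy (f ^ n) = n * f ^ (n - 1) * dy f := by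
  rw [dy, Derivation.leibniz_pow, nsmul_eq_mul, smul_eq_mul, mul_assoc]; rfl

@[simp] theorem dy_zero : dy (0 : SmoothFun U) = 0 := map_zero (dirDeriv U (0, 1))

@[simp] theorem dy_one : dy (1 : SmoothFun U) = 0 := (dirDeriv U (0, 1)).map_one_eq_zero

@[simp] theorem dy_ofNat (n : ℕ) [n.AtLeastTwo] : dy (ofNat(n) : SmoothFun U) = 0 :=
  (dirDeriv U (0, 1)).map_natCast n

@[simp] theorem dy_algebraMap (c : 𝕜) : dy (algebraMap 𝕜 (SmoothFun U) c) = 0 :=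
  (dirDeriv U (0, 1)).map_algebraMap c

theorem dx_apply (f : SmoothFun U) (z : U) : (dx f).1 z = fderiv 𝕜 f.ext z (1, 0) := rfl

theorem dy_apply (f : SmoothFun U) (z : U) : (dy f).1 z = fderiv 𝕜 f.ext z (0, 1) := rfl

theorem dy_dx (f : SmoothFun U) : dy (dx f) = dx (dy f) := dirDeriv_comm _ _ f

theorem fderiv_ext_eq (f : SmoothFun U) (z : U) (v : 𝕜 × 𝕜) :
    fderiv 𝕜 f.ext z v = v.1 * (dx f).1 z + v.2 * (dy f).1 z := by
  have : v = v.1 • ((1, 0) : 𝕜 × 𝕜) + v.2 • ((0, 1) : 𝕜 × 𝕜) := by ext <;> simp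
  conv_lhs => rw [this]
  rw [map_add, map_smul, map_smul, dx_apply, dy_apply, smul_eq_mul, smul_eq_mul]

theorem ext_iff_apply {f g : SmoothFun U} : f = g ↔ ∀ z : U, f.1 z = g.1 z :=
  ⟨fun h _ => h ▸ rfl, fun h => Subtype.ext (funext h)⟩

@[simp] theorem algebraMap_apply (c : 𝕜) (z : U) : (algebraMap 𝕜 (SmoothFun U) c).1 z = c := rfl

@[simp] theorem ofNat_apply (n : ℕ) [n.AtLeastTwo] (z : U) :
    (ofNat(n) : SmoothFun U).1 z = ofNat(n) := rfl

/-- The coordinate function `x`. -/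
def coordX : SmoothFun U := ofContDiffOn Prod.fst contDiff_fst.contDiffOn

/-- The coordinate function `y`. -/
def coordY : SmoothFun U := ofContDiffOn Prod.snd contDiff_snd.contDiffOn

@[simp] theorem coordX_apply (z : U) : (coordX : SmoothFun U).1 z = z.1.1 := rfl

@[simp] theorem coordY_apply (z : U) : (coordY : SmoothFun U).1 z = z.1.2 := rfl

@[simp] theorem dx_coordX : dx (coordX : SmoothFun U) = 1 := ext_iff_apply.2 fun z => by
  rw [dx_apply, coordX, fderiv_ext_ofContDiffOn _ _ z.2, fderiv_fst]; rfl

@[simp] theorem dy_coordX : dy (coordX : SmoothFun U) = 0 := ext_iff_apply.2 fun z => by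
  rw [dy_apply, coordX, fderiv_ext_ofContDiffOn _ _ z.2, fderiv_fst]; rfl

@[simp] theorem dx_coordY : dx (coordY : SmoothFun U) = 0 := ext_iff_apply.2 fun z => by
  rw [dx_apply, coordY, fderiv_ext_ofContDiffOn _ _ z.2, fderiv_snd]; rfl

@[simp] theorem dy_coordY : dy (coordY : SmoothFun U) = 1 := ext_iff_apply.2 fun z => by
  rw [dy_apply, coordY, fderiv_ext_ofContDiffOn _ _ z.2, fderiv_snd]; rfl

/-- The function `1 / (y - r)` on a set that does not meet the line `y = r`. -/
noncomputable def poleAt (r : 𝕜) (h : ∀ z ∈ U, z.2 ≠ r) : SmoothFun U :=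
  ofContDiffOn (fun z => (z.2 - r)⁻¹) fun z hz =>
    ((contDiff_snd.contDiffWithinAt.sub contDiffWithinAt_const).inv (sub_ne_zero.2 (h z hz)))

@[simp] theorem poleAt_apply (r : 𝕜) (h : ∀ z ∈ U, z.2 ≠ r) (z : U) :
    (poleAt r h).1 z = (z.1.2 - r)⁻¹ := rfl

theorem mul_poleAt (r : 𝕜) (h : ∀ z ∈ U, z.2 ≠ r) :
    (coordY - algebraMap 𝕜 _ r) * poleAt r h = 1 := ext_iff_apply.2 fun z => by
  have := sub_ne_zero.2 (h z z.2)
  simp [this]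

@[simp] theorem dx_poleAt (r : 𝕜) (h : ∀ z ∈ U, z.2 ≠ r) : dx (poleAt r h) = 0 := by
  have h1 := mul_poleAt r h
  have h2 := congrArg dx h1
  simp at h2
  linear_combination poleAt r h * h2 - dx (poleAt r h) * h1

@[simp] theorem dy_poleAt (r : 𝕜) (h : ∀ z ∈ U, z.2 ≠ r) :
    dy (poleAt r h) = -poleAt r h ^ 2 := by
  have h1 := mul_poleAt r h
  have h2 := congrArg dy h1
  simp at h2
  linear_combination poleAt r h * h2 - dy (poleAt r h) * h1

theorem eq_of_fderiv_eq_zero (hU : Convex ℝ (U : Set (𝕜 × 𝕜))) {f : SmoothFun U}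
    (h1 : dx f = 0) (h2 : dy f = 0) (z w : U) : f.1 z = f.1 w := by
  rw [← f.ext_coe, ← f.ext_coe]
  refine U.isOpen.is_const_of_fderiv_eq_zero (𝕜 := 𝕜) hU.isPreconnected
    (f.contDiffOn.differentiableOn (by simp)) (fun u hu => ?_) z.2 w.2
  ext <;> simp [fderiv_ext_eq f ⟨u, hu⟩, h1, h2]

theorem exists_eq_algebraMap (hU : Convex ℝ (U : Set (𝕜 × 𝕜))) {f : SmoothFun U}
    (h1 : dx f = 0) (h2 : dy f = 0) : ∃ c : 𝕜, f = algebraMap 𝕜 _ c := by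
  rcases isEmpty_or_nonempty U with h | ⟨⟨w⟩⟩
  · exact ⟨0, ext_iff_apply.2 fun z => isEmptyElim z⟩
  · exact ⟨f.1 w, ext_iff_apply.2 fun z => eq_of_fderiv_eq_zero hU h1 h2 z w⟩

/-- The set of the `y` with `(x, y) ∈ U`. -/
def slice (U : Opens (𝕜 × 𝕜)) (x : 𝕜) : Set 𝕜 := {y | (x, y) ∈ U}

theorem isOpen_slice (x : 𝕜) : IsOpen (slice U x) :=
  U.isOpen.preimage (Continuous.prodMk_right x)

theorem convex_slice (hU : Convex ℝ (U : Set (𝕜 × 𝕜))) (x : 𝕜) : Convex ℝ (slice U x) := by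
  intro y hy y' hy' s t hs ht hst
  have := hU hy hy' hs ht hst
  have h1 : s • x + t • x = x := by rw [← add_smul, hst, one_smul]
  simpa [slice, h1] using this

theorem hasDerivAt_slice (f : SmoothFun U) (z : U) :
    HasDerivAt (fun y => f.ext (z.1.1, y)) ((dy f).1 z) z.1.2 := by
  have h1 : HasFDerivAt f.ext (fderiv 𝕜 f.ext z) (z.1.1, z.1.2) :=
    (f.differentiableAt z.2).hasFDerivAt
  have h2 : HasDerivAt (fun y => (z.1.1, y)) ((0 : 𝕜), (1 : 𝕜)) z.1.2 :=
    (hasDerivAt_const _ _).prodMk (hasDerivAt_id _)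
  exact h1.comp_hasDerivAt z.1.2 h2

/-- Vertical slices of a convex set are convex, hence connected. If only U were connected, a slice
could have several components with different values. -/
theorem eq_of_dy_eq_zero (hU : Convex ℝ (U : Set (𝕜 × 𝕜))) {f : SmoothFun U} (h : dy f = 0)
    (z w : U) (hzw : z.1.1 = w.1.1) : f.1 z = f.1 w := by
  have hd : ∀ y ∈ slice U w.1.1, HasDerivAt (fun y => f.ext (w.1.1, y)) 0 y := fun y hy => by
    simpa [h] using hasDerivAt_slice f ⟨(w.1.1, y), hy⟩
  have h1 : z.1.2 ∈ slice U w.1.1 := by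
    simp only [slice, ← hzw]; exact z.2
  have := (isOpen_slice (U := U) w.1.1).is_const_of_deriv_eq_zero (convex_slice hU _).isPreconnected
    (fun y hy => (hd y hy).differentiableAt.differentiableWithinAt) (fun y hy => (hd y hy).deriv)
    h1 (y := w.1.2) w.2
  rw [← f.ext_coe, ← f.ext_coe, ← Prod.mk.eta (p := z.1), hzw]
  exact this

theorem infinite_slice {x y : 𝕜} (h : (x, y) ∈ U) : (slice U x).Infinite :=
  infinite_of_mem_nhds y ((isOpen_slice x).mem_nhds h)

theorem algebraMap_injective (hU : (U : Set (𝕜 × 𝕜)).Nonempty) :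
    Function.Injective (algebraMap 𝕜 (SmoothFun U)) := fun c d h => by
  obtain ⟨z, hz⟩ := hU
  exact ext_iff_apply.1 h ⟨z, hz⟩

theorem mul_cancel_of_ne_zero {c : 𝕜} (hc : c ≠ 0) {f g : SmoothFun U}
    (h : algebraMap 𝕜 _ c * f = algebraMap 𝕜 _ c * g) : f = g :=
  ext_iff_apply.2 fun z => mul_left_cancel₀ hc (ext_iff_apply.1 h z)

theorem aeval_coordY_apply (p : Polynomial 𝕜) (z : U) :
    (Polynomial.aeval (coordY : SmoothFun U) p).1 z = p.eval z.1.2 := by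
  have h := Polynomial.aeval_algHom_apply
    ((Pi.evalAlgHom 𝕜 (fun _ : U => 𝕜) z).comp (smoothAlg U).val) (coordY : SmoothFun U) p
  simp only [AlgHom.comp_apply] at h
  rw [← Polynomial.coe_aeval_eq_eval]
  exact h.symm

/-- If g y were nonzero, g would have no zero near y, and a whole neighbourhood would consist of
roots of p. The lemma lets a polynomial factor be cancelled even at its own zeros. -/
theorem eq_zero_of_eval_mul_eq_zero {p : Polynomial 𝕜} (hp : p ≠ 0) {g : 𝕜 → 𝕜} {y : 𝕜}
    (hg : ContinuousAt g y) (h : ∀ᶠ t in nhds y, p.eval t * g t = 0) : g y = 0 := by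
  by_contra hne
  refine infinite_of_mem_nhds y ((hg.eventually_ne hne).and h) ?_
  refine (p.roots.toFinset.finite_toSet).subset fun t ht => ?_
  obtain ⟨h1, h2⟩ : g t ≠ 0 ∧ p.eval t * g t = 0 := ht
  simpa [hp] using (mul_eq_zero.1 h2).resolve_right h1

theorem eventually_mem_slice (z : U) : ∀ᶠ y in nhds z.1.2, y ∈ slice U z.1.1 :=
  (isOpen_slice z.1.1).mem_nhds z.2

theorem eq_zero_of_aeval_mul_eq_zero {p : Polynomial 𝕜} (hp : p ≠ 0) {f : SmoothFun U}
    (h : Polynomial.aeval coordY p * f = 0) : f = 0 := by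
  refine ext_iff_apply.2 fun z => ?_
  have h1 := eq_zero_of_eval_mul_eq_zero hp (hasDerivAt_slice f z).continuousAt
    ((eventually_mem_slice z).mono fun y hy => by
      have := ext_iff_apply.1 h ⟨(z.1.1, y), hy⟩
      simpa [aeval_coordY_apply, ext_of_mem f hy] using this)
  simpa using h1

theorem eq_zero_of_aeval_eq_zero (hU : (U : Set (𝕜 × 𝕜)).Nonempty) {p : Polynomial 𝕜}
    (h : Polynomial.aeval (coordY : SmoothFun U) p = 0) : p = 0 := by
  by_contra hp
  obtain ⟨z, hz⟩ := hU
  exact one_ne_zero (α := 𝕜)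
    (ext_iff_apply.1 (eq_zero_of_aeval_mul_eq_zero hp (f := 1) (by simp [h])) ⟨z, hz⟩)

theorem dy_aeval (p : Polynomial 𝕜) : dy (Polynomial.aeval (coordY : SmoothFun U) p) =
    Polynomial.aeval coordY (Polynomial.derivative p) := by
  have h : dy (Polynomial.aeval (coordY : SmoothFun U) p) =
      Polynomial.aeval coordY (Polynomial.derivative p) • dy coordY :=
    (dirDeriv U (0, 1)).map_aeval p coordY
  rw [h, dy_coordY, smul_eq_mul, mul_one]

end SmoothFun

end PlaneSymmetry

/-! ### The determining equations of y'' = a y'² + b. -/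

namespace PlaneSymmetry

open TopologicalSpace SecondOrderODE SmoothFun

variable {𝕜 : Type*} [RCLike 𝕜] {U : Opens (𝕜 × 𝕜)}

/-- The determining equations for the point symmetries `ξ ∂_x + φ ∂_y` of `y'' = a y'² + b`, where
`a` and `b` are functions of `y`. -/
structure IsSymm (a b ξ φ : SmoothFun U) : Prop where
  cubic : dy (dy ξ) + a * dy ξ = 0
  quadratic : dy (dy φ - a * φ) = 2 * dx (dy ξ)
  linear : 2 * dx (dy φ - a * φ) = dx (dx ξ) + 3 * b * dy ξ
  const : dx (dx φ) + b * (dy φ - 2 * dx ξ) = φ * dy b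

/-- The vector field `ξ ∂_x + φ ∂_y`, extended by zero. -/
noncomputable def field (ξ φ : SmoothFun U) : 𝕜 × 𝕜 → 𝕜 × 𝕜 := fun z => (ξ.ext z, φ.ext z)

theorem prolong₁_field (ξ φ : SmoothFun U) (z : U) (p : 𝕜) :
    prolong₁ (field ξ φ) z p = (dx φ + algebraMap 𝕜 _ p * (dy φ - dx ξ) -
      algebraMap 𝕜 _ p ^ 2 * dy ξ).1 z := by
  have h1 := fderiv_ext_eq ξ z (1, p)
  have h2 := fderiv_ext_eq φ z (1, p)
  simp only [prolong₁, totalDeriv₀, field]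
  rw [h1, h2]
  simp
  ring

theorem prolong₂_field (ξ φ : SmoothFun U) (z : U) (p q : 𝕜) :
    prolong₂ (field ξ φ) z p q = (dx (dx φ)).1 z + p * (2 * (dx (dy φ)).1 z - (dx (dx ξ)).1 z) +
      p ^ 2 * ((dy (dy φ)).1 z - 2 * (dx (dy ξ)).1 z) - p ^ 3 * (dy (dy ξ)).1 z +
      q * ((dy φ).1 z - 2 * (dx ξ).1 z - 3 * p * (dy ξ).1 z) := by
  set g : SmoothFun U := dx φ + algebraMap 𝕜 _ p * (dy φ - dx ξ) - algebraMap 𝕜 _ p ^ 2 * dy ξ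
    with hg
  have h1 : fderiv 𝕜 (fun w => prolong₁ (field ξ φ) w p) z = fderiv 𝕜 g.ext z := by
    refine Filter.EventuallyEq.fderiv_eq ?_
    filter_upwards [U.isOpen.mem_nhds z.2] with w hw
    rw [prolong₁_field ξ φ ⟨w, hw⟩ p, g.ext_of_mem hw]
  have h2 : deriv (prolong₁ (field ξ φ) z) p =
      ((dy φ).1 z - (dx ξ).1 z) - 2 * p * (dy ξ).1 z := by
    have : prolong₁ (field ξ φ) z = fun p => (dx φ).1 z + p * ((dy φ).1 z - (dx ξ).1 z) -
        p ^ 2 * (dy ξ).1 z := by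
      funext p
      rw [prolong₁_field]
      simp
    rw [this]
    have h3 : HasDerivAt (fun p : 𝕜 => (dx φ).1 z + p * ((dy φ).1 z - (dx ξ).1 z) -
        p ^ 2 * (dy ξ).1 z) (0 + 1 * ((dy φ).1 z - (dx ξ).1 z) -
          ((2 : ℕ) * p ^ (2 - 1) * 1) * (dy ξ).1 z) p :=
      ((hasDerivAt_const p _).add ((hasDerivAt_id p).mul_const _)).sub
        (((hasDerivAt_id p).pow 2).mul_const _)
    rw [h3.deriv]
    simp
  have h4 := fderiv_ext_eq g z (1, p)
  have h5 := fderiv_ext_eq ξ z (1, p)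
  simp only [prolong₂, totalDeriv₁, totalDeriv₀]
  rw [h1, h2, h4]
  have h6 : fderiv 𝕜 (fun w => (field ξ φ w).1) z (1, p) = fderiv 𝕜 ξ.ext z (1, p) := rfl
  rw [h6, h5, hg]
  simp [dy_dx]
  ring

/-- As `a` and `b` are independent of x, ξ does not differentiate the right-hand side. After
substitution of q = a p² + b, the coefficients of the powers of p are the differences of the two
sides of the four fields of `IsSymm`. -/
theorem infinitesimalCriterion_iff {E : SecondOrderODE 𝕜} {a b : SmoothFun U}
    (hE : ∀ z : U, ∀ p, E.rhs z.1.1 z.1.2 p = a.1 z * p ^ 2 + b.1 z) (ha : dx a = 0)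
    (hb : dx b = 0) (ξ φ : SmoothFun U) (z : U) :
    E.InfinitesimalCriterion (field ξ φ) z ↔ ∀ p : 𝕜,
      (dx (dx φ) + b * (dy φ - 2 * dx ξ) - φ * dy b).1 z +
      p * (2 * dx (dy φ - a * φ) - (dx (dx ξ) + 3 * b * dy ξ)).1 z +
      p ^ 2 * (dy (dy φ - a * φ) - 2 * dx (dy ξ)).1 z -
      p ^ 3 * (dy (dy ξ) + a * dy ξ).1 z = 0 := by
  refine forall_congr' fun p => ?_
  have h1 : fderiv 𝕜 (fun w : 𝕜 × 𝕜 => E.rhs w.1 w.2 p) (z : 𝕜 × 𝕜) =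
      fderiv 𝕜 (a * algebraMap 𝕜 _ p ^ 2 + b).ext (z : 𝕜 × 𝕜) := by
    refine Filter.EventuallyEq.fderiv_eq ?_
    filter_upwards [U.isOpen.mem_nhds z.2] with w hw
    rw [hE ⟨w, hw⟩ p, ext_of_mem _ hw]
    simp
  have h2 : deriv (E.rhs z.1.1 z.1.2) p = 2 * a.1 z * p := by
    have : E.rhs z.1.1 z.1.2 = fun p => a.1 z * p ^ 2 + b.1 z := funext (hE z)
    rw [this]
    have h3 : HasDerivAt (fun p : 𝕜 => a.1 z * p ^ 2 + b.1 z)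
        (a.1 z * ((2 : ℕ) * p ^ (2 - 1) * 1)) p :=
      (((hasDerivAt_id p).pow 2).const_mul _).add_const _
    rw [h3.deriv]
    simp
    ring
  rw [h1, h2, hE, prolong₁_field, prolong₂_field, fderiv_ext_eq]
  rw [← sub_eq_zero]
  refine Eq.congr ?_ rfl
  simp [ha, hb, field]
  ring

/-- Interpolation at p = 0, 1, -1, 2. -/
theorem coeffs_eq_zero_of_cubic {c₀ c₁ c₂ c₃ : 𝕜}
    (h : ∀ p : 𝕜, c₀ + p * c₁ + p ^ 2 * c₂ - p ^ 3 * c₃ = 0) :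
    c₀ = 0 ∧ c₁ = 0 ∧ c₂ = 0 ∧ c₃ = 0 := by
  have h0 := h 0
  have h1 := h 1
  have h2 := h (-1)
  have h3 := h 2
  refine ⟨by linear_combination h0, ?_, ?_, ?_⟩
  · linear_combination h1 - h2 / 3 - h3 / 6 - h0 / 2
  · linear_combination (h1 + h2) / 2 - h0
  · linear_combination h1 / 2 + h2 / 6 - h3 / 6 - h0 / 2

theorem mem_symmetryAlgebra_iff {E : SecondOrderODE 𝕜} {a b : SmoothFun U}
    (hE : ∀ z : U, ∀ p, E.rhs z.1.1 z.1.2 p = a.1 z * p ^ 2 + b.1 z) (ha : dx a = 0)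
    (hb : dx b = 0) (X : 𝕜 × 𝕜 → 𝕜 × 𝕜) :
    X ∈ E.symmetryAlgebra U ↔ ∃ ξ φ : SmoothFun U, IsSymm a b ξ φ ∧ field ξ φ = X := by
  constructor
  · rintro ⟨h0, hX, hc⟩
    have hf : field (ofContDiffOn (U := U) (fun z => (X z).1) hX.fst)
        (ofContDiffOn (fun z => (X z).2) hX.snd) = X := by
      funext z
      by_cases hz : z ∈ U
      · simp [field, ext_of_mem _ hz]
      · simp [field, SmoothFun.ext, extendZero_of_notMem _ hz, h0 z hz]
    refine ⟨_, _, ?_, hf⟩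
    rw [← hf] at hc
    have key := fun z : U => coeffs_eq_zero_of_cubic
      ((infinitesimalCriterion_iff hE ha hb _ _ z).1 (hc z z.2))
    exact ⟨ext_iff_apply.2 fun z => (key z).2.2.2,
      sub_eq_zero.1 (ext_iff_apply.2 fun z => (key z).2.2.1),
      sub_eq_zero.1 (ext_iff_apply.2 fun z => (key z).2.1),
      sub_eq_zero.1 (ext_iff_apply.2 fun z => (key z).1)⟩
  · rintro ⟨ξ, φ, h, rfl⟩
    refine ⟨fun z hz => by simp [field, SmoothFun.ext, extendZero_of_notMem _ hz],
      ξ.contDiffOn.prodMk φ.contDiffOn, fun z hz => ?_⟩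
    refine (infinitesimalCriterion_iff hE ha hb ξ φ ⟨z, hz⟩).2 fun p => ?_
    rw [h.cubic, h.quadratic, h.linear, h.const]
    simp

theorem field_injective (ξ φ : SmoothFun U) (h : field ξ φ = 0) : ξ = 0 ∧ φ = 0 := by
  have key : ∀ z : U, ξ.1 z = 0 ∧ φ.1 z = 0 := fun z => by
    simpa [field] using congrFun h z
  exact ⟨ext_iff_apply.2 fun z => (key z).1, ext_iff_apply.2 fun z => (key z).2⟩

/-- The linear map `(ξ, φ) ↦ ξ ∂_x + φ ∂_y`. -/
noncomputable def fieldMap (U : Opens (𝕜 × 𝕜)) :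
    (SmoothFun U × SmoothFun U) →ₗ[𝕜] (𝕜 × 𝕜 → 𝕜 × 𝕜) where
  toFun q := field q.1 q.2
  map_add' q r := by
    funext z
    by_cases hz : z ∈ U <;>
      simp [field, SmoothFun.ext, extendZero, hz]
  map_smul' c q := by
    funext z
    by_cases hz : z ∈ U <;>
      simp [field, SmoothFun.ext, extendZero, hz]

theorem fieldMap_injective (U : Opens (𝕜 × 𝕜)) : Function.Injective (fieldMap U) := by
  rw [injective_iff_map_eq_zero]
  rintro ⟨ξ, φ⟩ h
  obtain ⟨rfl, rfl⟩ := field_injective ξ φ h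
  rfl

/-- A linear parametrization of the solutions of the determining equations has the symmetry algebra
as its range. -/
theorem range_fieldMap_comp {E : SecondOrderODE 𝕜} {a b : SmoothFun U}
    (hE : ∀ z : U, ∀ p, E.rhs z.1.1 z.1.2 p = a.1 z * p ^ 2 + b.1 z) (ha : dx a = 0)
    (hb : dx b = 0) {V : Type*} [AddCommGroup V] [Module 𝕜 V]
    (T : V →ₗ[𝕜] SmoothFun U × SmoothFun U)
    (hT : ∀ ξ φ, IsSymm a b ξ φ ↔ ∃ v, T v = (ξ, φ)) :
    LinearMap.range (fieldMap U ∘ₗ T) = E.symmetryAlgebra U := by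
  ext X
  rw [mem_symmetryAlgebra_iff hE ha hb]
  constructor
  · rintro ⟨v, rfl⟩
    exact ⟨(T v).1, (T v).2, (hT _ _).2 ⟨v, rfl⟩, rfl⟩
  · rintro ⟨ξ, φ, h, rfl⟩
    obtain ⟨v, hv⟩ := (hT _ _).1 h
    exact ⟨v, by simp [hv, fieldMap]⟩

theorem finrank_symmetryAlgebra {E : SecondOrderODE 𝕜} {a b : SmoothFun U}
    (hE : ∀ z : U, ∀ p, E.rhs z.1.1 z.1.2 p = a.1 z * p ^ 2 + b.1 z) (ha : dx a = 0)
    (hb : dx b = 0) {V : Type*} [AddCommGroup V] [Module 𝕜 V]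
    (T : V →ₗ[𝕜] SmoothFun U × SmoothFun U) (hTi : Function.Injective T)
    (hT : ∀ ξ φ, IsSymm a b ξ φ ↔ ∃ v, T v = (ξ, φ)) :
    Module.finrank 𝕜 (E.symmetryAlgebra U) = Module.finrank 𝕜 V := by
  rw [← range_fieldMap_comp hE ha hb T hT]
  exact LinearMap.finrank_range_of_inj ((fieldMap_injective U).comp hTi)

theorem translationField_mem {E : SecondOrderODE 𝕜} {a b : SmoothFun U}
    (hE : ∀ z : U, ∀ p, E.rhs z.1.1 z.1.2 p = a.1 z * p ^ 2 + b.1 z) (ha : dx a = 0)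
    (hb : dx b = 0) : translationField U ∈ E.symmetryAlgebra U := by
  refine (mem_symmetryAlgebra_iff hE ha hb _).2 ⟨1, 0, ⟨?_, ?_, ?_, ?_⟩, ?_⟩
  iterate 4 simp
  funext z
  by_cases hz : z ∈ U <;>
    simp [translationField, field, SmoothFun.ext, extendZero, hz]

end PlaneSymmetry

/-! ### Rational solutions of first order linear equations. -/

namespace PlaneSymmetry

section Poly

open Polynomial

variable {F : Type*} [Field F] [CharZero F]

/-- If `L / M` solves the linear equation `P w' = A w + c P` and no residue `A r / P' r` at a root
of `P` is a negative integer, then `L / M` has no poles. -/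
theorem dvd_of_rational_solution {P A : F[X]} (c : F) (hP : P.Splits) (hP0 : P ≠ 0)
    (hr : ∀ r, P.IsRoot r → ∀ k : ℕ, 0 < k → A.eval r + k * P.derivative.eval r ≠ 0) :
    ∀ (n : ℕ) (L M : F[X]), M ≠ 0 → M.natDegree ≤ n →
      P * (derivative L * M - L * derivative M) = A * L * M + C c * P * M ^ 2 → M ∣ L := by
  intro n
  induction n with
  | zero =>
    intro L M hM hdeg _
    exact (isUnit_iff_degree_eq_zero.2 (by
      rw [degree_eq_natDegree hM, Nat.le_zero.1 hdeg]; rfl)).dvd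
  | succ n ih =>
    intro L M hM hdeg h
    by_cases hu : IsUnit M
    · exact hu.dvd
    obtain ⟨π, hπ, M₁, rfl⟩ := WfDvdMonoid.exists_irreducible_factor hu hM
    have hM₁ : M₁ ≠ 0 := right_ne_zero_of_mul hM
    have hπd : 0 < π.natDegree := hπ.natDegree_pos
    -- A common factor cancels and lowers the degree of M. Otherwise π is a genuine pole of L / M,
    -- and the leading term of the equation at this pole contradicts the residue condition.
    by_cases hL : π ∣ L
    · obtain ⟨L₁, rfl⟩ := hL
      refine mul_dvd_mul_left π (ih L₁ M₁ hM₁ ?_ ?_)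
      · rw [natDegree_mul hπ.ne_zero hM₁] at hdeg
        omega
      · refine mul_left_cancel₀ (pow_ne_zero 2 hπ.ne_zero) ?_
        simp only [derivative_mul] at h
        linear_combination h
    · exfalso
      have hpr : Prime π := hπ.prime
      obtain ⟨k, M₂, hM₂, hk⟩ : ∃ k M₂, ¬π ∣ M₂ ∧ π * M₁ = π ^ k * M₂ := by
        obtain ⟨M₂, h1, h2⟩ :=
          (FiniteMultiplicity.of_prime_left hpr hM).exists_eq_pow_mul_and_not_dvd
        exact ⟨_, M₂, h2, h1⟩
      have hk0 : 0 < k := by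
        rcases Nat.eq_zero_or_pos k with rfl | h0
        · exact absurd ⟨M₁, by simpa using hk.symm⟩ hM₂
        · exact h0
      obtain ⟨j, rfl⟩ : ∃ j, k = j + 1 := ⟨k - 1, by omega⟩
      -- This is the equation for M = π^(j+1) M₂ with a factor π^j removed. Only the term that comes
      -- from differentiating the pole lacks a further factor π, so π divides P.
      have h' : P * L * ((j + 1 : F[X]) * derivative π * M₂) = π * (P * derivative L * M₂ -
          P * L * derivative M₂ - A * L * M₂ - C c * P * (π ^ (j + 1) * M₂ ^ 2)) := by
        refine mul_left_cancel₀ (pow_ne_zero j hpr.ne_zero) ?_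
        rw [hk] at h
        simp only [derivative_mul, derivative_pow_succ] at h
        simp only [map_add, map_natCast, map_one] at h
        linear_combination -h
      have hd : ¬π ∣ derivative π := fun hd => by
        have h1 := natDegree_le_of_dvd hd (fun h0 => by
          have := derivative_eq_zero.1 h0; omega)
        have h2 := natDegree_derivative_lt hπd.ne'
        omega
      have hj : ¬π ∣ (j + 1 : F[X]) := fun hd => hπ.not_isUnit (isUnit_of_dvd_unit hd (by
        have : ((j + 1 : F[X])) = C (j + 1 : F) := by simp
        rw [this, isUnit_C]
        exact (Nat.cast_add_one_ne_zero j).isUnit))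
      have hπP : π ∣ P := by
        have h1 : π ∣ P * L * ((j + 1 : F[X]) * derivative π * M₂) := ⟨_, h'⟩
        rcases hpr.dvd_or_dvd h1 with h2 | h2
        · exact (hpr.dvd_or_dvd h2).resolve_right hL
        · rcases hpr.dvd_or_dvd h2 with h3 | h3
          · exact absurd ((hpr.dvd_or_dvd h3).resolve_left hj) hd
          · exact absurd h3 hM₂
      obtain ⟨r, hr0⟩ : ∃ r, π.IsRoot r := by
        have h1 : π.Splits := hP.of_dvd hP0 hπP
        exact h1.exists_eval_eq_zero (by
          rw [degree_eq_natDegree hπ.ne_zero]; exact_mod_cast hπd.ne')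
      have hdr : (derivative π).eval r ≠ 0 := fun h0 => by
        refine hd ?_
        have h1 : Associated (X - C r) π :=
          (irreducible_X_sub_C r).associated_of_dvd hπ (dvd_iff_isRoot.2 hr0)
        exact h1.symm.dvd.trans (dvd_iff_isRoot.2 h0)
      have hne : ∀ {q : F[X]}, ¬π ∣ q → q.eval r ≠ 0 := fun {q} hq h0 => by
        have h1 : Associated (X - C r) π :=
          (irreducible_X_sub_C r).associated_of_dvd hπ (dvd_iff_isRoot.2 hr0)
        exact hq (h1.symm.dvd.trans (dvd_iff_isRoot.2 h0))
      obtain ⟨P₂, rfl⟩ := hπP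
      -- With one more factor π removed, evaluation at r leaves A(r) + (j+1) P'(r) = 0, since P'(r)
      -- = π'(r) P₂(r).
      have h'' : P₂ * L * ((j + 1 : F[X]) * derivative π * M₂) = π * P₂ * derivative L * M₂ -
          π * P₂ * L * derivative M₂ - A * L * M₂ - C c * (π * P₂) * (π ^ (j + 1) * M₂ ^ 2) :=
        mul_left_cancel₀ hpr.ne_zero (by linear_combination h')
      have h3 := congrArg (eval r) h''
      have hr0' : eval r π = 0 := hr0
      simp only [eval_mul, eval_sub, eval_add, eval_natCast, eval_one, hr0', zero_mul,
        mul_zero, sub_zero, zero_sub] at h3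
      have h4 := hr r (by simp [IsRoot, hr0']) (j + 1) hk0
      have h5 : eval r L * eval r M₂ ≠ 0 := mul_ne_zero (hne hL) (hne hM₂)
      refine h4 (mul_left_cancel₀ h5 ?_)
      simp only [derivative_mul, eval_add, eval_mul, hr0', zero_mul, add_zero, Nat.cast_add,
        Nat.cast_one, mul_zero]
      linear_combination h3

/-- A polynomial solution of `P w' = A w + c P` whose degree is not a root of the indicial equation
at infinity is affine. -/
theorem natDegree_le_one_of_solution {P A W : F[X]} {c : F} {n : ℕ} (hP : P.natDegree ≤ n)
    (hA : (X * A).natDegree ≤ n)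
    (hd : ∀ d : ℕ, 2 ≤ d → P.coeff n * d ≠ (X * A).coeff n)
    (h : P * derivative W = A * W + C c * P) : W.natDegree ≤ 1 := by
  by_contra! hW
  -- The operator X d/dX multiplies the leading coefficient of W by its degree. The term c X P has
  -- degree at most n + 1, below the degree n + deg W at which coefficients are compared.
  have h1 : P * (X * derivative W) = (X * A) * W + C c * (X * P) := by linear_combination X * h
  have h2 := congrArg (coeff · (n + W.natDegree)) h1
  have h3 : (X * derivative W).natDegree ≤ W.natDegree := by
    have := natDegree_derivative_lt (p := W) (by omega)
    refine natDegree_mul_le.trans ?_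
    simp; omega
  have h4 : (C c * (X * P)).coeff (n + W.natDegree) = 0 := by
    refine coeff_eq_zero_of_natDegree_lt ?_
    refine (natDegree_C_mul_le _ _).trans_lt (natDegree_mul_le.trans_lt ?_)
    simp; omega
  have h5 : (X * derivative W).coeff W.natDegree = W.natDegree * W.leadingCoeff := by
    obtain ⟨m, hm⟩ : ∃ m, W.natDegree = m + 1 := ⟨W.natDegree - 1, by omega⟩
    rw [leadingCoeff, hm, coeff_X_mul, coeff_derivative]
    push_cast; ring
  simp only [coeff_add] at h2
  rw [coeff_mul_add_eq_of_natDegree_le hP h3, coeff_mul_add_eq_of_natDegree_le hA le_rfl, h4, h5,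
    add_zero] at h2
  refine hd W.natDegree hW (mul_right_cancel₀ (b := W.leadingCoeff) ?_ ?_)
  · rw [Ne, leadingCoeff_eq_zero]
    rintro rfl
    simp at hW
  · rw [← leadingCoeff] at h2
    linear_combination h2

end Poly

end PlaneSymmetry

/-! ### Rigidity of symmetries when B = b' - a b is a nonconstant rational function. -/

namespace PlaneSymmetry

open TopologicalSpace SecondOrderODE SmoothFun Polynomial

variable {𝕜 : Type*} [RCLike 𝕜] {U : Opens (𝕜 × 𝕜)}

namespace IsSymm

variable {a b ξ φ : SmoothFun U}

/-- The y-derivative of `linear` and the x-derivative of `quadratic` give the same mixed derivative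
of φ_y - a φ; `cubic` then removes ξ_yy. -/
theorem dx_dx_dy (h : IsSymm a b ξ φ) :
    dx (dx (dy ξ)) = (dy b - a * b) * dy ξ := by
  have h1 := congrArg dy h.linear
  have h2 := congrArg dx h.quadratic
  rw [← dy_dx] at h2
  have h3 := h.cubic
  simp only [dy_mul, dy_add, dy_ofNat, dx_mul, dx_ofNat, dy_dx] at h1 h2
  refine mul_cancel_of_ne_zero (c := 3) (by norm_num) ?_
  simp only [map_ofNat]
  linear_combination 3 * b * h3 + h1 - 2 * h2

/-- The fourth derivative ξ_xxyy is computed twice, from `dx_dx_dy` and from `cubic`. The two values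
differ by B' ξ_y. -/
theorem dy_mul_dy_eq_zero (h : IsSymm a b ξ φ) (ha : dx a = 0) :
    dy (dy b - a * b) * dy ξ = 0 := by
  have h1 := h.dx_dx_dy
  have h2 := congrArg dy h1
  have h3 := congrArg dx (congrArg dx h.cubic)
  simp only [dy_mul, dy_sub, dx_add, dx_mul, ha, dy_dx, mul_zero, add_zero, dx_zero] at h1 h2 h3 ⊢
  linear_combination h3 - h2 - a * h1 - (dy b - a * b) * h.cubic

/-- The combination ∂_y - a applied to `const` turns φ into ψ = φ_y - a φ and b into B. The result
expresses φ algebraically through functions of x alone and B. -/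
theorem const_of_dy_eq_zero (h : IsSymm a b ξ φ) (ha : dx a = 0) (hw : dy ξ = 0) :
    φ * dy (dy b - a * b) + 2 * dx ξ * (dy b - a * b) = dx (dx (dy φ - a * φ)) := by
  have h1 := congrArg dy h.const
  have h2 := h.quadratic
  have h3 := h.const
  simp only [hw, dx_zero, dy_mul, dy_add, dy_sub, dx_mul, dx_sub, ha, dy_dx, mul_zero, add_zero,
    dy_ofNat] at h1 h2 h3 ⊢
  linear_combination -h1 + b * h2 + a * h3

end IsSymm

/-- The coefficients of `y'' = a y'² + b` are rational functions `a = A / P`, `b' - a b = N / Q` of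
`y`; the second one is not constant, and all solutions of `w' = a w + c`
that are rational in `y` are affine. -/
structure RationalCoeffs (a b : SmoothFun U) (P A Q N : 𝕜[X]) : Prop where
  dx_left : dx a = 0
  dx_right : dx b = 0
  left_mul : a * aeval coordY P = aeval coordY A
  right_mul : (dy b - a * b) * aeval coordY Q = aeval coordY N
  splits : P.Splits
  ne_zero : P ≠ 0
  residue : ∀ r, P.IsRoot r → ∀ k : ℕ, 0 < k → A.eval r + k * P.derivative.eval r ≠ 0
  indicial : ∃ n, P.natDegree ≤ n ∧ (X * A).natDegree ≤ n ∧
    ∀ d : ℕ, 2 ≤ d → P.coeff n * d ≠ (X * A).coeff n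
  denom_ne_zero : Q ≠ 0
  not_const : ∀ K, N ≠ C K * Q

namespace RationalCoeffs

variable {a b ξ φ : SmoothFun U} {P A Q N : 𝕜[X]}

theorem dy_mul (hc : RationalCoeffs a b P A Q N) : aeval coordY Q ^ 2 * dy (dy b - a * b) =
    aeval coordY (derivative N * Q - N * derivative Q) := by
  have h1 := hc.right_mul
  have h2 := congrArg dy h1
  rw [SmoothFun.dy_mul, dy_aeval, dy_aeval] at h2
  simp only [map_sub, map_mul]
  linear_combination aeval coordY Q * h2 - aeval coordY (derivative Q) * h1

/-- The Wronskian is Q² times B'. If it were zero, B would be constant on the connected set U, so N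
would be a constant multiple of Q. -/
theorem wronskian_ne_zero (hc : RationalCoeffs a b P A Q N)
    (hUne : (U : Set (𝕜 × 𝕜)).Nonempty) (hUc : Convex ℝ (U : Set (𝕜 × 𝕜))) :
    derivative N * Q - N * derivative Q ≠ 0 := by
  intro h0
  have h1 : dy (dy b - a * b) = 0 := by
    refine eq_zero_of_aeval_mul_eq_zero (pow_ne_zero 2 hc.denom_ne_zero) ?_
    rw [map_pow, hc.dy_mul, h0, map_zero]
  have h2 : dx (dy b - a * b) = 0 := by
    simp [← dy_dx, hc.dx_left, hc.dx_right]
  obtain ⟨K, hK⟩ := exists_eq_algebraMap hUc h2 h1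
  refine hc.not_const K (sub_eq_zero.1 (eq_zero_of_aeval_eq_zero hUne ?_))
  rw [map_sub, map_mul, aeval_C, ← hK, hc.right_mul, sub_self]

theorem dy_eq_zero (hc : RationalCoeffs a b P A Q N)
    (hUne : (U : Set (𝕜 × 𝕜)).Nonempty) (hUc : Convex ℝ (U : Set (𝕜 × 𝕜)))
    (h : IsSymm a b ξ φ) : dy ξ = 0 := by
  refine eq_zero_of_aeval_mul_eq_zero (hc.wronskian_ne_zero hUne hUc) ?_
  rw [← hc.dy_mul, mul_assoc, h.dy_mul_dy_eq_zero hc.dx_left, mul_zero]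

theorem two_dx (hc : RationalCoeffs a b P A Q N)
    (hUne : (U : Set (𝕜 × 𝕜)).Nonempty) (hUc : Convex ℝ (U : Set (𝕜 × 𝕜)))
    (h : IsSymm a b ξ φ) : 2 * dx (dy φ - a * φ) = dx (dx ξ) := by
  have := h.linear
  rwa [hc.dy_eq_zero hUne hUc h, mul_zero, add_zero] at this

/-- On every vertical line, the `∂_y`-coefficient of a symmetry is an affine function of `y`. -/
theorem exists_affine (hc : RationalCoeffs a b P A Q N)
    (hUne : (U : Set (𝕜 × 𝕜)).Nonempty) (hUc : Convex ℝ (U : Set (𝕜 × 𝕜)))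
    (h : IsSymm a b ξ φ) (z : U) : ∃ l₀ l₁ : 𝕜, φ.1 z = l₀ + l₁ * z.1.2 ∧
      C l₁ * P = A * (C l₀ + C l₁ * X) + C ((dy φ - a * φ).1 z) * P ∧
      (C l₀ + C l₁ * X) * (derivative N * Q - N * derivative Q) + C (2 * (dx ξ).1 z) * N * Q =
        C ((dx (dx (dy φ - a * φ))).1 z) * Q ^ 2 := by
  have hM := hc.wronskian_ne_zero hUne hUc
  have hw := hc.dy_eq_zero hUne hUc h
  have hψ : dy (dy φ - a * φ) = 0 := by rw [h.quadratic, hw, dx_zero, mul_zero]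
  set ψ := dy φ - a * φ with hψd
  set M := derivative N * Q - N * derivative Q with hMd
  -- On the vertical line through z, φ = L / M: this is `const_of_dy_eq_zero` cleared of
  -- denominators by Q².
  set L : 𝕜[X] := C ((dx (dx ψ)).1 z) * Q ^ 2 - C (2 * (dx ξ).1 z) * N * Q with hL
  have e1 : φ * aeval coordY M =
      dx (dx ψ) * aeval coordY Q ^ 2 - 2 * dx ξ * aeval coordY N * aeval coordY Q := by
    have h1 := h.const_of_dy_eq_zero hc.dx_left hw
    rw [← hψd] at h1
    rw [← hc.dy_mul]
    linear_combination aeval coordY Q ^ 2 * h1 - 2 * dx ξ * aeval coordY Q * hc.right_mul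
  have e2 := congrArg dy e1
  simp only [SmoothFun.dy_mul, dy_sub, dy_pow, dy_aeval, dy_dx, hψ, hw, dx_zero, dy_ofNat,
    mul_zero, add_zero] at e2
  -- Along the vertical line ψ, ξ_x and ψ_xx are constants. Thus φ_y = a φ + ψ becomes a relation
  -- between polynomials in y, and it is an identity because an open slice is infinite.
  have hslice : ∀ y ∈ slice U z.1.1, φ.ext (z.1.1, y) * M.eval y = L.eval y ∧
      P.eval y * ((derivative L).eval y * M.eval y - L.eval y * (derivative M).eval y) =
        A.eval y * L.eval y * M.eval y + ψ.1 z * P.eval y * M.eval y ^ 2 := by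
    intro y hy
    have i1 : ψ.1 ⟨(z.1.1, y), hy⟩ = ψ.1 z := eq_of_dy_eq_zero hUc hψ _ _ rfl
    have i2 : (dx ξ).1 ⟨(z.1.1, y), hy⟩ = (dx ξ).1 z :=
      eq_of_dy_eq_zero hUc (by rw [dy_dx, hw, dx_zero]) _ _ rfl
    have i3 : (dx (dx ψ)).1 ⟨(z.1.1, y), hy⟩ = (dx (dx ψ)).1 z :=
      eq_of_dy_eq_zero hUc (by rw [dy_dx, dy_dx, hψ, dx_zero, dx_zero]) _ _ rfl
    have j1 := ext_iff_apply.1 e1 ⟨(z.1.1, y), hy⟩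
    have j2 := ext_iff_apply.1 e2 ⟨(z.1.1, y), hy⟩
    have j3 := ext_iff_apply.1 hc.left_mul ⟨(z.1.1, y), hy⟩
    have j4 := ext_iff_apply.1 hψd ⟨(z.1.1, y), hy⟩
    simp only [Subalgebra.coe_mul, Subalgebra.coe_sub, Subalgebra.coe_add, Subalgebra.coe_pow,
      Pi.mul_apply, Pi.sub_apply, Pi.add_apply, Pi.pow_apply, aeval_coordY_apply, i1, i2, i3,
      ofNat_apply] at j1 j2 j3 j4
    rw [ext_of_mem φ hy]
    have k1 : L.eval y = (dx (dx ψ)).1 z * Q.eval y ^ 2 -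
        2 * (dx ξ).1 z * N.eval y * Q.eval y := by
      simp [hL]
    have k2 : (derivative L).eval y = (dx (dx ψ)).1 z * (2 * Q.eval y * (derivative Q).eval y) -
        2 * (dx ξ).1 z * (N.eval y * (derivative Q).eval y +
          Q.eval y * (derivative N).eval y) := by
      simp [hL, derivative_pow]
      ring
    refine ⟨by rw [k1, j1], ?_⟩
    have j1' : L.eval y = φ.1 ⟨(z.1.1, y), hy⟩ * M.eval y := by rw [k1, j1]
    have j2' : (derivative L).eval y = φ.1 ⟨(z.1.1, y), hy⟩ * (derivative M).eval y +
        M.eval y * (dy φ).1 ⟨(z.1.1, y), hy⟩ := by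
      rw [k2, j2]
      simp
      ring
    rw [j1', j2']
    linear_combination (P.eval y * M.eval y ^ 2) * (-j4) +
      φ.1 ⟨(z.1.1, y), hy⟩ * M.eval y ^ 2 * j3
  have hinf : (slice U z.1.1).Infinite := infinite_slice (y := z.1.2) z.2
  have hode : P * (derivative L * M - L * derivative M) = A * L * M + C (ψ.1 z) * P * M ^ 2 :=
    eq_of_infinite_eval_eq _ _ (hinf.mono fun y hy => by simpa using (hslice y hy).2)
  obtain ⟨W, hW⟩ := dvd_of_rational_solution (ψ.1 z) hc.splits hc.ne_zero hc.residue M.natDegree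
    L M hM le_rfl hode
  have hWode : P * derivative W = A * W + C (ψ.1 z) * P := by
    refine mul_left_cancel₀ (pow_ne_zero 2 hM) ?_
    rw [hW, derivative_mul] at hode
    linear_combination hode
  obtain ⟨n, hn1, hn2, hn3⟩ := hc.indicial
  obtain ⟨l₁, l₀, rfl⟩ :=
    exists_eq_X_add_C_of_natDegree_le_one (natDegree_le_one_of_solution hn1 hn2 hn3 hWode)
  refine ⟨l₀, l₁, ?_, ?_, ?_⟩
  -- M may vanish at z itself; the cancellation there rests on the continuity of φ.
  · have h1 := eq_zero_of_eval_mul_eq_zero hM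
      (g := fun y => φ.ext (z.1.1, y) - (l₀ + l₁ * y)) (y := z.1.2)
      ((hasDerivAt_slice φ z).continuousAt.sub (by fun_prop))
      ((eventually_mem_slice z).mono fun y hy => by
        have := (hslice y hy).1
        rw [hW] at this
        simp only [eval_mul, eval_add, eval_C, eval_X] at this
        linear_combination this)
    simpa [sub_eq_zero] using h1
  · simp at hWode
    linear_combination hWode
  · linear_combination hL - hW

/-- If `A` does not vanish at the roots `0` and `1` of `P`, the only symmetries are the constant
multiples of `∂_x`. -/
theorem of_two_poles (hc : RationalCoeffs a b P A Q N)
    (hUne : (U : Set (𝕜 × 𝕜)).Nonempty) (hUc : Convex ℝ (U : Set (𝕜 × 𝕜)))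
    (hP0 : P.eval 0 = 0) (hP1 : P.eval 1 = 0) (hA0 : A.eval 0 ≠ 0) (hA1 : A.eval 1 ≠ 0)
    (h : IsSymm a b ξ φ) : dx ξ = 0 ∧ φ = 0 := by
  have key : ∀ z, φ.1 z = 0 := fun z => by
    obtain ⟨l₀, l₁, h1, h2, -⟩ := hc.exists_affine hUne hUc h z
    -- At a zero of P the relation l₁ P = A (l₀ + l₁ y) + ψ P reduces to A (l₀ + l₁ y) = 0. So the
    -- affine function vanishes at 0 and at 1.
    have e0 := congrArg (eval 0) h2
    have e1 := congrArg (eval 1) h2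
    simp [hP0, hA0] at e0
    simp [hP1, hA1, e0] at e1
    simp [h1, e0, e1]
  have hφ : φ = 0 := ext_iff_apply.2 key
  subst hφ
  refine ⟨?_, rfl⟩
  have h1 := h.const_of_dy_eq_zero hc.dx_left (hc.dy_eq_zero hUne hUc h)
  have hN : N ≠ 0 := fun h0 => hc.not_const 0 (by simp [h0])
  refine eq_zero_of_aeval_mul_eq_zero hN ?_
  refine mul_cancel_of_ne_zero (c := 2) (by norm_num) ?_
  simp only [dy_zero, mul_zero, sub_zero, dx_zero, zero_mul, zero_add] at h1
  rw [← hc.right_mul, map_ofNat]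
  linear_combination aeval coordY Q * h1

/-- Comparison of coefficients in the case `b' - a b = N / y ^ j`. -/
theorem coeff_relation {j : ℕ} {l₀ l₁ d e : 𝕜}
    (h : (C l₀ + C l₁ * X) * (derivative N * X ^ j - N * derivative (X ^ j)) + C d * N * X ^ j =
        C e * (X ^ j) ^ 2) (k : ℕ) :
    l₀ * ((k + 1 - j) * N.coeff (k + 1)) + (l₁ * (k - j) + d) * N.coeff k =
      if k = j then e else 0 := by
  -- Multiplication by X and division by X^j turn the derivatives into the operator X d/dX, which
  -- acts on monomials by their exponents.
  have hX : X * derivative (X ^ j : 𝕜[X]) = C (j : 𝕜) * X ^ j := by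
    rcases j with _ | j
    · simp
    · simp only [derivative_X_pow, Nat.add_sub_cancel]
      ring
  have h1 : (C l₀ + C l₁ * X) * (X * derivative N - C (j : 𝕜) * N) + C d * (X * N) =
      C e * (X * X ^ j) := by
    refine mul_left_cancel₀ (pow_ne_zero j (X_ne_zero (R := 𝕜))) ?_
    linear_combination X * h + (C l₀ + C l₁ * X) * N * hX
  have h2 : C l₀ * (X * derivative N) - C (l₀ * j) * N + C l₁ * (X * (X * derivative N)) -
      C (l₁ * j) * (X * N) + C d * (X * N) = C e * (X * X ^ j) := by
    rw [← h1]
    simp only [C_mul]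
    ring
  have h3 := congrArg (coeff · (k + 1)) h2
  have h4 : (X * derivative N).coeff k = k * N.coeff k := by
    rcases k with _ | k
    · simp
    · rw [coeff_X_mul, coeff_derivative]
      push_cast
      ring
  simp only [coeff_add, coeff_sub, coeff_C_mul, coeff_X_mul, coeff_derivative, h4,
    coeff_X_pow] at h3
  rw [mul_ite, mul_one, mul_zero] at h3
  linear_combination h3

/-- The case `a = 0`. -/
theorem relation_of_left_eq_zero {j : ℕ} (hc : RationalCoeffs a b 1 0 (X ^ j) N)
    (hUne : (U : Set (𝕜 × 𝕜)).Nonempty) (hUc : Convex ℝ (U : Set (𝕜 × 𝕜)))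
    (h : IsSymm a b ξ φ) (z : U) (k : ℕ) :
    (φ.1 z - (dy φ).1 z * z.1.2) * ((k + 1 - j) * N.coeff (k + 1)) +
      ((dy φ).1 z * (k - j) + 2 * (dx ξ).1 z) * N.coeff k =
        if k = j then (dx (dx (dy φ))).1 z else 0 := by
  have ha : a = 0 := by simpa using hc.left_mul
  obtain ⟨l₀, l₁, h1, h2, h3⟩ := hc.exists_affine hUne hUc h z
  simp only [ha, zero_mul, sub_zero] at h2 h3
  have h4 : l₁ = (dy φ).1 z := by simpa using h2
  have h5 : φ.1 z - (dy φ).1 z * z.1.2 = l₀ := by rw [h1, h4]; ring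
  rw [h5, ← h4]
  exact coeff_relation h3 k

/-- The case `a = s / y`. -/
theorem relation_of_left_eq_inv {j : ℕ} {s : 𝕜} (hc : RationalCoeffs a b X (C s) (X ^ j) N)
    (hs : s ≠ 0) (hUne : (U : Set (𝕜 × 𝕜)).Nonempty) (hUc : Convex ℝ (U : Set (𝕜 × 𝕜)))
    (h : IsSymm a b ξ φ) (z : U) :
    ∃ l, φ.1 z = l * z.1.2 ∧ (dy φ - a * φ).1 z = (1 - s) * l ∧
      ∀ k, (l * (k - j) + 2 * (dx ξ).1 z) * N.coeff k =
        if k = j then (dx (dx (dy φ - a * φ))).1 z else 0 := by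
  obtain ⟨l₀, l₁, h1, h2, h3⟩ := hc.exists_affine hUne hUc h z
  -- In l₁ y = s (l₀ + l₁ y) + ψ y the constant term gives l₀ = 0, and the coefficient of y gives ψ
  -- = (1 - s) l₁.
  have h4 := congrArg (eval 0) h2
  have h5 := congrArg (coeff · 1) h2
  simp only [eval_mul, eval_add, eval_C, eval_X, mul_zero, add_zero] at h4
  have h6 : l₀ = 0 := (mul_eq_zero.1 h4.symm).resolve_left hs
  subst h6
  simp only [coeff_C_mul, coeff_add, coeff_X_one, mul_one, coeff_C_of_ne_zero one_ne_zero,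
    zero_add] at h5
  refine ⟨l₁, by rw [h1, zero_add], by linear_combination -h5, fun k => ?_⟩
  have := coeff_relation h3 k
  rwa [zero_mul, zero_add] at this

end RationalCoeffs

/-! ### Dimension of the symmetry algebra from the form of its elements. -/

section Dimension

variable {a b : SmoothFun U} {E : SecondOrderODE 𝕜}

theorem finrank_symmetryAlgebra_eq_one
    (hE : ∀ z : U, ∀ p, E.rhs z.1.1 z.1.2 p = a.1 z * p ^ 2 + b.1 z) (ha : dx a = 0)
    (hb : dx b = 0) (hUne : (U : Set (𝕜 × 𝕜)).Nonempty) (hUc : Convex ℝ (U : Set (𝕜 × 𝕜)))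
    (H : ∀ ξ φ, IsSymm a b ξ φ → dy ξ = 0 ∧ dx ξ = 0 ∧ φ = 0) :
    Module.finrank 𝕜 (E.symmetryAlgebra U) = 1 := by
  rw [← Module.finrank_self 𝕜]
  refine finrank_symmetryAlgebra hE ha hb
    ((Algebra.linearMap 𝕜 (SmoothFun U)).prod 0) ?_ fun ξ φ => ⟨fun h => ?_, ?_⟩
  · intro c d h
    exact algebraMap_injective hUne (congrArg Prod.fst h)
  · obtain ⟨h1, h2, rfl⟩ := H ξ φ h
    obtain ⟨c, rfl⟩ := exists_eq_algebraMap hUc h2 h1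
    exact ⟨c, rfl⟩
  · rintro ⟨c, h⟩
    obtain ⟨rfl, rfl⟩ := Prod.mk.inj h
    constructor <;> simp

/-- The hypothesis `hbμ` is Euler's relation μ y b' = (μ - 2) b, the infinitesimal form of
invariance under x ↦ e^t x, y ↦ e^(μt) y. It shows that the scaling field is a symmetry, while `H`
bounds the algebra from above. -/
theorem finrank_symmetryAlgebra_eq_two {s μ : 𝕜}
    (hE : ∀ z : U, ∀ p, E.rhs z.1.1 z.1.2 p = a.1 z * p ^ 2 + b.1 z) (ha : dx a = 0)
    (hb : dx b = 0) (hUne : (U : Set (𝕜 × 𝕜)).Nonempty) (hUc : Convex ℝ (U : Set (𝕜 × 𝕜)))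
    (has : a * coordY = algebraMap 𝕜 _ s)
    (hbμ : algebraMap 𝕜 _ (μ - 2) * b = algebraMap 𝕜 _ μ * coordY * dy b)
    (H : ∀ ξ φ, IsSymm a b ξ φ →
      dy ξ = 0 ∧ dx (dx ξ) = 0 ∧ φ = algebraMap 𝕜 _ μ * coordY * dx ξ) :
    Module.finrank 𝕜 (E.symmetryAlgebra U) = 2 := by
  have h2 : Module.finrank 𝕜 (𝕜 × 𝕜) = 2 := by simp
  rw [← h2]
  let T : 𝕜 × 𝕜 →ₗ[𝕜] SmoothFun U × SmoothFun U :=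
    { toFun := fun v => (algebraMap 𝕜 _ v.1 + algebraMap 𝕜 _ v.2 * coordX,
        algebraMap 𝕜 _ μ * coordY * algebraMap 𝕜 _ v.2)
      map_add' := fun v w => by
        ext1 <;> simp only [Prod.fst_add, Prod.snd_add, map_add] <;> ring
      map_smul' := fun c v => by
        ext1 <;> simp only [Prod.smul_fst, Prod.smul_snd, smul_eq_mul, map_mul,
          RingHom.id_apply] <;> rw [Algebra.smul_def] <;> ring }
  refine finrank_symmetryAlgebra hE ha hb T ?_ fun ξ φ => ⟨fun h => ?_, ?_⟩
  · rw [injective_iff_map_eq_zero]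
    rintro ⟨c, d⟩ h
    have h1 : algebraMap 𝕜 (SmoothFun U) c + algebraMap 𝕜 _ d * coordX = 0 :=
      congrArg Prod.fst h
    have h3 := congrArg dx h1
    simp only [dx_add, dx_mul, dx_algebraMap, dx_coordX, mul_one, mul_zero, add_zero, zero_add,
      dx_zero] at h3
    rw [h3, zero_mul, add_zero] at h1
    rw [(map_eq_zero_iff _ (algebraMap_injective hUne)).1 h1,
      (map_eq_zero_iff _ (algebraMap_injective hUne)).1 h3]
    rfl
  · obtain ⟨h1, h2, rfl⟩ := H ξ φ h
    obtain ⟨d, hd⟩ := exists_eq_algebraMap hUc h2 (by rw [dy_dx, h1, dx_zero])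
    obtain ⟨c, hc⟩ := exists_eq_algebraMap hUc (f := ξ - algebraMap 𝕜 _ d * coordX)
      (by simp [hd]) (by simp [h1])
    refine ⟨(c, d), Prod.ext ?_ ?_⟩
    · exact (eq_add_of_sub_eq hc).symm
    · rw [hd]
      rfl
  · rintro ⟨⟨c, d⟩, h⟩
    obtain ⟨rfl, rfl⟩ := Prod.mk.inj h
    have h1 := congrArg dx has
    have h2 := congrArg dy has
    simp at h1 h2
    rw [map_sub, map_ofNat] at hbμ
    constructor
    · simp
    · simp
      linear_combination (-algebraMap 𝕜 _ μ * algebraMap 𝕜 _ d) * h2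
    · simp [ha]
    · simp
      linear_combination algebraMap 𝕜 _ d * hbμ

/-- The resonance `hsμ` is what `linear` requires of ξ = x²: with φ = μ y ξ_x one has ψ = μ (1 - s)
ξ_x, and 2 ψ_x = ξ_xx must hold although ξ_xx ≠ 0. -/
theorem finrank_symmetryAlgebra_eq_three {s μ : 𝕜}
    (hE : ∀ z : U, ∀ p, E.rhs z.1.1 z.1.2 p = a.1 z * p ^ 2 + b.1 z) (ha : dx a = 0)
    (hb : dx b = 0) (hUne : (U : Set (𝕜 × 𝕜)).Nonempty) (hUc : Convex ℝ (U : Set (𝕜 × 𝕜)))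
    (has : a * coordY = algebraMap 𝕜 _ s) (hsμ : 2 * μ * (1 - s) = 1)
    (hbμ : algebraMap 𝕜 _ (μ - 2) * b = algebraMap 𝕜 _ μ * coordY * dy b)
    (H : ∀ ξ φ, IsSymm a b ξ φ →
      dy ξ = 0 ∧ dx (dx (dx ξ)) = 0 ∧ φ = algebraMap 𝕜 _ μ * coordY * dx ξ) :
    Module.finrank 𝕜 (E.symmetryAlgebra U) = 3 := by
  have h2 : Module.finrank 𝕜 (𝕜 × 𝕜 × 𝕜) = 3 := by simp
  rw [← h2]
  let T : 𝕜 × 𝕜 × 𝕜 →ₗ[𝕜] SmoothFun U × SmoothFun U :=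
    { toFun := fun v => (algebraMap 𝕜 _ v.1 + algebraMap 𝕜 _ v.2.1 * coordX +
          algebraMap 𝕜 _ v.2.2 * coordX ^ 2,
        algebraMap 𝕜 _ μ * coordY *
          (algebraMap 𝕜 _ v.2.1 + 2 * algebraMap 𝕜 _ v.2.2 * coordX))
      map_add' := fun v w => by
        ext1 <;> simp only [Prod.fst_add, Prod.snd_add, map_add] <;> ring
      map_smul' := fun c v => by
        ext1 <;> simp only [Prod.smul_fst, Prod.smul_snd, smul_eq_mul, map_mul,
          RingHom.id_apply] <;> rw [Algebra.smul_def] <;> ring }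
  refine finrank_symmetryAlgebra hE ha hb T ?_ fun ξ φ => ⟨fun h => ?_, ?_⟩
  · rw [injective_iff_map_eq_zero]
    rintro ⟨c, d, e⟩ h
    have h1 : algebraMap 𝕜 (SmoothFun U) c + algebraMap 𝕜 _ d * coordX +
      algebraMap 𝕜 _ e * coordX ^ 2 = 0 := congrArg Prod.fst h
    have h3 := congrArg dx h1
    have h4 := congrArg dx h3
    simp at h3 h4
    replace h4 : algebraMap 𝕜 (SmoothFun U) e = 0 :=
      mul_cancel_of_ne_zero (c := 2) (by norm_num) (by rw [map_ofNat]; linear_combination h4)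
    rw [h4, zero_mul, add_zero] at h3
    rw [h3, h4, zero_mul, zero_mul, add_zero, add_zero] at h1
    have hc := (map_eq_zero_iff _ (algebraMap_injective hUne)).1 h1
    have hd := (map_eq_zero_iff _ (algebraMap_injective hUne)).1 h3
    have he := (map_eq_zero_iff _ (algebraMap_injective hUne)).1 h4
    rw [hc, hd, he]
    rfl
  · obtain ⟨h1, h2, rfl⟩ := H ξ φ h
    obtain ⟨e, he⟩ := exists_eq_algebraMap hUc h2 (by rw [dy_dx, dy_dx, h1, dx_zero, dx_zero])
    obtain ⟨d, hd⟩ := exists_eq_algebraMap hUc (f := dx ξ - algebraMap 𝕜 _ e * coordX)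
      (by simp [he]) (by simp [dy_dx, h1])
    -- The constant e is ξ_xx, so the coefficient of x² in ξ is e / 2.
    have he2 : algebraMap 𝕜 (SmoothFun U) e = 2 * algebraMap 𝕜 _ (e / 2) := by
      rw [← map_ofNat (algebraMap 𝕜 (SmoothFun U)) 2, ← map_mul]
      congr 1
      ring
    obtain ⟨c, hc⟩ := exists_eq_algebraMap hUc
      (f := ξ - algebraMap 𝕜 _ d * coordX - algebraMap 𝕜 _ (e / 2) * coordX ^ 2)
      (by
        simp
        linear_combination hd + coordX * he2) (by simp [h1])
    refine ⟨(c, d, e / 2), Prod.ext ?_ ?_⟩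
    · change algebraMap 𝕜 _ c + algebraMap 𝕜 _ d * coordX +
          algebraMap 𝕜 _ (e / 2) * coordX ^ 2 = ξ
      linear_combination -hc
    · change algebraMap 𝕜 _ μ * coordY *
          (algebraMap 𝕜 _ d + 2 * algebraMap 𝕜 _ (e / 2) * coordX) = _
      linear_combination (-algebraMap 𝕜 _ μ * coordY) * (hd + coordX * he2)
  · rintro ⟨⟨c, d, e⟩, h⟩
    obtain ⟨rfl, rfl⟩ := Prod.mk.inj h
    have h1 := congrArg dx has
    have h2 := congrArg dy has
    have h3 := congrArg (algebraMap 𝕜 (SmoothFun U)) hsμ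
    simp at h1 h2
    simp only [map_mul, map_sub, map_one, map_ofNat] at h3
    rw [map_sub, map_ofNat] at hbμ
    constructor
    · simp
    · simp
      linear_combination (-algebraMap 𝕜 _ μ * (algebraMap 𝕜 _ d +
        2 * algebraMap 𝕜 _ e * coordX)) * h2
    · simp [ha]
      linear_combination 2 * algebraMap 𝕜 _ e * h3 -
        4 * algebraMap 𝕜 _ μ * algebraMap 𝕜 _ e * has
    · simp
      linear_combination (algebraMap 𝕜 _ d + 2 * algebraMap 𝕜 _ e * coordX) * hbμ

end Dimension

end PlaneSymmetry

/-! ### Symmetries when a = 0 or a = s/y. -/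

namespace PlaneSymmetry

open TopologicalSpace SecondOrderODE SmoothFun Polynomial

variable {𝕜 : Type*} [RCLike 𝕜] {U : Opens (𝕜 × 𝕜)} {a b ξ φ : SmoothFun U}

section LeftZero

/-- Here a = 0 / 1 has no finite poles, and the condition at infinity reads d ≠ 0. -/
theorem rationalCoeffs_zero {N : 𝕜[X]} (hb : dx b = 0) (hN : dy b = aeval coordY N) {k : ℕ}
    (hk : k ≠ 0) (hNk : N.coeff k ≠ 0) : RationalCoeffs 0 b 1 0 (X ^ 0) N where
  dx_left := dx_zero
  dx_right := hb
  left_mul := by simp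
  right_mul := by simp [hN]
  splits := Splits.one
  ne_zero := one_ne_zero
  residue r hr := by simp at hr
  indicial := ⟨0, by simp, by simp, fun d hd => by simpa using by omega⟩
  denom_ne_zero := by simp
  not_const K h := hNk (by simp [h, coeff_C, hk])

/-- Only b' is prescribed, so this serves both `I2` and `I3`; the value of b enters later through
`const`. The coefficient of y gives φ_y = -2 ξ_x, then 2 φ_xy = ξ_xx gives 5 ξ_xx = 0, and the
constant coefficient removes the part of φ independent of y. -/
theorem eq_of_dy_eq_linear (hUne : (U : Set (𝕜 × 𝕜)).Nonempty)
    (hUc : Convex ℝ (U : Set (𝕜 × 𝕜))) (hb : dx b = 0) (hb' : dy b = 12 * coordY)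
    (h : IsSymm 0 b ξ φ) :
    dy ξ = 0 ∧ dx (dx ξ) = 0 ∧ φ = algebraMap 𝕜 _ (-2) * coordY * dx ξ := by
  have hc : RationalCoeffs 0 b 1 0 (X ^ 0) (C (12 : 𝕜) * X) :=
    rationalCoeffs_zero hb (by simp only [hb', map_mul, aeval_X, map_ofNat]) one_ne_zero (by simp)
  have h1 := fun z => hc.relation_of_left_eq_zero hUne hUc h z 1
  have h0 := fun z => hc.relation_of_left_eq_zero hUne hUc h z 0
  have e1 : dy φ = -2 * dx ξ := ext_iff_apply.2 fun z => by
    have := h1 z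
    simp at this
    simp
    linear_combination this
  have e2 := hc.two_dx hUne hUc h
  rw [zero_mul, sub_zero] at e2
  rw [e1] at e2
  have e3 : dx (dx ξ) = 0 := by
    refine mul_cancel_of_ne_zero (c := 5) (by norm_num) ?_
    simp at e2
    rw [map_ofNat]
    linear_combination -e2
  refine ⟨hc.dy_eq_zero hUne hUc h, e3, ext_iff_apply.2 fun z => ?_⟩
  have e4 := h0 z
  rw [e1] at e4
  simp [e3, coeff_X] at e4
  simp
  linear_combination e4

/-- The coefficient of y² gives φ_y = -ξ_x, hence 3 ξ_xx = 0. Since b' has no term in y, the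
coefficient of y makes φ homogeneous in y. -/
theorem eq_of_dy_eq_quadratic (hUne : (U : Set (𝕜 × 𝕜)).Nonempty)
    (hUc : Convex ℝ (U : Set (𝕜 × 𝕜))) (hb : dx b = 0) {β : 𝕜}
    (hb' : dy b = 6 * coordY ^ 2 + algebraMap 𝕜 _ β) (h : IsSymm 0 b ξ φ) :
    dy ξ = 0 ∧ dx (dx ξ) = 0 ∧ φ = algebraMap 𝕜 _ (-1) * coordY * dx ξ := by
  have hc : RationalCoeffs 0 b 1 0 (X ^ 0) (C (6 : 𝕜) * X ^ 2 + C β) :=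
    rationalCoeffs_zero hb (by simp only [hb', map_add, map_mul, map_pow, aeval_C, aeval_X,
      map_ofNat]) two_ne_zero (by simp)
  have h1 := fun z => hc.relation_of_left_eq_zero hUne hUc h z 2
  have h0 := fun z => hc.relation_of_left_eq_zero hUne hUc h z 1
  have e1 : dy φ = -dx ξ := ext_iff_apply.2 fun z => by
    have := h1 z
    simp [coeff_X_pow] at this
    simp
    linear_combination this / 2
  have e2 := hc.two_dx hUne hUc h
  rw [zero_mul, sub_zero] at e2
  rw [e1] at e2
  have e3 : dx (dx ξ) = 0 := by
    refine mul_cancel_of_ne_zero (c := 3) (by norm_num) ?_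
    simp at e2
    rw [map_ofNat]
    linear_combination -e2
  refine ⟨hc.dy_eq_zero hUne hUc h, e3, ext_iff_apply.2 fun z => ?_⟩
  have e4 := h0 z
  rw [e1] at e4
  simp [coeff_X_pow] at e4
  simp
  linear_combination e4

end LeftZero

section LeftInv

/-- With s = p/q the residue condition is s + k ≠ 0 for k > 0, which follows from s > 0. The
condition at infinity is s ≠ d for d ≥ 2, which follows from s < 2. -/
theorem rationalCoeffs_inv (h0 : ∀ z ∈ U, z.2 ≠ (0 : 𝕜)) {s : 𝕜} {p q : ℕ}
    (hs : s * q = p) (hp : 0 < p) (hpq : p < 2 * q) {N : 𝕜[X]} {j : ℕ} (hb : dx b = 0)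
    (hN : (dy b - algebraMap 𝕜 _ s * poleAt 0 h0 * b) * coordY ^ j = aeval coordY N) {k : ℕ}
    (hk : k ≠ j) (hNk : N.coeff k ≠ 0) :
    RationalCoeffs (algebraMap 𝕜 _ s * poleAt 0 h0) b X (C s) (X ^ j) N where
  dx_left := by simp
  dx_right := hb
  left_mul := by
    have := mul_poleAt 0 h0
    simp at this ⊢
    linear_combination algebraMap 𝕜 _ s * this
  right_mul := by rw [← hN]; simp
  splits := Splits.X
  ne_zero := X_ne_zero
  residue r _ k hk h := by
    simp at h
    have h1 : ((p + k * q : ℕ) : 𝕜) = 0 := by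
      push_cast
      linear_combination (q : 𝕜) * h - hs
    rw [Nat.cast_eq_zero] at h1
    omega
  indicial := ⟨1, by simp, natDegree_mul_le.trans (by simp), fun d hd h => by
    simp at h
    have h1 : ((d * q : ℕ) : 𝕜) = (p : ℕ) := by
      push_cast
      rw [h, hs]
    have h2 := Nat.cast_injective h1
    nlinarith⟩
  denom_ne_zero := by simp
  not_const K h := hNk (by simp [h, coeff_X_pow, hk])

variable {s : 𝕜} {j : ℕ} {N : 𝕜[X]}

/-- The powers y^(k-j) and y^(k'-j) of B require l (k - j) = -2 ξ_x = l (k' - j), so l = 0. -/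
theorem eq_of_two_exponents (hc : RationalCoeffs a b X (C s) (X ^ j) N) (hs : s ≠ 0)
    (hUne : (U : Set (𝕜 × 𝕜)).Nonempty) (hUc : Convex ℝ (U : Set (𝕜 × 𝕜)))
    {k k' : ℕ} (hkj : k ≠ j) (hkj' : k' ≠ j) (hkk : k ≠ k') (hk : N.coeff k ≠ 0)
    (hk' : N.coeff k' ≠ 0) (h : IsSymm a b ξ φ) : dy ξ = 0 ∧ dx ξ = 0 ∧ φ = 0 := by
  have key : ∀ z, (dx ξ).1 z = 0 ∧ φ.1 z = 0 := fun z => by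
    obtain ⟨l, h1, -, h2⟩ := hc.relation_of_left_eq_inv hs hUne hUc h z
    have e1 := h2 k
    have e2 := h2 k'
    simp only [hkj, hkj', if_false, mul_eq_zero, hk, hk', or_false] at e1 e2
    have e3 : l * ((k : 𝕜) - k') = 0 := by linear_combination e1 - e2
    have e4 : l = 0 := (mul_eq_zero.1 e3).resolve_right
      (sub_ne_zero.2 (Nat.cast_injective.ne hkk))
    subst e4
    refine ⟨by linear_combination e1 / 2, by simp [h1]⟩
  exact ⟨hc.dy_eq_zero hUne hUc h, ext_iff_apply.2 fun z => (key z).1,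
    ext_iff_apply.2 fun z => (key z).2⟩

/-- A single nonconstant power of B fixes the ratio of l to ξ_x, the weight μ. -/
theorem eq_of_exponent (hc : RationalCoeffs a b X (C s) (X ^ j) N) (hs : s ≠ 0)
    (hUne : (U : Set (𝕜 × 𝕜)).Nonempty) (hUc : Convex ℝ (U : Set (𝕜 × 𝕜)))
    {k : ℕ} (hkj : k ≠ j) (hk : N.coeff k ≠ 0) {μ : 𝕜} (hμ : μ * (k - j) = -2)
    (h : IsSymm a b ξ φ) : φ = algebraMap 𝕜 _ μ * coordY * dx ξ ∧
      dy φ - a * φ = algebraMap 𝕜 _ ((1 - s) * μ) * dx ξ := by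
  have key : ∀ z, φ.1 z = μ * z.1.2 * (dx ξ).1 z ∧
      (dy φ - a * φ).1 z = (1 - s) * μ * (dx ξ).1 z := fun z => by
    obtain ⟨l, h1, h3, h2⟩ := hc.relation_of_left_eq_inv hs hUne hUc h z
    have e1 := h2 k
    simp only [hkj, if_false, mul_eq_zero, hk, or_false] at e1
    have e2 : l = μ * (dx ξ).1 z := by linear_combination l / 2 * hμ - μ / 2 * e1
    exact ⟨by rw [h1, e2]; ring, by rw [h3, e2]; ring⟩
  exact ⟨ext_iff_apply.2 fun z => (key z).1, ext_iff_apply.2 fun z => (key z).2⟩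

/-- Since ψ = (1 - s) μ ξ_x, the relation 2 ψ_x = ξ_xx becomes (2 (1 - s) μ - 1) ξ_xx = 0. The
excluded value is the resonance. -/
theorem dx_dx_eq_zero_of_exponent (hc : RationalCoeffs a b X (C s) (X ^ j) N) (hs : s ≠ 0)
    (hUne : (U : Set (𝕜 × 𝕜)).Nonempty) (hUc : Convex ℝ (U : Set (𝕜 × 𝕜)))
    {k : ℕ} (hkj : k ≠ j) (hk : N.coeff k ≠ 0) {μ : 𝕜} (hμ : μ * (k - j) = -2)
    (hsμ : 2 * ((1 - s) * μ) - 1 ≠ 0) (h : IsSymm a b ξ φ) : dx (dx ξ) = 0 := by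
  have e1 := hc.two_dx hUne hUc h
  rw [(eq_of_exponent hc hs hUne hUc hkj hk hμ h).2] at e1
  refine mul_cancel_of_ne_zero hsμ ?_
  rw [dx_mul, dx_algebraMap] at e1
  rw [map_sub, map_mul _ 2, map_ofNat, map_one]
  linear_combination e1

/-- The coefficient j of N is the constant term of B. It gives 2 ξ_x N_j = ψ_xx, a multiple of
ξ_xxx, which is zero away from the resonance. -/
theorem eq_of_exponent_of_coeff (hc : RationalCoeffs a b X (C s) (X ^ j) N) (hs : s ≠ 0)
    (hUne : (U : Set (𝕜 × 𝕜)).Nonempty) (hUc : Convex ℝ (U : Set (𝕜 × 𝕜)))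
    {k : ℕ} (hkj : k ≠ j) (hk : N.coeff k ≠ 0) {μ : 𝕜} (hμ : μ * (k - j) = -2)
    (hsμ : 2 * ((1 - s) * μ) - 1 ≠ 0) (hj : N.coeff j ≠ 0) (h : IsSymm a b ξ φ) :
    dy ξ = 0 ∧ dx ξ = 0 ∧ φ = 0 := by
  obtain ⟨e1, e2⟩ := eq_of_exponent hc hs hUne hUc hkj hk hμ h
  have e3 := dx_dx_eq_zero_of_exponent hc hs hUne hUc hkj hk hμ hsμ h
  have e4 : dx ξ = 0 := ext_iff_apply.2 fun z => by
    obtain ⟨l, -, -, h2⟩ := hc.relation_of_left_eq_inv hs hUne hUc h z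
    have := h2 j
    rw [e2] at this
    simpa [e3, hj] using this
  exact ⟨hc.dy_eq_zero hUne hUc h, e4, by rw [e1, e4, mul_zero]⟩

/-- If B has no constant term, comparison at k = j leaves ψ_xx = 0, and 2 ψ_x = ξ_xx passes this on
to ξ. The resonant case is covered. -/
theorem dx_dx_dx_eq_zero_of_exponent (hc : RationalCoeffs a b X (C s) (X ^ j) N) (hs : s ≠ 0)
    (hUne : (U : Set (𝕜 × 𝕜)).Nonempty) (hUc : Convex ℝ (U : Set (𝕜 × 𝕜)))
    (hj : N.coeff j = 0) (h : IsSymm a b ξ φ) : dx (dx (dx ξ)) = 0 := by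
  have e1 : dx (dx (dy φ - a * φ)) = 0 := ext_iff_apply.2 fun z => by
    obtain ⟨l, -, -, h2⟩ := hc.relation_of_left_eq_inv hs hUne hUc h z
    have := h2 j
    rw [hj, mul_zero, if_pos rfl] at this
    exact this.symm
  have e2 := congrArg dx (hc.two_dx hUne hUc h)
  rw [dx_mul, e1, dx_ofNat] at e2
  linear_combination -e2

end LeftInv

section Equations

open Ince

end Equations

end PlaneSymmetry

set_option linter.unusedSimpArgs false

/-! ### The equations with a = 0 or a = s/y and b ≠ 0. -/

namespace PlaneSymmetry

open TopologicalSpace SecondOrderODE SmoothFun Polynomial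

variable {𝕜 : Type*} [RCLike 𝕜] {U : Opens (𝕜 × 𝕜)}

section Equations

open Ince

theorem dimension_I2 (hUne : (U : Set (𝕜 × 𝕜)).Nonempty)
    (hUc : Convex ℝ (U : Set (𝕜 × 𝕜))) :
    translationField U ∈ (I2 (𝕜 := 𝕜)).symmetryAlgebra U ∧
    Module.finrank 𝕜 ((I2 (𝕜 := 𝕜)).symmetryAlgebra U) = 2 := by
  have hE : ∀ z : U, ∀ p, (I2 (𝕜 := 𝕜)).rhs z.1.1 z.1.2 p =
      (0 : SmoothFun U).1 z * p ^ 2 + (6 * coordY ^ 2 : SmoothFun U).1 z := fun z p => by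
    simp [I2]
  have hb : dx (6 * coordY ^ 2 : SmoothFun U) = 0 := by simp
  have hb' : dy (6 * coordY ^ 2 : SmoothFun U) = 12 * coordY := by
    simp
    ring
  exact ⟨translationField_mem hE dx_zero hb,
    finrank_symmetryAlgebra_eq_two (s := 0) (μ := -2) hE dx_zero hb hUne hUc (by simp)
      (by rw [hb']; simp only [map_sub, map_neg, map_ofNat, map_one, map_zero]; ring)
      fun ξ φ h => eq_of_dy_eq_linear hUne hUc hb hb' h⟩

theorem dimension_I7 (hUne : (U : Set (𝕜 × 𝕜)).Nonempty)
    (hUc : Convex ℝ (U : Set (𝕜 × 𝕜))) :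
    translationField U ∈ (I7 (𝕜 := 𝕜)).symmetryAlgebra U ∧
    Module.finrank 𝕜 ((I7 (𝕜 := 𝕜)).symmetryAlgebra U) = 2 := by
  have hE : ∀ z : U, ∀ p, (I7 (𝕜 := 𝕜)).rhs z.1.1 z.1.2 p =
      (0 : SmoothFun U).1 z * p ^ 2 + (2 * coordY ^ 3 : SmoothFun U).1 z := fun z p => by
    simp [I7]
  have hb : dx (2 * coordY ^ 3 : SmoothFun U) = 0 := by simp
  have hb' : dy (2 * coordY ^ 3 : SmoothFun U) = 6 * coordY ^ 2 + algebraMap 𝕜 _ 0 := by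
    simp
    ring
  exact ⟨translationField_mem hE dx_zero hb,
    finrank_symmetryAlgebra_eq_two (s := 0) (μ := -1) hE dx_zero hb hUne hUc (by simp)
      (by rw [hb']; simp only [map_sub, map_neg, map_ofNat, map_one, map_zero]; ring)
      fun ξ φ h => eq_of_dy_eq_quadratic hUne hUc hb hb' h⟩

theorem dimension_I3 (hUne : (U : Set (𝕜 × 𝕜)).Nonempty)
    (hUc : Convex ℝ (U : Set (𝕜 × 𝕜))) :
    translationField U ∈ (I3 (𝕜 := 𝕜)).symmetryAlgebra U ∧
    Module.finrank 𝕜 ((I3 (𝕜 := 𝕜)).symmetryAlgebra U) = 1 := by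
  have hE : ∀ z : U, ∀ p, (I3 (𝕜 := 𝕜)).rhs z.1.1 z.1.2 p =
      (0 : SmoothFun U).1 z * p ^ 2 +
        (6 * coordY ^ 2 + algebraMap 𝕜 _ (1 / 2) : SmoothFun U).1 z := fun z p => by
    simp [I3]
  have hb : dx (6 * coordY ^ 2 + algebraMap 𝕜 _ (1 / 2) : SmoothFun U) = 0 := by simp
  have hb' : dy (6 * coordY ^ 2 + algebraMap 𝕜 _ (1 / 2) : SmoothFun U) = 12 * coordY := by
    simp
    ring
  refine ⟨translationField_mem hE dx_zero hb,
    finrank_symmetryAlgebra_eq_one hE dx_zero hb hUne hUc fun ξ φ h => ?_⟩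
  obtain ⟨e1, e2, e3⟩ := eq_of_dy_eq_linear hUne hUc hb hb' h
  have e4 := h.const
  rw [e3, hb'] at e4
  simp [e1, e2, dy_dx] at e4
  have e5 : dx ξ = 0 := by
    refine ext_iff_apply.2 fun z => ?_
    have := ext_iff_apply.1 e4 z
    simp at this
    simp
    linear_combination -this / 2
  exact ⟨e1, e5, by rw [e3, e5, mul_zero]⟩

theorem dimension_I8 (hUne : (U : Set (𝕜 × 𝕜)).Nonempty)
    (hUc : Convex ℝ (U : Set (𝕜 × 𝕜))) (β γ : 𝕜) (h : β ≠ 0 ∨ γ ≠ 0) :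
    translationField U ∈ (I8 (𝕜 := 𝕜) β γ).symmetryAlgebra U ∧
    Module.finrank 𝕜 ((I8 (𝕜 := 𝕜) β γ).symmetryAlgebra U) = 1 := by
  have hE : ∀ z : U, ∀ p, (I8 (𝕜 := 𝕜) β γ).rhs z.1.1 z.1.2 p =
      (0 : SmoothFun U).1 z * p ^ 2 +
        (2 * coordY ^ 3 + algebraMap 𝕜 _ β * coordY + algebraMap 𝕜 _ γ : SmoothFun U).1 z := fun z p => by
    simp [I8]
  have hb : dx (2 * coordY ^ 3 + algebraMap 𝕜 _ β * coordY + algebraMap 𝕜 _ γ : SmoothFun U) = 0 := by simp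
  have hb' : dy (2 * coordY ^ 3 + algebraMap 𝕜 _ β * coordY + algebraMap 𝕜 _ γ : SmoothFun U) = 6 * coordY ^ 2 + algebraMap 𝕜 _ β := by
    simp
    ring
  refine ⟨translationField_mem hE dx_zero hb,
    finrank_symmetryAlgebra_eq_one hE dx_zero hb hUne hUc fun ξ φ hs => ?_⟩
  obtain ⟨e1, e2, e3⟩ := eq_of_dy_eq_quadratic hUne hUc hb hb' hs
  have e4 := hs.const
  rw [e3, hb'] at e4
  simp [e1, e2, dy_dx] at e4
  -- This polynomial is 3 b - y b', the failure of b to be homogeneous of degree 3; `const` says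
  -- that its product with ξ_x is zero.
  have hp : (C (2 * β) * X + C (3 * γ) : 𝕜[X]) ≠ 0 := fun h0 => by
    have h1 := congrArg (coeff · 1) h0
    have h2 := congrArg (coeff · 0) h0
    simp [coeff_X, coeff_C] at h1 h2
    exact h.elim (· h1) (· h2)
  have e5 : dx ξ = 0 := by
    refine eq_zero_of_aeval_mul_eq_zero hp ?_
    simp only [map_add, map_mul, aeval_C, aeval_X, map_ofNat]
    linear_combination -e4
  exact ⟨e1, e5, by rw [e3, e5, mul_zero]⟩

theorem dimension_I18 (hUne : (U : Set (𝕜 × 𝕜)).Nonempty)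
    (hUc : Convex ℝ (U : Set (𝕜 × 𝕜))) (h0 : ∀ z ∈ U, z.2 ≠ (0 : 𝕜)) :
    translationField U ∈ (I18 (𝕜 := 𝕜)).symmetryAlgebra U ∧
    Module.finrank 𝕜 ((I18 (𝕜 := 𝕜)).symmetryAlgebra U) = 2 := by
  have hE : ∀ z : U, ∀ p, (I18 (𝕜 := 𝕜)).rhs z.1.1 z.1.2 p =
      (algebraMap 𝕜 _ (1 / 2) * poleAt 0 h0 : SmoothFun U).1 z * p ^ 2 +
        (4 * coordY ^ 2 : SmoothFun U).1 z := fun z p => by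
    simp [I18]
    ring
  have hb : dx (4 * coordY ^ 2 : SmoothFun U) = 0 := by simp
  -- Here B = 8 y - 2 y = 6 y, so the exponent is 1 and the weight is -2.
  have hc : RationalCoeffs (algebraMap 𝕜 _ (1 / 2) * poleAt 0 h0) (4 * coordY ^ 2 : SmoothFun U) X
      (C (1 / 2)) (X ^ 0) (C 6 * X : 𝕜[X]) :=
    rationalCoeffs_inv h0 (p := 1) (q := 2) (by norm_num) (by norm_num) (by norm_num) hb
      (ext_iff_apply.2 fun z => by
        have := h0 z z.2
        simp [aeval_coordY_apply]
        field_simp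
        ring) (k := 1) (by norm_num)
      (by simp only [coeff_add, coeff_sub, coeff_C_mul, coeff_X_pow, coeff_X, coeff_C]; norm_num)
  refine ⟨translationField_mem hE hc.dx_left hb,
    finrank_symmetryAlgebra_eq_two (μ := -2) hE hc.dx_left hb hUne hUc
      (ext_iff_apply.2 fun z => by
        have := h0 z z.2
        simp [this]
        rfl)
      (ext_iff_apply.2 fun z => by
        have := h0 z z.2
        simp
        field_simp
        ring) fun ξ φ h => ⟨hc.dy_eq_zero hUne hUc h, ?_, ?_⟩⟩
  · exact dx_dx_eq_zero_of_exponent hc (by norm_num) hUne hUc (k := 1) (by norm_num)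
      (by simp only [coeff_add, coeff_sub, coeff_C_mul, coeff_X_pow, coeff_X, coeff_C]; norm_num)
      (μ := -2) (by norm_num) (by norm_num) h
  · exact (eq_of_exponent hc (by norm_num) hUne hUc (k := 1) (by norm_num)
      (by simp only [coeff_add, coeff_sub, coeff_C_mul, coeff_X_pow, coeff_X, coeff_C]; norm_num)
      (μ := -2) (by norm_num) h).1

theorem dimension_I19 (hUne : (U : Set (𝕜 × 𝕜)).Nonempty)
    (hUc : Convex ℝ (U : Set (𝕜 × 𝕜))) (h0 : ∀ z ∈ U, z.2 ≠ (0 : 𝕜)) :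
    translationField U ∈ (I19 (𝕜 := 𝕜)).symmetryAlgebra U ∧
    Module.finrank 𝕜 ((I19 (𝕜 := 𝕜)).symmetryAlgebra U) = 1 := by
  have hE : ∀ z : U, ∀ p, (I19 (𝕜 := 𝕜)).rhs z.1.1 z.1.2 p =
      (algebraMap 𝕜 _ (1 / 2) * poleAt 0 h0 : SmoothFun U).1 z * p ^ 2 +
        (4 * coordY ^ 2 + 2 * coordY : SmoothFun U).1 z := fun z p => by
    simp [I19]
    ring
  have hb : dx (4 * coordY ^ 2 + 2 * coordY : SmoothFun U) = 0 := by simp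
  have hc : RationalCoeffs
      (algebraMap 𝕜 _ (1 / 2) * poleAt 0 h0) (4 * coordY ^ 2 + 2 * coordY : SmoothFun U) X
      (C (1 / 2)) (X ^ 0) (C 6 * X + C 1 : 𝕜[X]) :=
    rationalCoeffs_inv h0 (p := 1) (q := 2) (by norm_num) (by norm_num) (by norm_num) hb
      (ext_iff_apply.2 fun z => by
        have := h0 z z.2
        simp [aeval_coordY_apply]
        field_simp
        ring) (k := 1) (by norm_num)
      (by simp only [coeff_add, coeff_sub, coeff_C_mul, coeff_X_pow, coeff_X, coeff_C]; norm_num)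
  refine ⟨translationField_mem hE hc.dx_left hb,
    finrank_symmetryAlgebra_eq_one hE hc.dx_left hb hUne hUc fun ξ φ hs => ?_⟩
  exact eq_of_exponent_of_coeff hc (by norm_num) hUne hUc (k := 1) (by norm_num)
      (by simp only [coeff_add, coeff_sub, coeff_C_mul, coeff_X_pow, coeff_X, coeff_C]; norm_num)
      (μ := -2) (by norm_num) (by norm_num)
      (by simp only [coeff_add, coeff_sub, coeff_C_mul, coeff_X_pow, coeff_X, coeff_C]; norm_num [*])
      hs

theorem dimension_I21 (hUne : (U : Set (𝕜 × 𝕜)).Nonempty)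
    (hUc : Convex ℝ (U : Set (𝕜 × 𝕜))) (h0 : ∀ z ∈ U, z.2 ≠ (0 : 𝕜)) :
    translationField U ∈ (I21 (𝕜 := 𝕜)).symmetryAlgebra U ∧
    Module.finrank 𝕜 ((I21 (𝕜 := 𝕜)).symmetryAlgebra U) = 2 := by
  have hE : ∀ z : U, ∀ p, (I21 (𝕜 := 𝕜)).rhs z.1.1 z.1.2 p =
      (algebraMap 𝕜 _ (3 / 4) * poleAt 0 h0 : SmoothFun U).1 z * p ^ 2 +
        (3 * coordY ^ 2 : SmoothFun U).1 z := fun z p => by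
    simp [I21]
    ring
  have hb : dx (3 * coordY ^ 2 : SmoothFun U) = 0 := by simp
  have hc : RationalCoeffs (algebraMap 𝕜 _ (3 / 4) * poleAt 0 h0) (3 * coordY ^ 2 : SmoothFun U) X
      (C (3 / 4)) (X ^ 0) (C (15 / 4) * X : 𝕜[X]) :=
    rationalCoeffs_inv h0 (p := 3) (q := 4) (by norm_num) (by norm_num) (by norm_num) hb
      (ext_iff_apply.2 fun z => by
        have := h0 z z.2
        simp [aeval_coordY_apply]
        field_simp
        ring) (k := 1) (by norm_num)
      (by simp only [coeff_add, coeff_sub, coeff_C_mul, coeff_X_pow, coeff_X, coeff_C]; norm_num)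
  refine ⟨translationField_mem hE hc.dx_left hb,
    finrank_symmetryAlgebra_eq_two (μ := -2) hE hc.dx_left hb hUne hUc
      (ext_iff_apply.2 fun z => by
        have := h0 z z.2
        simp [this]
        rfl)
      (ext_iff_apply.2 fun z => by
        have := h0 z z.2
        simp
        field_simp
        ring) fun ξ φ h => ⟨hc.dy_eq_zero hUne hUc h, ?_, ?_⟩⟩
  · exact dx_dx_eq_zero_of_exponent hc (by norm_num) hUne hUc (k := 1) (by norm_num)
      (by simp only [coeff_add, coeff_sub, coeff_C_mul, coeff_X_pow, coeff_X, coeff_C]; norm_num)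
      (μ := -2) (by norm_num) (by norm_num) h
  · exact (eq_of_exponent hc (by norm_num) hUne hUc (k := 1) (by norm_num)
      (by simp only [coeff_add, coeff_sub, coeff_C_mul, coeff_X_pow, coeff_X, coeff_C]; norm_num)
      (μ := -2) (by norm_num) h).1

theorem dimension_I22 (hUne : (U : Set (𝕜 × 𝕜)).Nonempty)
    (hUc : Convex ℝ (U : Set (𝕜 × 𝕜))) (h0 : ∀ z ∈ U, z.2 ≠ (0 : 𝕜)) :
    translationField U ∈ (I22 (𝕜 := 𝕜)).symmetryAlgebra U ∧
    Module.finrank 𝕜 ((I22 (𝕜 := 𝕜)).symmetryAlgebra U) = 3 := by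
  have hE : ∀ z : U, ∀ p, (I22 (𝕜 := 𝕜)).rhs z.1.1 z.1.2 p =
      (algebraMap 𝕜 _ (3 / 4) * poleAt 0 h0 : SmoothFun U).1 z * p ^ 2 +
        (-1 : SmoothFun U).1 z := fun z p => by
    simp [I22]
    ring
  have hb : dx (-1 : SmoothFun U) = 0 := by simp
  -- B = 3 / (4 y) has exponent -1 and weight 2, and 2 · 2 · (1 - 3/4) = 1 is the resonance.
  have hc : RationalCoeffs (algebraMap 𝕜 _ (3 / 4) * poleAt 0 h0) (-1 : SmoothFun U) X
      (C (3 / 4)) (X ^ 1) (C (3 / 4) : 𝕜[X]) :=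
    rationalCoeffs_inv h0 (p := 3) (q := 4) (by norm_num) (by norm_num) (by norm_num) hb
      (ext_iff_apply.2 fun z => by
        have := h0 z z.2
        simp [aeval_coordY_apply]
        field_simp) (k := 0) (by norm_num)
      (by simp only [coeff_add, coeff_sub, coeff_C_mul, coeff_X_pow, coeff_X, coeff_C]; norm_num)
  refine ⟨translationField_mem hE hc.dx_left hb,
    finrank_symmetryAlgebra_eq_three (μ := 2) hE hc.dx_left hb hUne hUc
      (ext_iff_apply.2 fun z => by
        have := h0 z z.2
        simp [this]
        rfl) (by norm_num)
      (ext_iff_apply.2 fun z => by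
        have := h0 z z.2
        simp) fun ξ φ h => ⟨hc.dy_eq_zero hUne hUc h, ?_, ?_⟩⟩
  · exact dx_dx_dx_eq_zero_of_exponent hc (by norm_num) hUne hUc
      (by simp only [coeff_add, coeff_sub, coeff_C_mul, coeff_X_pow, coeff_X, coeff_C]; norm_num) h
  · exact (eq_of_exponent hc (by norm_num) hUne hUc (k := 0) (by norm_num)
      (by simp only [coeff_add, coeff_sub, coeff_C_mul, coeff_X_pow, coeff_X, coeff_C]; norm_num)
      (μ := 2) (by norm_num) h).1

theorem dimension_I23 (hUne : (U : Set (𝕜 × 𝕜)).Nonempty)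
    (hUc : Convex ℝ (U : Set (𝕜 × 𝕜))) (h0 : ∀ z ∈ U, z.2 ≠ (0 : 𝕜)) (α β : 𝕜) (h : α ≠ 0 ∨ β ≠ 0) :
    translationField U ∈ (I23 (𝕜 := 𝕜) α β).symmetryAlgebra U ∧
    Module.finrank 𝕜 ((I23 (𝕜 := 𝕜) α β).symmetryAlgebra U) = 1 := by
  have hE : ∀ z : U, ∀ p, (I23 (𝕜 := 𝕜) α β).rhs z.1.1 z.1.2 p =
      (algebraMap 𝕜 _ (3 / 4) * poleAt 0 h0 : SmoothFun U).1 z * p ^ 2 +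
        (3 * coordY ^ 2 + algebraMap 𝕜 _ α * coordY + algebraMap 𝕜 _ β : SmoothFun U).1 z := fun z p => by
    simp [I23]
    ring
  have hb : dx (3 * coordY ^ 2 + algebraMap 𝕜 _ α * coordY + algebraMap 𝕜 _ β : SmoothFun U) = 0 := by simp
  have hc : RationalCoeffs
      (algebraMap 𝕜 _ (3 / 4) * poleAt 0 h0) (3 * coordY ^ 2 + algebraMap 𝕜 _ α * coordY + algebraMap 𝕜 _ β : SmoothFun U) X
      (C (3 / 4)) (X ^ 1) (C (15 / 4) * X ^ 2 + C (α / 4) * X - C (3 / 4 * β) : 𝕜[X]) :=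
    rationalCoeffs_inv h0 (p := 3) (q := 4) (by norm_num) (by norm_num) (by norm_num) hb
      (ext_iff_apply.2 fun z => by
        have := h0 z z.2
        simp [aeval_coordY_apply]
        field_simp
        ring) (k := 2) (by norm_num)
      (by simp only [coeff_add, coeff_sub, coeff_C_mul, coeff_X_pow, coeff_X, coeff_C]; norm_num)
  refine ⟨translationField_mem hE hc.dx_left hb,
    finrank_symmetryAlgebra_eq_one hE hc.dx_left hb hUne hUc fun ξ φ hs => ?_⟩
  -- B = 15 y / 4 + α / 4 - 3 β / (4 y): α is the constant term of B, and β supplies a second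
  -- nonconstant power.
  rcases h with h | h
  · exact eq_of_exponent_of_coeff hc (by norm_num) hUne hUc (k := 2) (by norm_num)
      (by simp only [coeff_add, coeff_sub, coeff_C_mul, coeff_X_pow, coeff_X, coeff_C]; norm_num)
      (μ := -2) (by norm_num) (by norm_num)
      (by simp only [coeff_add, coeff_sub, coeff_C_mul, coeff_X_pow, coeff_X, coeff_C]; norm_num [*])
      hs
  · exact eq_of_two_exponents hc (by norm_num) hUne hUc (k := 2) (k' := 0) (by norm_num)
      (by norm_num) (by norm_num)
      (by simp only [coeff_add, coeff_sub, coeff_C_mul, coeff_X_pow, coeff_X, coeff_C]; norm_num [*])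
      (by simp only [coeff_add, coeff_sub, coeff_C_mul, coeff_X_pow, coeff_X, coeff_C]; norm_num [*])
      hs

theorem dimension_I29 (hUne : (U : Set (𝕜 × 𝕜)).Nonempty)
    (hUc : Convex ℝ (U : Set (𝕜 × 𝕜))) (h0 : ∀ z ∈ U, z.2 ≠ (0 : 𝕜)) :
    translationField U ∈ (I29 (𝕜 := 𝕜)).symmetryAlgebra U ∧
    Module.finrank 𝕜 ((I29 (𝕜 := 𝕜)).symmetryAlgebra U) = 2 := by
  have hE : ∀ z : U, ∀ p, (I29 (𝕜 := 𝕜)).rhs z.1.1 z.1.2 p =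
      (algebraMap 𝕜 _ (1 / 2) * poleAt 0 h0 : SmoothFun U).1 z * p ^ 2 +
        (algebraMap 𝕜 _ (3 / 2) * coordY ^ 3 : SmoothFun U).1 z := fun z p => by
    simp [I29]
    ring
  have hb : dx (algebraMap 𝕜 _ (3 / 2) * coordY ^ 3 : SmoothFun U) = 0 := by simp
  have hc : RationalCoeffs
      (algebraMap 𝕜 _ (1 / 2) * poleAt 0 h0) (algebraMap 𝕜 _ (3 / 2) * coordY ^ 3 : SmoothFun U) X
      (C (1 / 2)) (X ^ 0) (C (15 / 4) * X ^ 2 : 𝕜[X]) :=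
    rationalCoeffs_inv h0 (p := 1) (q := 2) (by norm_num) (by norm_num) (by norm_num) hb
      (ext_iff_apply.2 fun z => by
        have := h0 z z.2
        simp [aeval_coordY_apply]
        field_simp
        ring) (k := 2) (by norm_num)
      (by simp only [coeff_add, coeff_sub, coeff_C_mul, coeff_X_pow, coeff_X, coeff_C]; norm_num)
  refine ⟨translationField_mem hE hc.dx_left hb,
    finrank_symmetryAlgebra_eq_two (μ := -1) hE hc.dx_left hb hUne hUc
      (ext_iff_apply.2 fun z => by
        have := h0 z z.2
        simp [this]
        rfl)
      (ext_iff_apply.2 fun z => by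
        have := h0 z z.2
        simp
        field_simp
        ring) fun ξ φ h => ⟨hc.dy_eq_zero hUne hUc h, ?_, ?_⟩⟩
  · exact dx_dx_eq_zero_of_exponent hc (by norm_num) hUne hUc (k := 2) (by norm_num)
      (by simp only [coeff_add, coeff_sub, coeff_C_mul, coeff_X_pow, coeff_X, coeff_C]; norm_num)
      (μ := -1) (by norm_num) (by norm_num) h
  · exact (eq_of_exponent hc (by norm_num) hUne hUc (k := 2) (by norm_num)
      (by simp only [coeff_add, coeff_sub, coeff_C_mul, coeff_X_pow, coeff_X, coeff_C]; norm_num)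
      (μ := -1) (by norm_num) h).1

theorem dimension_I30 (hUne : (U : Set (𝕜 × 𝕜)).Nonempty)
    (hUc : Convex ℝ (U : Set (𝕜 × 𝕜))) (h0 : ∀ z ∈ U, z.2 ≠ (0 : 𝕜)) (α β γ : 𝕜) (h : α ≠ 0 ∨ β ≠ 0 ∨ γ ≠ 0) :
    translationField U ∈ (I30 (𝕜 := 𝕜) α β γ).symmetryAlgebra U ∧
    Module.finrank 𝕜 ((I30 (𝕜 := 𝕜) α β γ).symmetryAlgebra U) = 1 := by
  have hE : ∀ z : U, ∀ p, (I30 (𝕜 := 𝕜) α β γ).rhs z.1.1 z.1.2 p =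
      (algebraMap 𝕜 _ (1 / 2) * poleAt 0 h0 : SmoothFun U).1 z * p ^ 2 +
        (algebraMap 𝕜 _ (3 / 2) * coordY ^ 3 + 4 * algebraMap 𝕜 _ α * coordY ^ 2 + 2 * algebraMap 𝕜 _ β * coordY -
      algebraMap 𝕜 _ (γ ^ 2 / 2) * poleAt 0 h0 : SmoothFun U).1 z := fun z p => by
    simp [I30]
    ring
  have hb : dx (algebraMap 𝕜 _ (3 / 2) * coordY ^ 3 + 4 * algebraMap 𝕜 _ α * coordY ^ 2 + 2 * algebraMap 𝕜 _ β * coordY -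
      algebraMap 𝕜 _ (γ ^ 2 / 2) * poleAt 0 h0 : SmoothFun U) = 0 := by simp
  have hc : RationalCoeffs
      (algebraMap 𝕜 _ (1 / 2) * poleAt 0 h0) (algebraMap 𝕜 _ (3 / 2) * coordY ^ 3 + 4 * algebraMap 𝕜 _ α * coordY ^ 2 + 2 * algebraMap 𝕜 _ β * coordY -
      algebraMap 𝕜 _ (γ ^ 2 / 2) * poleAt 0 h0 : SmoothFun U) X
      (C (1 / 2)) (X ^ 2) (C (15 / 4) * X ^ 4 + C (6 * α) * X ^ 3 + C β * X ^ 2 + C (3 / 4 * γ ^ 2) : 𝕜[X]) :=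
    rationalCoeffs_inv h0 (p := 1) (q := 2) (by norm_num) (by norm_num) (by norm_num) hb
      (ext_iff_apply.2 fun z => by
        have := h0 z z.2
        simp [aeval_coordY_apply]
        field_simp
        ring) (k := 4) (by norm_num)
      (by simp only [coeff_add, coeff_sub, coeff_C_mul, coeff_X_pow, coeff_X, coeff_C]; norm_num)
  refine ⟨translationField_mem hE hc.dx_left hb,
    finrank_symmetryAlgebra_eq_one hE hc.dx_left hb hUne hUc fun ξ φ hs => ?_⟩
  -- B = 15 y² / 4 + 6 α y + β + 3 γ² / (4 y²): α and γ each supply a second nonconstant power,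
  -- while β is the constant term.
  rcases h with h | h | h
  · exact eq_of_two_exponents hc (by norm_num) hUne hUc (k := 4) (k' := 3) (by norm_num)
      (by norm_num) (by norm_num)
      (by simp only [coeff_add, coeff_sub, coeff_C_mul, coeff_X_pow, coeff_X, coeff_C]; norm_num [*])
      (by simp only [coeff_add, coeff_sub, coeff_C_mul, coeff_X_pow, coeff_X, coeff_C]; norm_num [*])
      hs
  · exact eq_of_exponent_of_coeff hc (by norm_num) hUne hUc (k := 4) (by norm_num)
      (by simp only [coeff_add, coeff_sub, coeff_C_mul, coeff_X_pow, coeff_X, coeff_C]; norm_num)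
      (μ := -1) (by norm_num) (by norm_num)
      (by simp only [coeff_add, coeff_sub, coeff_C_mul, coeff_X_pow, coeff_X, coeff_C]; norm_num [*])
      hs
  · exact eq_of_two_exponents hc (by norm_num) hUne hUc (k := 4) (k' := 0) (by norm_num)
      (by norm_num) (by norm_num)
      (by simp only [coeff_add, coeff_sub, coeff_C_mul, coeff_X_pow, coeff_X, coeff_C]; norm_num [*])
      (by simp only [coeff_add, coeff_sub, coeff_C_mul, coeff_X_pow, coeff_X, coeff_C]; norm_num [*])
      hs

theorem dimension_I32 (hUne : (U : Set (𝕜 × 𝕜)).Nonempty)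
    (hUc : Convex ℝ (U : Set (𝕜 × 𝕜))) (h0 : ∀ z ∈ U, z.2 ≠ (0 : 𝕜)) :
    translationField U ∈ (I32 (𝕜 := 𝕜)).symmetryAlgebra U ∧
    Module.finrank 𝕜 ((I32 (𝕜 := 𝕜)).symmetryAlgebra U) = 3 := by
  have hE : ∀ z : U, ∀ p, (I32 (𝕜 := 𝕜)).rhs z.1.1 z.1.2 p =
      (algebraMap 𝕜 _ (1 / 2) * poleAt 0 h0 : SmoothFun U).1 z * p ^ 2 +
        (-(algebraMap 𝕜 _ (1 / 2) * poleAt 0 h0) : SmoothFun U).1 z := fun z p => by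
    simp [I32]
    ring
  have hb : dx (-(algebraMap 𝕜 _ (1 / 2) * poleAt 0 h0) : SmoothFun U) = 0 := by simp
  -- B = 3 / (4 y²) has exponent -2 and weight 1, and 2 · 1 · (1 - 1/2) = 1 is the resonance.
  have hc : RationalCoeffs
      (algebraMap 𝕜 _ (1 / 2) * poleAt 0 h0) (-(algebraMap 𝕜 _ (1 / 2) * poleAt 0 h0) : SmoothFun U) X
      (C (1 / 2)) (X ^ 2) (C (3 / 4) : 𝕜[X]) :=
    rationalCoeffs_inv h0 (p := 1) (q := 2) (by norm_num) (by norm_num) (by norm_num) hb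
      (ext_iff_apply.2 fun z => by
        have := h0 z z.2
        simp [aeval_coordY_apply]
        field_simp
        ring) (k := 0) (by norm_num)
      (by simp only [coeff_add, coeff_sub, coeff_C_mul, coeff_X_pow, coeff_X, coeff_C]; norm_num)
  refine ⟨translationField_mem hE hc.dx_left hb,
    finrank_symmetryAlgebra_eq_three (μ := 1) hE hc.dx_left hb hUne hUc
      (ext_iff_apply.2 fun z => by
        have := h0 z z.2
        simp [this]
        rfl) (by norm_num)
      (ext_iff_apply.2 fun z => by
        have := h0 z z.2
        simp
        field_simp
        ring) fun ξ φ h => ⟨hc.dy_eq_zero hUne hUc h, ?_, ?_⟩⟩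
  · exact dx_dx_dx_eq_zero_of_exponent hc (by norm_num) hUne hUc
      (by simp only [coeff_add, coeff_sub, coeff_C_mul, coeff_X_pow, coeff_X, coeff_C]; norm_num) h
  · exact (eq_of_exponent hc (by norm_num) hUne hUc (k := 0) (by norm_num)
      (by simp only [coeff_add, coeff_sub, coeff_C_mul, coeff_X_pow, coeff_X, coeff_C]; norm_num)
      (μ := 1) (by norm_num) h).1

theorem dimension_I33 (hUne : (U : Set (𝕜 × 𝕜)).Nonempty)
    (hUc : Convex ℝ (U : Set (𝕜 × 𝕜))) (h0 : ∀ z ∈ U, z.2 ≠ (0 : 𝕜)) (α : 𝕜) :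
    translationField U ∈ (I33 (𝕜 := 𝕜) α).symmetryAlgebra U ∧
    Module.finrank 𝕜 ((I33 (𝕜 := 𝕜) α).symmetryAlgebra U) = 1 := by
  have hE : ∀ z : U, ∀ p, (I33 (𝕜 := 𝕜) α).rhs z.1.1 z.1.2 p =
      (algebraMap 𝕜 _ (1 / 2) * poleAt 0 h0 : SmoothFun U).1 z * p ^ 2 +
        (4 * coordY ^ 2 + algebraMap 𝕜 _ α * coordY - algebraMap 𝕜 _ (1 / 2) * poleAt 0 h0 : SmoothFun U).1 z := fun z p => by
    simp [I33]
    ring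
  have hb : dx (4 * coordY ^ 2 + algebraMap 𝕜 _ α * coordY - algebraMap 𝕜 _ (1 / 2) * poleAt 0 h0 : SmoothFun U) = 0 := by simp
  have hc : RationalCoeffs
      (algebraMap 𝕜 _ (1 / 2) * poleAt 0 h0) (4 * coordY ^ 2 + algebraMap 𝕜 _ α * coordY - algebraMap 𝕜 _ (1 / 2) * poleAt 0 h0 : SmoothFun U) X
      (C (1 / 2)) (X ^ 2) (C 6 * X ^ 3 + C (α / 2) * X ^ 2 + C (3 / 4) : 𝕜[X]) :=
    rationalCoeffs_inv h0 (p := 1) (q := 2) (by norm_num) (by norm_num) (by norm_num) hb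
      (ext_iff_apply.2 fun z => by
        have := h0 z z.2
        simp [aeval_coordY_apply]
        field_simp
        ring) (k := 3) (by norm_num)
      (by simp only [coeff_add, coeff_sub, coeff_C_mul, coeff_X_pow, coeff_X, coeff_C]; norm_num)
  refine ⟨translationField_mem hE hc.dx_left hb,
    finrank_symmetryAlgebra_eq_one hE hc.dx_left hb hUne hUc fun ξ φ hs => ?_⟩
  -- B contains 6 y and 3 / (4 y²) whatever α is; α contributes only the constant term.
  exact eq_of_two_exponents hc (by norm_num) hUne hUc (k := 3) (k' := 0) (by norm_num)
    (by norm_num) (by norm_num)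
      (by simp only [coeff_add, coeff_sub, coeff_C_mul, coeff_X_pow, coeff_X, coeff_C]; norm_num [*])
      (by simp only [coeff_add, coeff_sub, coeff_C_mul, coeff_X_pow, coeff_X, coeff_C]; norm_num [*])
      hs

theorem dimension_I12 (hUne : (U : Set (𝕜 × 𝕜)).Nonempty)
    (hUc : Convex ℝ (U : Set (𝕜 × 𝕜))) (h0 : ∀ z ∈ U, z.2 ≠ (0 : 𝕜)) (α β γ δ : 𝕜)
    (h : (α ≠ 0 ∧ β ≠ 0) ∨ (α ≠ 0 ∧ γ ≠ 0) ∨ (α ≠ 0 ∧ δ ≠ 0) ∨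
        (β ≠ 0 ∧ γ ≠ 0) ∨ (β ≠ 0 ∧ δ ≠ 0) ∨ (γ ≠ 0 ∧ δ ≠ 0)) :
    translationField U ∈ (I12 (𝕜 := 𝕜) α β γ δ).symmetryAlgebra U ∧
    Module.finrank 𝕜 ((I12 (𝕜 := 𝕜) α β γ δ).symmetryAlgebra U) = 1 := by
  have hE : ∀ z : U, ∀ p, (I12 (𝕜 := 𝕜) α β γ δ).rhs z.1.1 z.1.2 p =
      (algebraMap 𝕜 _ 1 * poleAt 0 h0 : SmoothFun U).1 z * p ^ 2 +
        (algebraMap 𝕜 _ α * coordY ^ 3 + algebraMap 𝕜 _ β * coordY ^ 2 + algebraMap 𝕜 _ γ + algebraMap 𝕜 _ δ * poleAt 0 h0 : SmoothFun U).1 z := fun z p => by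
    simp [I12]
    ring
  have hb : dx (algebraMap 𝕜 _ α * coordY ^ 3 + algebraMap 𝕜 _ β * coordY ^ 2 + algebraMap 𝕜 _ γ + algebraMap 𝕜 _ δ * poleAt 0 h0 : SmoothFun U) = 0 := by simp
  -- B = 2 α y² + β y - γ / y - 2 δ / y² has four different powers, none of them constant, so any
  -- two nonzero parameters suffice.
  have key : ∀ k k' : ℕ, k ≠ 2 → k' ≠ 2 → k ≠ k' →
      (C (2 * α) * X ^ 4 + C β * X ^ 3 - C γ * X - C (2 * δ) : 𝕜[X]).coeff k ≠ 0 →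
      (C (2 * α) * X ^ 4 + C β * X ^ 3 - C γ * X - C (2 * δ) : 𝕜[X]).coeff k' ≠ 0 →
      Module.finrank 𝕜 ((I12 (𝕜 := 𝕜) α β γ δ).symmetryAlgebra U) = 1 := by
    intro k k' hk hk' hkk hN hN'
    have hc := rationalCoeffs_inv h0 (s := 1) (p := 1) (q := 1) (j := 2) (by norm_num) (by norm_num)
      (by norm_num) hb (N := C (2 * α) * X ^ 4 + C β * X ^ 3 - C γ * X - C (2 * δ))
      (ext_iff_apply.2 fun z => by
        have := h0 z z.2
        simp [aeval_coordY_apply]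
        field_simp
        ring) hk hN
    exact finrank_symmetryAlgebra_eq_one hE hc.dx_left hb hUne hUc fun ξ φ hs =>
      eq_of_two_exponents hc one_ne_zero hUne hUc hk hk' hkk hN hN' hs
  refine ⟨translationField_mem hE (by simp) hb, ?_⟩
  rcases h with ⟨h, h'⟩ | ⟨h, h'⟩ | ⟨h, h'⟩ | ⟨h, h'⟩ | ⟨h, h'⟩ | ⟨h, h'⟩
  · exact key 4 3 (by norm_num) (by norm_num) (by norm_num)
      (by simp only [coeff_add, coeff_sub, coeff_C_mul, coeff_X_pow, coeff_X, coeff_C]; norm_num [h])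
      (by simp only [coeff_add, coeff_sub, coeff_C_mul, coeff_X_pow, coeff_X, coeff_C]; norm_num [h'])
  · exact key 4 1 (by norm_num) (by norm_num) (by norm_num)
      (by simp only [coeff_add, coeff_sub, coeff_C_mul, coeff_X_pow, coeff_X, coeff_C]; norm_num [h])
      (by simp only [coeff_add, coeff_sub, coeff_C_mul, coeff_X_pow, coeff_X, coeff_C]; norm_num [h'])
  · exact key 4 0 (by norm_num) (by norm_num) (by norm_num)
      (by simp only [coeff_add, coeff_sub, coeff_C_mul, coeff_X_pow, coeff_X, coeff_C]; norm_num [h])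
      (by simp only [coeff_add, coeff_sub, coeff_C_mul, coeff_X_pow, coeff_X, coeff_C]; norm_num [h'])
  · exact key 3 1 (by norm_num) (by norm_num) (by norm_num)
      (by simp only [coeff_add, coeff_sub, coeff_C_mul, coeff_X_pow, coeff_X, coeff_C]; norm_num [h])
      (by simp only [coeff_add, coeff_sub, coeff_C_mul, coeff_X_pow, coeff_X, coeff_C]; norm_num [h'])
  · exact key 3 0 (by norm_num) (by norm_num) (by norm_num)
      (by simp only [coeff_add, coeff_sub, coeff_C_mul, coeff_X_pow, coeff_X, coeff_C]; norm_num [h])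
      (by simp only [coeff_add, coeff_sub, coeff_C_mul, coeff_X_pow, coeff_X, coeff_C]; norm_num [h'])
  · exact key 1 0 (by norm_num) (by norm_num) (by norm_num)
      (by simp only [coeff_add, coeff_sub, coeff_C_mul, coeff_X_pow, coeff_X, coeff_C]; norm_num [h])
      (by simp only [coeff_add, coeff_sub, coeff_C_mul, coeff_X_pow, coeff_X, coeff_C]; norm_num [h'])

end Equations

end PlaneSymmetry

/-! ### The equations with poles at 0 and 1 and b ≠ 0. -/

namespace PlaneSymmetry

open TopologicalSpace SecondOrderODE SmoothFun Polynomial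

variable {𝕜 : Type*} [RCLike 𝕜] {U : Opens (𝕜 × 𝕜)}

section Equations

open Ince

theorem dimension_I38 (hUne : (U : Set (𝕜 × 𝕜)).Nonempty)
    (hUc : Convex ℝ (U : Set (𝕜 × 𝕜))) (h0 : ∀ z ∈ U, z.2 ≠ (0 : 𝕜)) (h1 : ∀ z ∈ U, z.2 ≠ (1 : 𝕜)) (α β γ δ : 𝕜)
    (h : α ≠ 0 ∨ β ≠ 0 ∨ γ ≠ 0 ∨ δ ≠ 0) :
    translationField U ∈ (I38 (𝕜 := 𝕜) α β γ δ).symmetryAlgebra U ∧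
    Module.finrank 𝕜 ((I38 (𝕜 := 𝕜) α β γ δ).symmetryAlgebra U) = 1 := by
  have hE : ∀ z : U, ∀ p, (I38 (𝕜 := 𝕜) α β γ δ).rhs z.1.1 z.1.2 p =
      (algebraMap 𝕜 _ (1 / 2) * poleAt 0 h0 + poleAt 1 h1 : SmoothFun U).1 z * p ^ 2 +
        (coordY * (coordY - 1) * (algebraMap 𝕜 _ α * (coordY - 1) + algebraMap 𝕜 _ β * (coordY - 1) * poleAt 0 h0 ^ 2 +
      algebraMap 𝕜 _ γ * poleAt 1 h1 + algebraMap 𝕜 _ δ * poleAt 1 h1 ^ 2) : SmoothFun U).1 z := fun z p => by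
    simp [I38]
    ring
  have hb : dx (coordY * (coordY - 1) * (algebraMap 𝕜 _ α * (coordY - 1) + algebraMap 𝕜 _ β * (coordY - 1) * poleAt 0 h0 ^ 2 +
      algebraMap 𝕜 _ γ * poleAt 1 h1 + algebraMap 𝕜 _ δ * poleAt 1 h1 ^ 2) : SmoothFun U) = 0 := by simp
  have hc : RationalCoeffs
      (algebraMap 𝕜 _ (1 / 2) * poleAt 0 h0 + poleAt 1 h1) (coordY * (coordY - 1) * (algebraMap 𝕜 _ α * (coordY - 1) + algebraMap 𝕜 _ β * (coordY - 1) * poleAt 0 h0 ^ 2 +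
      algebraMap 𝕜 _ γ * poleAt 1 h1 + algebraMap 𝕜 _ δ * poleAt 1 h1 ^ 2))
      (X * (X - C 1) : 𝕜[X]) (C (3 / 2) * X - C (1 / 2)) (X ^ 2 * (X - C 1) ^ 2)
      (C (α / 2) * (X - C 1) * (C 3 * X - C 1) * (X ^ 2 * (X - C 1) ^ 2) +
        C β * (X * (X - C 1) ^ 3 - C (3 / 2) * (X - C 1) ^ 4) -
        C γ * (C (1 / 2) * X ^ 2 * (X - C 1) ^ 2 + X ^ 2 * (X - C 1)) -
        C δ * (C 2 * X ^ 2 + C (3 / 2) * X ^ 2 * (X - C 1))) :=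
    { dx_left := by simp
      dx_right := hb
      left_mul := ext_iff_apply.2 fun z => by
        have := h0 z z.2
        have := sub_ne_zero.2 (h1 z z.2)
        simp [aeval_coordY_apply]
        field_simp
        ring
      right_mul := ext_iff_apply.2 fun z => by
        have := h0 z z.2
        have := sub_ne_zero.2 (h1 z z.2)
        simp [aeval_coordY_apply]
        field_simp
        ring
      splits := Splits.X.mul (Splits.X_sub_C 1)
      ne_zero := mul_ne_zero X_ne_zero (X_sub_C_ne_zero 1)
      -- The residues of a at 0 and 1 are 1/2 and 1, so neither is a negative integer.
      residue := fun r hr k hk h => by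
        rcases (by simpa [sub_eq_zero] using hr : r = 0 ∨ r = 1) with rfl | rfl
        · simp at h
          have h2 : ((2 + 4 * k : ℕ) : 𝕜) = 0 := by
            push_cast
            linear_combination -4 * h
          rw [Nat.cast_eq_zero] at h2
          omega
        · simp at h
          have h2 : ((4 + 4 * k : ℕ) : 𝕜) = 0 := by
            push_cast
            linear_combination 4 * h
          rw [Nat.cast_eq_zero] at h2
          omega
      indicial := ⟨2, by compute_degree, by compute_degree, fun d _ h => by
        have e1 : (X * (X - C 1) : 𝕜[X]).coeff 2 = 1 := by simp [coeff_X_mul, coeff_one]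
        rw [e1] at h
        simp [coeff_X_mul, coeff_one] at h
        have h2 : ((2 * d : ℕ) : 𝕜) = (3 : ℕ) := by
          push_cast
          linear_combination 2 * h
        have := Nat.cast_injective h2
        omega⟩
      denom_ne_zero := mul_ne_zero (pow_ne_zero 2 X_ne_zero) (pow_ne_zero 2 (X_sub_C_ne_zero 1))
      -- At 0 only a multiple of β survives and at 1 only a multiple of δ. Three further values then
      -- separate α, γ and K.
      not_const := fun K h' => by
        have e0 := congrArg (eval 0) h'
        have e1 := congrArg (eval 1) h'
        simp at e0 e1
        simp only [e0, e1] at h'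
        have e2 := congrArg (eval 2) h'
        have e3 := congrArg (eval (-1)) h'
        have e4 := congrArg (eval 3) h'
        simp at e2 e3 e4
        norm_num at e2 e3 e4
        have e5 : α = 0 := by linear_combination -(e2 - e4 / 6 + 2 * e3) / 30
        have e6 : γ = 0 := by linear_combination e3 - e4 / 36 + 4 * e5
        simp [e0, e1, e5, e6] at h }
  exact ⟨translationField_mem hE hc.dx_left hb,
    finrank_symmetryAlgebra_eq_one hE hc.dx_left hb hUne hUc fun ξ φ hs =>
      ⟨hc.dy_eq_zero hUne hUc hs,
        hc.of_two_poles hUne hUc (by simp) (by simp) (by norm_num) (by norm_num) hs⟩⟩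

theorem dimension_I44 (hUne : (U : Set (𝕜 × 𝕜)).Nonempty)
    (hUc : Convex ℝ (U : Set (𝕜 × 𝕜))) (h0 : ∀ z ∈ U, z.2 ≠ (0 : 𝕜)) (h1 : ∀ z ∈ U, z.2 ≠ (1 : 𝕜)) (α β γ : 𝕜)
    (h : α ≠ 0 ∨ β ≠ 0 ∨ γ ≠ 0) :
    translationField U ∈ (I44 (𝕜 := 𝕜) α β γ).symmetryAlgebra U ∧
    Module.finrank 𝕜 ((I44 (𝕜 := 𝕜) α β γ).symmetryAlgebra U) = 1 := by
  have hE : ∀ z : U, ∀ p, (I44 (𝕜 := 𝕜) α β γ).rhs z.1.1 z.1.2 p =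
      (algebraMap 𝕜 _ (3 / 4) * (poleAt 0 h0 + poleAt 1 h1) : SmoothFun U).1 z * p ^ 2 +
        (coordY * (coordY - 1) * (algebraMap 𝕜 _ α * poleAt 0 h0 + algebraMap 𝕜 _ β * poleAt 1 h1 + 2 * algebraMap 𝕜 _ γ * (2 * coordY - 1)) : SmoothFun U).1 z := fun z p => by
    simp [I44, -mul_eq_mul_left_iff, -mul_eq_mul_right_iff]
    ring
  have hb : dx (coordY * (coordY - 1) * (algebraMap 𝕜 _ α * poleAt 0 h0 + algebraMap 𝕜 _ β * poleAt 1 h1 + 2 * algebraMap 𝕜 _ γ * (2 * coordY - 1)) : SmoothFun U) = 0 := by simp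
  have hc : RationalCoeffs
      (algebraMap 𝕜 _ (3 / 4) * (poleAt 0 h0 + poleAt 1 h1)) (coordY * (coordY - 1) * (algebraMap 𝕜 _ α * poleAt 0 h0 + algebraMap 𝕜 _ β * poleAt 1 h1 + 2 * algebraMap 𝕜 _ γ * (2 * coordY - 1)))
      (X * (X - C 1) : 𝕜[X]) (C (3 / 2) * X - C (3 / 4)) (X * (X - C 1))
      ((C (α + β) + C (2 * γ) * ((C 2 * X - C 1) ^ 2 + C 2 * X * (X - C 1))) * (X * (X - C 1)) -
        C (3 / 4) * (C 2 * X - C 1) * (C α * (X - C 1) + C β * X +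
          C (2 * γ) * (C 2 * X - C 1) * (X * (X - C 1)))) :=
    { dx_left := by simp
      dx_right := hb
      left_mul := ext_iff_apply.2 fun z => by
        have := h0 z z.2
        have := sub_ne_zero.2 (h1 z z.2)
        simp [aeval_coordY_apply]
        field_simp
        ring
      right_mul := ext_iff_apply.2 fun z => by
        have := h0 z z.2
        have := sub_ne_zero.2 (h1 z z.2)
        simp [aeval_coordY_apply]
        field_simp
        ring
      splits := Splits.X.mul (Splits.X_sub_C 1)
      ne_zero := mul_ne_zero X_ne_zero (X_sub_C_ne_zero 1)
      residue := fun r hr k hk h => by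
        rcases (by simpa [sub_eq_zero] using hr : r = 0 ∨ r = 1) with rfl | rfl
        · simp at h
          have h2 : ((3 + 4 * k : ℕ) : 𝕜) = 0 := by
            push_cast
            linear_combination -4 * h
          rw [Nat.cast_eq_zero] at h2
          omega
        · simp at h
          have h2 : ((3 + 4 * k : ℕ) : 𝕜) = 0 := by
            push_cast
            linear_combination 4 * h
          rw [Nat.cast_eq_zero] at h2
          omega
      indicial := ⟨2, by compute_degree, by compute_degree, fun d _ h => by
        have e1 : (X * (X - C 1) : 𝕜[X]).coeff 2 = 1 := by simp [coeff_X_mul, coeff_one]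
        rw [e1] at h
        simp [coeff_X_mul, coeff_one] at h
        have h2 : ((2 * d : ℕ) : 𝕜) = (3 : ℕ) := by
          push_cast
          linear_combination 2 * h
        have := Nat.cast_injective h2
        omega⟩
      denom_ne_zero := mul_ne_zero X_ne_zero (X_sub_C_ne_zero 1)
      -- The values at 0 and 1 isolate α and β; two further values eliminate K and give γ = 0.
      not_const := fun K h' => by
        have e0 := congrArg (eval 0) h'
        have e1 := congrArg (eval 1) h'
        simp at e0 e1
        norm_num at e0 e1
        simp only [e0, e1] at h'
        have e2 := congrArg (eval 2) h'
        have e4 := congrArg (eval 3) h'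
        simp at e2 e4
        norm_num at e2 e4
        have e5 : γ = 0 := by linear_combination (e4 - 3 * e2) / 144
        simp [e0, e1, e5] at h }
  exact ⟨translationField_mem hE hc.dx_left hb,
    finrank_symmetryAlgebra_eq_one hE hc.dx_left hb hUne hUc fun ξ φ hs =>
      ⟨hc.dy_eq_zero hUne hUc hs,
        hc.of_two_poles hUne hUc (by simp) (by simp) (by norm_num) (by norm_num) hs⟩⟩

set_option maxHeartbeats 1000000 in
theorem dimension_I49 (hUne : (U : Set (𝕜 × 𝕜)).Nonempty)
    (hUc : Convex ℝ (U : Set (𝕜 × 𝕜))) (h0 : ∀ z ∈ U, z.2 ≠ (0 : 𝕜)) (h1 : ∀ z ∈ U, z.2 ≠ (1 : 𝕜)) (a : 𝕜)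
    (ha : ∀ z ∈ U, z.2 ≠ a) (α β γ δ : 𝕜) (ha₀ : a ≠ 0) (ha₁ : a ≠ 1)
    (h : α ≠ 0 ∨ β ≠ 0 ∨ γ ≠ 0 ∨ δ ≠ 0) :
    translationField U ∈ (I49 (𝕜 := 𝕜) a α β γ δ).symmetryAlgebra U ∧
    Module.finrank 𝕜 ((I49 (𝕜 := 𝕜) a α β γ δ).symmetryAlgebra U) = 1 := by
  have hE : ∀ z : U, ∀ p, (I49 (𝕜 := 𝕜) a α β γ δ).rhs z.1.1 z.1.2 p =
      (algebraMap 𝕜 _ (1 / 2) * (poleAt 0 h0 + poleAt 1 h1 + poleAt a ha) : SmoothFun U).1 z * p ^ 2 +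
        (coordY * (coordY - 1) * (coordY - algebraMap 𝕜 _ a) * (algebraMap 𝕜 _ α + algebraMap 𝕜 _ β * poleAt 0 h0 ^ 2 +
      algebraMap 𝕜 _ γ * poleAt 1 h1 ^ 2 + algebraMap 𝕜 _ δ * poleAt a ha ^ 2) : SmoothFun U).1 z := fun z p => by
    simp [I49, -mul_eq_mul_left_iff, -mul_eq_mul_right_iff]
    ring
  have hP : (X * (X - C 1) * (X - C a) : 𝕜[X]) ≠ 0 :=
    mul_ne_zero (mul_ne_zero X_ne_zero (X_sub_C_ne_zero 1)) (X_sub_C_ne_zero a)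
  have hb : dx (coordY * (coordY - 1) * (coordY - algebraMap 𝕜 _ a) * (algebraMap 𝕜 _ α + algebraMap 𝕜 _ β * poleAt 0 h0 ^ 2 +
      algebraMap 𝕜 _ γ * poleAt 1 h1 ^ 2 + algebraMap 𝕜 _ δ * poleAt a ha ^ 2) : SmoothFun U) = 0 := by simp
  have hc : RationalCoeffs
      (algebraMap 𝕜 _ (1 / 2) * (poleAt 0 h0 + poleAt 1 h1 + poleAt a ha)) (coordY * (coordY - 1) * (coordY - algebraMap 𝕜 _ a) * (algebraMap 𝕜 _ α + algebraMap 𝕜 _ β * poleAt 0 h0 ^ 2 +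
      algebraMap 𝕜 _ γ * poleAt 1 h1 ^ 2 + algebraMap 𝕜 _ δ * poleAt a ha ^ 2))
      (X * (X - C 1) * (X - C a) : 𝕜[X]) (C (1 / 2) * (C 3 * X ^ 2 - C (2 * (1 + a)) * X + C a)) ((X * (X - C 1) * (X - C a)) ^ 2)
      (C (α / 2) * (C 3 * X ^ 2 - C (2 * (1 + a)) * X + C a) * (X * (X - C 1) * (X - C a)) ^ 2 +
        C β * (C (1 / 2) * (C 2 * X - C (1 + a)) * X - C (3 / 2) * ((X - C 1) * (X - C a))) *
          ((X - C 1) * (X - C a)) ^ 2 +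
        C γ * (C (1 / 2) * (C 2 * X - C a) * (X - C 1) - C (3 / 2) * (X * (X - C a))) *
          (X * (X - C a)) ^ 2 +
        C δ * (C (1 / 2) * (C 2 * X - C 1) * (X - C a) - C (3 / 2) * (X * (X - C 1))) *
          (X * (X - C 1)) ^ 2) :=
    { dx_left := by simp
      dx_right := hb
      left_mul := ext_iff_apply.2 fun z => by
        have := h0 z z.2
        have := sub_ne_zero.2 (h1 z z.2)
        have := sub_ne_zero.2 (ha z z.2)
        simp [aeval_coordY_apply]
        field_simp
        ring
      right_mul := ext_iff_apply.2 fun z => by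
        have := h0 z z.2
        have := sub_ne_zero.2 (h1 z z.2)
        have := sub_ne_zero.2 (ha z z.2)
        simp [aeval_coordY_apply]
        field_simp
        ring
      splits := (Splits.X.mul (Splits.X_sub_C 1)).mul (Splits.X_sub_C a)
      ne_zero := hP
      -- Here A = P' / 2, so A(r) + k P'(r) = (k + 1/2) P'(r), which is nonzero because the three
      -- roots are distinct.
      residue := fun r hr k hk h => by
        have h2 : ((2 * k + 1 : ℕ) : 𝕜) ≠ 0 := Nat.cast_ne_zero.2 (by omega)
        rcases (by simpa [sub_eq_zero, or_assoc] using hr : r = 0 ∨ r = 1 ∨ r = a) with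
          rfl | rfl | rfl
        · simp at h
          refine mul_ne_zero h2 ha₀ ?_
          push_cast
          linear_combination 2 * h
        · simp at h
          refine mul_ne_zero h2 (sub_ne_zero.2 ha₁) ?_
          push_cast
          linear_combination -2 * h
        · simp at h
          refine mul_ne_zero (mul_ne_zero h2 ha₀) (sub_ne_zero.2 ha₁) ?_
          push_cast
          linear_combination 2 * h
      indicial := ⟨3, by compute_degree, by compute_degree, fun d _ h => by
        have e1 : (X * (X - C 1) * (X - C a) : 𝕜[X]) =
            X ^ 3 - C (1 + a) * X ^ 2 + C a * X := by
          simp only [map_add, map_one]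
          ring
        have e2 : X * (C (1 / 2) * (C 3 * X ^ 2 - C (2 * (1 + a)) * X + C a)) =
            C (1 / 2 * 3) * X ^ 3 - C (1 / 2 * (2 * (1 + a))) * X ^ 2 + C (1 / 2 * a) * X := by
          simp only [C_mul]
          ring
        rw [e1, e2] at h
        simp only [coeff_add, coeff_sub, coeff_C_mul, coeff_X_pow, coeff_X] at h
        norm_num at h
        have h2 : ((2 * d : ℕ) : 𝕜) = (3 : ℕ) := by
          push_cast
          linear_combination 2 * h
        have := Nat.cast_injective h2
        omega⟩
      denom_ne_zero := pow_ne_zero 2 hP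
      -- The values at 0, 1 and a isolate β, γ and δ. After division by P² the remaining quadratic
      -- would be constant; its second difference at -1, 0, 1 is a multiple of α.
      not_const := fun K h' => by
        have e0 := congrArg (eval 0) h'
        have e1 := congrArg (eval 1) h'
        have ea := congrArg (eval a) h'
        simp [ha₀, sub_ne_zero.2 ha₁, sub_ne_zero.2 ha₁.symm] at e0 e1 ea
        simp only [e0, e1, ea, C_0, zero_mul, add_zero] at h'
        replace h' := mul_right_cancel₀ (pow_ne_zero 2 hP) h'
        have e2 := congrArg (eval 0) h'
        have e3 := congrArg (eval 1) h'
        have e4 := congrArg (eval (-1)) h'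
        simp at e2 e3 e4
        have e5 : α = 0 := by linear_combination (e4 - e2) / 3 - (e2 - e3) / 3
        simp [e0, e1, e5, ea] at h }
  exact ⟨translationField_mem hE hc.dx_left hb,
    finrank_symmetryAlgebra_eq_one hE hc.dx_left hb hUne hUc fun ξ φ hs =>
      ⟨hc.dy_eq_zero hUne hUc hs,
        hc.of_two_poles hUne hUc (by simp) (by simp) (by simp [ha₀]) (by simp [sub_eq_zero, ha₁.symm]; intro h; exact ha₁ (by linear_combination -h)) hs⟩⟩

end Equations

end PlaneSymmetry

/-! ### The equations y'' = a y'²: straightening coordinate and projective vector fields. -/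

namespace PlaneSymmetry

open TopologicalSpace SecondOrderODE SmoothFun

variable {𝕜 : Type*} [RCLike 𝕜] {U : Opens (𝕜 × 𝕜)}

namespace SmoothFun

/-- A function of `y` has a primitive on a convex set. -/
theorem exists_primitive (hUc : Convex ℝ (U : Set (𝕜 × 𝕜))) {f : SmoothFun U} (hf : dx f = 0) :
    ∃ F : SmoothFun U, dx F = 0 ∧ dy F = f := by
  let θ : 𝕜 × 𝕜 → (𝕜 × 𝕜 →L[𝕜] 𝕜) := fun z => f.ext z • ContinuousLinearMap.snd 𝕜 𝕜 𝕜
  have hθ : ∀ z ∈ U, HasFDerivAt θ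
      ((((fderiv 𝕜 f.ext z).restrictScalars ℝ).smulRight (ContinuousLinearMap.snd 𝕜 𝕜 𝕜))) z :=
    fun z hz => ((f.differentiableAt hz).hasFDerivAt.restrictScalars ℝ).smul_const
      (ContinuousLinearMap.snd 𝕜 𝕜 𝕜)
  -- The one-form f dy is closed because f_x = 0, so the Poincaré lemma on a convex set applies.
  obtain ⟨F, hF⟩ := hUc.exists_forall_hasFDerivAt_of_fderiv_symmetric U.isOpen
    (fun z hz => (hθ z hz).differentiableAt.differentiableWithinAt) fun z hz v w => by
      rw [(hθ z hz).fderiv]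
      have h1 := fderiv_ext_eq f ⟨z, hz⟩ v
      have h2 := fderiv_ext_eq f ⟨z, hz⟩ w
      simp only [hf] at h1 h2
      simp [h1, h2]
      ring
  have hs : ContDiffOn 𝕜 ∞ F U := by
    refine (contDiffOn_infty_iff_fderiv_of_isOpen U.isOpen).2
      ⟨fun z hz => (hF z hz).differentiableAt.differentiableWithinAt, ?_⟩
    exact (f.contDiffOn.smul contDiffOn_const).congr fun z hz => (hF z hz).fderiv
  refine ⟨ofContDiffOn F hs, ext_iff_apply.2 fun z => ?_, ext_iff_apply.2 fun z => ?_⟩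
  · rw [dx_apply, fderiv_ext_ofContDiffOn _ _ z.2, (hF z z.2).fderiv]
    simp [θ]
  · rw [dy_apply, fderiv_ext_ofContDiffOn _ _ z.2, (hF z z.2).fderiv]
    simp [θ]

/-- The functions are exp f and exp (-f). The second is kept so that division can be done by
multiplication within the algebra of smooth functions. -/
theorem exists_exp (f : SmoothFun U) :
    ∃ g g' : SmoothFun U, g * g' = 1 ∧ dx g = g * dx f ∧ dy g = g * dy f := by
  have hs : ∀ f : SmoothFun U, ContDiffOn 𝕜 ∞ (fun z => NormedSpace.exp (f.ext z)) U :=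
    fun f z hz => ((NormedSpace.exp_analytic (𝕂 := 𝕜) (f.ext z)).contDiffAt.comp z
      (f.contDiffAt hz)).contDiffWithinAt
  have hd : ∀ z : U, ∀ v, fderiv 𝕜 (ofContDiffOn _ (hs f)).ext z v =
      NormedSpace.exp (f.1 z) * fderiv 𝕜 f.ext z v := by
    intro z v
    rw [fderiv_ext_ofContDiffOn _ _ z.2]
    have h1 := (hasDerivAt_exp (𝕂 := 𝕜) (x := f.ext z)).comp_hasFDerivAt (z : 𝕜 × 𝕜)
      (f.differentiableAt z.2).hasFDerivAt
    have h2 : fderiv 𝕜 (fun z => NormedSpace.exp (f.ext z)) (z : 𝕜 × 𝕜) = _ := h1.fderiv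
    rw [h2]
    simp
  refine ⟨ofContDiffOn _ (hs f), ofContDiffOn _ (hs (-f)), ?_, ?_, ?_⟩
  · refine ext_iff_apply.2 fun z => ?_
    simp only [Subalgebra.coe_mul, Pi.mul_apply, ofContDiffOn_apply, ext_coe, Subalgebra.coe_neg,
      Pi.neg_apply, NormedSpace.exp_neg, Subalgebra.coe_one, Pi.one_apply]
    exact mul_inv_cancel₀ (NormedSpace.isUnit_exp (f.1 z)).ne_zero
  · exact ext_iff_apply.2 fun z => by
      rw [dx_apply, hd]
      simp [dx_apply]
  · exact ext_iff_apply.2 fun z => by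
      rw [dy_apply, hd]
      simp [dy_apply]

end SmoothFun

/-- A coordinate `h`, a function of `y`, in which the equation `y'' = a y'²` becomes `h'' = 0`;
here `σ = h'` and `τ = 1 / h'`. -/
structure FlatFrame (a : SmoothFun U) where
  h : SmoothFun U
  σ : SmoothFun U
  τ : SmoothFun U
  mul_eq_one : σ * τ = 1
  dx_h : dx h = 0
  dy_h : dy h = σ
  dx_σ : dx σ = 0
  dy_σ : dy σ = -a * σ

/-- Two quadratures: σ = exp(-∫ a dy), then h = ∫ σ dy. -/
theorem exists_flatFrame (hUc : Convex ℝ (U : Set (𝕜 × 𝕜))) {a : SmoothFun U} (ha : dx a = 0) :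
    Nonempty (FlatFrame a) := by
  obtain ⟨G, hG1, hG2⟩ := exists_primitive hUc ha
  obtain ⟨σ, τ, h1, h2, h3⟩ := exists_exp (-G)
  have h4 : dx σ = 0 := by rw [h2, dx_neg, hG1, neg_zero, mul_zero]
  obtain ⟨h, h5, h6⟩ := exists_primitive hUc h4
  exact ⟨⟨h, σ, τ, h1, h5, h6, h4, by rw [h3, dy_neg, hG2]; ring⟩⟩

namespace FlatFrame

variable {a : SmoothFun U}

theorem dx_left (D : FlatFrame a) : dx a = 0 := by
  have h1 := congrArg dx D.dy_σ
  rw [← dy_dx, D.dx_σ, dy_zero, dx_mul, D.dx_σ, dx_neg] at h1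
  linear_combination D.τ * h1 - dx a * D.mul_eq_one

variable (D : FlatFrame a)

theorem dx_τ : dx D.τ = 0 := by
  have h1 := congrArg dx D.mul_eq_one
  rw [dx_mul, D.dx_σ, dx_one] at h1
  linear_combination D.τ * h1 - dx D.τ * D.mul_eq_one

theorem dy_τ : dy D.τ = a * D.τ := by
  have h1 := congrArg dy D.mul_eq_one
  rw [dy_mul, D.dy_σ, dy_one] at h1
  linear_combination D.τ * h1 - (dy D.τ - a * D.τ) * D.mul_eq_one

/-- The `i`-th coordinate of the image of `(x, h, 1)` under a matrix. -/
noncomputable def row (A : Matrix (Fin 3) (Fin 3) 𝕜) (i : Fin 3) : SmoothFun U :=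
  algebraMap 𝕜 _ (A i 0) * coordX + algebraMap 𝕜 _ (A i 1) * D.h + algebraMap 𝕜 _ (A i 2)

/-- The `∂_x`-coefficient of the projective vector field of the matrix `-A`. -/
noncomputable def projX (A : Matrix (Fin 3) (Fin 3) 𝕜) : SmoothFun U :=
  coordX * D.row A 2 - D.row A 0

/-- The `∂_h`-coefficient of the projective vector field of the matrix `-A`. -/
noncomputable def projH (A : Matrix (Fin 3) (Fin 3) 𝕜) : SmoothFun U :=
  D.h * D.row A 2 - D.row A 1

theorem isSymm_proj (A : Matrix (Fin 3) (Fin 3) 𝕜) :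
    IsSymm a 0 (D.projX A) (D.τ * D.projH A) := by
  constructor <;>
    simp [projX, projH, row, D.dx_h, D.dy_h, D.dx_σ, D.dy_σ, D.dx_τ, D.dy_τ, D.dx_left]
  · ring
  · linear_combination (2 * algebraMap 𝕜 _ (A 2 1) * D.σ) * D.mul_eq_one
  · linear_combination (2 * algebraMap 𝕜 _ (A 2 0)) * D.mul_eq_one

/-- Repeated integration, with each constant produced by a function whose two partial derivatives
vanish, gives ξ = α x² + β x h + c₁ x + c₂ h + c₀ and σ φ = α x h + β h² + c₄ x + c₅ h + c₃. This is
the general projective vector field in (x, h). -/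
theorem exists_proj_of_isSymm (hUc : Convex ℝ (U : Set (𝕜 × 𝕜))) {ξ φ : SmoothFun U}
    (hs : IsSymm a 0 ξ φ) : ∃ A : Matrix (Fin 3) (Fin 3) 𝕜, A.trace = 0 ∧ D.projX A = ξ ∧
      D.τ * D.projH A = φ := by
  have hστ := D.mul_eq_one
  have two_cancel : ∀ {f g : SmoothFun U}, 2 * f = 2 * g → f = g := fun h =>
    mul_cancel_of_ne_zero (c := 2) two_ne_zero (by rwa [map_ofNat])
  have e1 : dy (dy ξ) = -a * dy ξ := by linear_combination hs.cubic
  have e2 := hs.quadratic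
  have e3 : 2 * dx (dy φ - a * φ) = dx (dx ξ) := by simpa using hs.linear
  have e4 : dx (dx φ) = 0 := by simpa using hs.const
  set ψ := dy φ - a * φ with hψ
  have e5 : dx (dx ψ) = 0 := by
    rw [hψ, dx_sub, dx_sub, ← dy_dx, ← dy_dx, e4]
    simp [D.dx_left, e4]
  have e6 : dx (dx (dx ξ)) = 0 := by
    rw [← e3]
    simp [e5]
  -- The y-derivative of 2 ψ_x = ξ_xx, combined with ψ_y = 2 ξ_xy, gives 4 ξ_xxy = ξ_xxy.
  have e7 : dy (dx (dx ξ)) = 0 := by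
    have h1 := congrArg dy e3
    rw [dy_mul, dy_dx, e2] at h1
    simp [dy_dx] at h1 ⊢
    refine mul_cancel_of_ne_zero (c := 3) three_ne_zero ?_
    rw [map_ofNat]
    linear_combination h1
  obtain ⟨α₂, hα₂⟩ := exists_eq_algebraMap hUc e6 e7
  obtain ⟨α, rfl⟩ : ∃ α, α₂ = 2 * α := ⟨α₂ / 2, by ring⟩
  rw [map_mul, map_ofNat] at hα₂
  have f1 : dx (dx (dy ξ)) = 0 := by rw [← dy_dx, ← dy_dx]; exact e7
  obtain ⟨β, hβ⟩ := exists_eq_algebraMap hUc (f := D.τ * dx (dy ξ)) (by simp [D.dx_τ, f1])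
    (by
      rw [dy_mul, D.dy_τ, dy_dx, e1]
      simp [D.dx_left]
      ring)
  have hβ' : dx (dy ξ) = D.σ * algebraMap 𝕜 _ β := by
    linear_combination D.σ * hβ - dx (dy ξ) * hστ
  obtain ⟨c₂, hc₂⟩ := exists_eq_algebraMap hUc
    (f := D.τ * dy ξ - algebraMap 𝕜 _ β * coordX) (by simp [D.dx_τ, hβ])
    (by
      simp [D.dy_τ, e1]
      ring)
  have hξy : dy ξ = D.σ * (algebraMap 𝕜 _ β * coordX + algebraMap 𝕜 _ c₂) := by
    linear_combination D.σ * hc₂ - dy ξ * hστ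
  obtain ⟨c₁, hc₁⟩ := exists_eq_algebraMap hUc
    (f := dx ξ - 2 * algebraMap 𝕜 _ α * coordX - algebraMap 𝕜 _ β * D.h)
    (by simp [hα₂, D.dx_h]) (by
      simp [dy_dx, hβ', D.dy_h]
      ring)
  obtain ⟨c₀, hc₀⟩ := exists_eq_algebraMap hUc
    (f := ξ - algebraMap 𝕜 _ α * coordX ^ 2 - algebraMap 𝕜 _ β * coordX * D.h -
      algebraMap 𝕜 _ c₁ * coordX - algebraMap 𝕜 _ c₂ * D.h)
    (by
      simp [D.dx_h]
      linear_combination hc₁) (by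
      simp [hξy, D.dy_h]
      ring)
  have hψx : dx ψ = algebraMap 𝕜 _ α := two_cancel (by rw [e3, hα₂])
  obtain ⟨c₅, hc₅⟩ := exists_eq_algebraMap hUc
    (f := ψ - algebraMap 𝕜 _ α * coordX - 2 * algebraMap 𝕜 _ β * D.h)
    (by simp [hψx, D.dx_h]) (by
      simp [e2, hβ', D.dy_h]
      ring)
  have hφy : dy φ = a * φ + algebraMap 𝕜 _ α * coordX + 2 * algebraMap 𝕜 _ β * D.h +
      algebraMap 𝕜 _ c₅ := by
    linear_combination hc₅ - hψ
  have hφxy : dx (dy φ) = algebraMap 𝕜 _ α + a * dx φ := by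
    rw [hφy]
    simp [D.dx_left, D.dx_h]
    ring
  obtain ⟨c₄, hc₄⟩ := exists_eq_algebraMap hUc
    (f := D.σ * dx φ - algebraMap 𝕜 _ α * D.h) (by simp [e4, D.dx_σ, D.dx_h]) (by
      simp [dy_dx, hφxy, D.dy_σ, D.dy_h]
      ring)
  obtain ⟨c₃, hc₃⟩ := exists_eq_algebraMap hUc
    (f := D.σ * φ - algebraMap 𝕜 _ α * coordX * D.h - algebraMap 𝕜 _ β * D.h ^ 2 -
      algebraMap 𝕜 _ c₄ * coordX - algebraMap 𝕜 _ c₅ * D.h)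
    (by
      simp [D.dx_h, D.dx_σ]
      linear_combination hc₄) (by
      simp [hφy, D.dy_h, D.dy_σ]
      ring)
  have hthird : (algebraMap 𝕜 (SmoothFun U)) ((c₁ + c₅) / 3) * 3 =
      algebraMap 𝕜 _ c₁ + algebraMap 𝕜 _ c₅ := by
    rw [← map_ofNat (algebraMap 𝕜 (SmoothFun U)) 3, ← map_mul, ← map_add]
    congr 1
    ring
  -- Scalar matrices act trivially on the projective plane; the multiple (c₁ + c₅) / 3 of the
  -- identity is added to make the trace zero.
  refine ⟨!![(c₁ + c₅) / 3 - c₁, -c₂, -c₀; -c₄, (c₁ + c₅) / 3 - c₅, -c₃; α, β, (c₁ + c₅) / 3],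
    ?_, ?_, ?_⟩
  · simp [Matrix.trace_fin_three]
    ring
  · simp [projX, row]
    linear_combination -hc₀
  · simp [projH, row]
    linear_combination (-D.τ) * hc₃ + φ * hστ

/-- Differentiation in x and h reads off the entries and leaves only a scalar matrix, which has
trace zero only if it is zero. -/
theorem proj_injective (hUne : (U : Set (𝕜 × 𝕜)).Nonempty) {A : Matrix (Fin 3) (Fin 3) 𝕜}
    (hA : A.trace = 0) (h1 : D.projX A = 0) (h2 : D.τ * D.projH A = 0) : A = 0 := by
  have hinj : ∀ {c : 𝕜}, algebraMap 𝕜 (SmoothFun U) c = 0 → c = 0 := fun h =>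
    (map_eq_zero_iff _ (algebraMap_injective hUne)).1 h
  have hσ : ∀ {f : SmoothFun U}, D.σ * f = 0 → f = 0 := fun {f} h => by
    linear_combination D.τ * h - f * D.mul_eq_one
  have h3 : D.projH A = 0 := by
    linear_combination D.σ * h2 - D.projH A * D.mul_eq_one
  have x1 := congrArg dx h1
  have x2 := congrArg dx x1
  have y1 := congrArg dy h1
  have xy := congrArg dx y1
  have u1 := congrArg dx h3
  have v1 := congrArg dy h3
  simp [projX, projH, row, D.dx_h, D.dy_h, D.dx_σ] at x1 x2 y1 xy u1 v1
  have h20 : A 2 0 = 0 := by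
    refine hinj (mul_cancel_of_ne_zero (c := 2) two_ne_zero ?_)
    rw [map_ofNat]
    linear_combination x2
  have h21 : A 2 1 = 0 := hinj (hσ (by linear_combination xy))
  simp only [h20, h21, map_zero] at x1 y1 u1 v1
  have h01 : A 0 1 = 0 := hinj (hσ (by linear_combination -y1))
  have h10 : A 1 0 = 0 := hinj (by linear_combination -u1)
  have h00 : A 2 2 - A 0 0 = 0 := hinj (by rw [map_sub]; linear_combination x1)
  have h11 : A 2 2 - A 1 1 = 0 := hinj (hσ (by rw [map_sub]; linear_combination v1))
  rw [Matrix.trace_fin_three] at hA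
  have h22 : A 2 2 = 0 := by linear_combination (hA + h00 + h11) / 3
  rw [h22, zero_sub, neg_eq_zero] at h00 h11
  have h02 : A 0 2 = 0 := hinj (by
    simp only [projX, row, h20, h21, h22, h00, h01, map_zero] at h1
    linear_combination -h1)
  have h12 : A 1 2 = 0 := hinj (by
    simp only [projH, row, h20, h21, h22, h10, h11, map_zero] at h3
    linear_combination -h3)
  ext i j
  fin_cases i <;> fin_cases j <;> assumption

/-- The infinitesimal projective transformations of the plane of `x` and `h`. -/
noncomputable def proj : LieAlgebra.SpecialLinear.sl (Fin 3) 𝕜 →ₗ[𝕜] SmoothFun U × SmoothFun U where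
  toFun A := (D.projX A.1, D.τ * D.projH A.1)
  map_add' A B := by
    ext1 <;> simp [projX, projH, row] <;> ring
  map_smul' c A := by
    ext1 <;> simp [projX, projH, row, Algebra.smul_def] <;> ring

end FlatFrame

end PlaneSymmetry

/-! ### The isomorphism with sl(3) and the linearizing transformation. -/

namespace PlaneSymmetry

open TopologicalSpace SecondOrderODE SmoothFun

variable {𝕜 : Type*} [RCLike 𝕜] {U : Opens (𝕜 × 𝕜)}

theorem fderiv_field (ξ φ : SmoothFun U) (z : U) (v : 𝕜 × 𝕜) :
    fderiv 𝕜 (field ξ φ) z v =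
      (v.1 * (dx ξ).1 z + v.2 * (dy ξ).1 z, v.1 * (dx φ).1 z + v.2 * (dy φ).1 z) := by
  have h : HasFDerivAt (field ξ φ) ((fderiv 𝕜 ξ.ext z).prod (fderiv 𝕜 φ.ext z)) (z : 𝕜 × 𝕜) :=
    (ξ.differentiableAt z.2).hasFDerivAt.prodMk (φ.differentiableAt z.2).hasFDerivAt
  rw [h.fderiv]
  simp [fderiv_ext_eq]

theorem lieBracket_field (ξ₁ φ₁ ξ₂ φ₂ : SmoothFun U) :
    VectorField.lieBracket 𝕜 (field ξ₁ φ₁) (field ξ₂ φ₂) =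
      field (ξ₁ * dx ξ₂ + φ₁ * dy ξ₂ - (ξ₂ * dx ξ₁ + φ₂ * dy ξ₁))
        (ξ₁ * dx φ₂ + φ₁ * dy φ₂ - (ξ₂ * dx φ₁ + φ₂ * dy φ₁)) := by
  funext z
  by_cases hz : z ∈ U
  · lift z to U using hz
    rw [VectorField.lieBracket, fderiv_field, fderiv_field]
    simp [field]
  · have h0 : ∀ ξ φ : SmoothFun U, field ξ φ z = 0 := fun ξ φ => by
      simp [field, SmoothFun.ext, extendZero_of_notMem _ hz]
    rw [VectorField.lieBracket_eq_zero_of_eq_zero (h0 _ _) (h0 _ _), h0]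

namespace FlatFrame

variable {a : SmoothFun U} (D : FlatFrame a) (A B : Matrix (Fin 3) (Fin 3) 𝕜)

/-- The derivative of `projX` with respect to `h`. -/
noncomputable def projX_h : SmoothFun U :=
  algebraMap 𝕜 _ (A 2 1) * coordX - algebraMap 𝕜 _ (A 0 1)

/-- The derivative of `projH` with respect to `h`. -/
noncomputable def projH_h : SmoothFun U :=
  D.row A 2 + algebraMap 𝕜 _ (A 2 1) * D.h - algebraMap 𝕜 _ (A 1 1)

theorem dy_projX : dy (D.projX A) = D.σ * projX_h A := by
  simp [projX, row, projX_h, D.dy_h]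
  ring

theorem dy_projH : dy (D.projH A) = D.σ * D.projH_h A := by
  simp [projH, row, projH_h, D.dy_h]
  ring

theorem dx_projX :
    dx (D.projX A) = D.row A 2 + algebraMap 𝕜 _ (A 2 0) * coordX - algebraMap 𝕜 _ (A 0 0) := by
  simp [projX, row, D.dx_h]
  ring

theorem dx_projH :
    dx (D.projH A) = algebraMap 𝕜 _ (A 2 0) * D.h - algebraMap 𝕜 _ (A 1 0) := by
  simp [projH, row, D.dx_h]
  ring

theorem projX_commutator : D.projX (A * B - B * A) =
    D.projX A * dx (D.projX B) + D.projH A * projX_h B -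
      (D.projX B * dx (D.projX A) + D.projH B * projX_h A) := by
  rw [dx_projX, dx_projX]
  simp only [projX, projH, row, projX_h, Matrix.sub_apply, Matrix.mul_apply, Fin.sum_univ_three,
    map_sub, map_add, map_mul]
  ring

theorem projH_commutator : D.projH (A * B - B * A) =
    D.projX A * dx (D.projH B) + D.projH A * D.projH_h B -
      (D.projX B * dx (D.projH A) + D.projH B * D.projH_h A) := by
  rw [dx_projH, dx_projH]
  simp only [projX, projH, row, projH_h, Matrix.sub_apply, Matrix.mul_apply, Fin.sum_univ_three,
    map_sub, map_add, map_mul]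
  ring

/-- The bracket of the linear vector fields of A and B is the field of -(A B - B A). This is why
`projX` and `projH` use the matrix -A: with that sign the map preserves brackets. -/
theorem lieBracket_proj (A B : LieAlgebra.SpecialLinear.sl (Fin 3) 𝕜) :
    fieldMap U (D.proj ⁅A, B⁆) =
      VectorField.lieBracket 𝕜 (fieldMap U (D.proj A)) (fieldMap U (D.proj B)) := by
  have h : ∀ A, fieldMap U (D.proj A) = field (D.projX A.1) (D.τ * D.projH A.1) := fun A => rfl
  rw [h, h, h, lieBracket_field, LieAlgebra.SpecialLinear.sl_bracket]
  congr 1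
  · rw [projX_commutator, dy_projX, dy_projX]
    linear_combination (D.projH B.1 * projX_h A.1 - D.projH A.1 * projX_h B.1) * D.mul_eq_one
  · rw [projH_commutator, dx_mul, dx_mul, dy_mul, dy_mul, dy_projH, dy_projH, D.dx_τ, D.dy_τ]
    linear_combination
      D.τ * (D.projH B.1 * D.projH_h A.1 - D.projH A.1 * D.projH_h B.1) * D.mul_eq_one

end FlatFrame

theorem finrank_specialLinear_three :
    Module.finrank 𝕜 (LieAlgebra.SpecialLinear.sl (Fin 3) 𝕜) = 8 := by
  have h1 := (Matrix.traceLinearMap (Fin 3) 𝕜 𝕜).finrank_range_add_finrank_ker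
  have h2 : LinearMap.range (Matrix.traceLinearMap (Fin 3) 𝕜 𝕜) = ⊤ :=
    LinearMap.range_eq_top.2 fun c => ⟨Matrix.single 0 0 c, by simp⟩
  rw [h2, finrank_top, Module.finrank_self, Module.finrank_matrix] at h1
  simp at h1
  have h3 : Module.finrank 𝕜 (LieAlgebra.SpecialLinear.sl (Fin 3) 𝕜) =
    Module.finrank 𝕜 (LinearMap.ker (Matrix.traceLinearMap (Fin 3) 𝕜 𝕜)) := rfl
  omega

section FlatEquation

variable {E : SecondOrderODE 𝕜} {a : SmoothFun U}

theorem FlatFrame.isSymm_iff (hUc : Convex ℝ (U : Set (𝕜 × 𝕜))) (D : FlatFrame a)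
    (ξ φ : SmoothFun U) : IsSymm a 0 ξ φ ↔ ∃ A, D.proj A = (ξ, φ) := by
  constructor
  · intro h
    obtain ⟨A, h1, h2, h3⟩ := D.exists_proj_of_isSymm hUc h
    exact ⟨⟨A, h1⟩, Prod.ext h2 h3⟩
  · rintro ⟨A, hA⟩
    obtain ⟨rfl, rfl⟩ := Prod.mk.inj hA
    exact D.isSymm_proj A.1

theorem FlatFrame.injective_proj (hUne : (U : Set (𝕜 × 𝕜)).Nonempty) (D : FlatFrame a) :
    Function.Injective D.proj := by
  rw [injective_iff_map_eq_zero]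
  intro A hA
  obtain ⟨h1, h2⟩ := Prod.mk.inj hA
  exact Subtype.ext (D.proj_injective hUne A.2 h1 h2)

theorem symmetryAlgebraIsoSl3_of_flat (hUne : (U : Set (𝕜 × 𝕜)).Nonempty)
    (hUc : Convex ℝ (U : Set (𝕜 × 𝕜)))
    (hE : ∀ z : U, ∀ p, E.rhs z.1.1 z.1.2 p = a.1 z * p ^ 2 + (0 : SmoothFun U).1 z)
    (D : FlatFrame a) : E.SymmetryAlgebraIsoSl3 U :=
  ⟨(LinearEquiv.ofInjective (fieldMap U ∘ₗ D.proj)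
      ((fieldMap_injective U).comp (D.injective_proj hUne))).trans
    (LinearEquiv.ofEq _ _ (range_fieldMap_comp hE D.dx_left dx_zero D.proj (D.isSymm_iff hUc))),
    D.lieBracket_proj⟩

/-- The transformation is (x, y) ↦ (x, h(y)). Its new independent variable is x, so D_x T = 1, and
the second derivative of h along a solution is σ (q - a p²) with σ nowhere zero. -/
theorem linearizableAt_of_flat (hUE : (U : Set (𝕜 × 𝕜)) ⊆ E.domain)
    (hE : ∀ z : U, ∀ p, E.rhs z.1.1 z.1.2 p = a.1 z * p ^ 2 + (0 : SmoothFun U).1 z)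
    (D : FlatFrame a) (z₀ : U) : E.LinearizableAt z₀ := by
  have hσ : ∀ z : U, D.σ.1 z ≠ 0 := fun z h => by
    have := congrArg (fun f : SmoothFun U => f.1 z) D.mul_eq_one
    simp [h] at this
  have hh : ∀ z : U, HasFDerivAt D.h.ext (D.σ.1 z • ContinuousLinearMap.snd 𝕜 𝕜 𝕜) (z : 𝕜 × 𝕜) :=
    fun z => by
      convert (D.h.differentiableAt z.2).hasFDerivAt using 1
      ext <;> simp [fderiv_ext_eq, D.dx_h, D.dy_h]
  let Ψ : 𝕜 × 𝕜 → 𝕜 × 𝕜 := fun z => (z.1, D.h.ext z)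
  have hΨ : ∀ z : U, ContDiffAt 𝕜 ∞ Ψ z := fun z => contDiffAt_fst.prodMk (D.h.contDiffAt z.2)
  let L : U → (𝕜 × 𝕜) ≃L[𝕜] (𝕜 × 𝕜) := fun z => (ContinuousLinearEquiv.refl 𝕜 𝕜).prodCongr
    (ContinuousLinearEquiv.unitsEquivAut 𝕜 (Units.mk0 _ (hσ z)))
  have hL : ∀ z : U, HasFDerivAt Ψ (L z : 𝕜 × 𝕜 →L[𝕜] 𝕜 × 𝕜) (z : 𝕜 × 𝕜) := fun z => by
    have hLz : (L z : 𝕜 × 𝕜 →L[𝕜] 𝕜 × 𝕜) = (ContinuousLinearMap.fst 𝕜 𝕜 𝕜).prod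
        (D.σ.1 z • ContinuousLinearMap.snd 𝕜 𝕜 𝕜) := by
      ext <;> simp [L]
    rw [hLz]
    exact hasFDerivAt_fst.prodMk (hh z)
  -- The inverse function theorem gives a local inverse near z₀. Restricting it to U makes the
  -- invertible derivative L available on the whole source, so the inverse is smooth on the whole
  -- target.
  let Φ₀ : OpenPartialHomeomorph (𝕜 × 𝕜) (𝕜 × 𝕜) :=
    (hΨ z₀).toOpenPartialHomeomorph Ψ (hL z₀) (by simp)
  let Φ := Φ₀.restrOpen U U.isOpen
  have hΦ : ∀ z ∈ Φ.source, z ∈ U := fun z hz => by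
    rw [Φ₀.restrOpen_source] at hz
    exact hz.2
  have hcoe : (Φ : 𝕜 × 𝕜 → 𝕜 × 𝕜) = Ψ := rfl
  refine ⟨Φ, ?_, fun z hz => hUE (hΦ z hz), fun z hz => ?_, fun w hw => ?_, fun z hz p q hp => ?_⟩
  · rw [Φ₀.restrOpen_source]
    exact ⟨(hΨ z₀).mem_toOpenPartialHomeomorph_source (hL z₀) (by simp), z₀.2⟩
  · exact (hΨ ⟨z, hΦ z hz⟩).contDiffWithinAt
  · have hz := Φ.map_target hw
    exact (Φ.contDiffAt_symm hw (f₀' := L ⟨_, hΦ _ hz⟩) (hL ⟨_, hΦ _ hz⟩)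
      (hΨ ⟨_, hΦ _ hz⟩)).contDiffWithinAt
  · lift z to U using hΦ z hz
    have hT : ∀ (w : 𝕜 × 𝕜) (p : 𝕜), totalDeriv₀ (fun w => (Φ w).1) w p = 1 := fun w p => by
      have : fderiv 𝕜 (fun w : 𝕜 × 𝕜 => (Φ w).1) w = ContinuousLinearMap.fst 𝕜 𝕜 𝕜 :=
        hasFDerivAt_fst.fderiv
      simp [totalDeriv₀, this]
    have h1 : ∀ (w : U) (p : 𝕜),
        newDeriv₁ (fun w => (Φ w).1) (fun w => (Φ w).2) w p = D.σ.1 w * p := fun w p => by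
      rw [newDeriv₁, hT, div_one, totalDeriv₀]
      have : fderiv 𝕜 (fun w : 𝕜 × 𝕜 => (Φ w).2) w = _ := (hh w).fderiv
      simp [this]
    have h2 : fderiv 𝕜 (fun w => newDeriv₁ (fun w => (Φ w).1) (fun w => (Φ w).2) w p) z =
        fderiv 𝕜 (D.σ * algebraMap 𝕜 _ p).ext (z : 𝕜 × 𝕜) := by
      refine Filter.EventuallyEq.fderiv_eq ?_
      filter_upwards [U.isOpen.mem_nhds z.2] with w hw
      rw [h1 ⟨w, hw⟩, ext_of_mem _ hw]
      simp
    have h3 : deriv (newDeriv₁ (fun w => (Φ w).1) (fun w => (Φ w).2) z) p = D.σ.1 z := by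
      rw [show newDeriv₁ (fun w => (Φ w).1) (fun w => (Φ w).2) z = fun p => D.σ.1 z * p from
        funext (h1 z)]
      simp
    rw [newDeriv₂, hT, div_one, totalDeriv₁, h2, h3, hE, fderiv_ext_eq]
    have h4 : q = a.1 z * p ^ 2 ↔ D.σ.1 z * (q - a.1 z * p ^ 2) = 0 := by
      rw [mul_eq_zero, sub_eq_zero]
      simp [hσ z]
    simp only [ZeroMemClass.coe_zero, Pi.zero_apply, add_zero]
    rw [h4]
    refine Eq.congr ?_ rfl
    simp [D.dx_σ, D.dy_σ]
    ring

/-- The conclusions for the equations `y'' = a y'²`, where `a` is a function of `y`. -/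
theorem maximal_of_flat (hUne : (U : Set (𝕜 × 𝕜)).Nonempty)
    (hUc : Convex ℝ (U : Set (𝕜 × 𝕜))) (hUE : (U : Set (𝕜 × 𝕜)) ⊆ E.domain) (ha : dx a = 0)
    (hE : ∀ z : U, ∀ p, E.rhs z.1.1 z.1.2 p = a.1 z * p ^ 2 + (0 : SmoothFun U).1 z) :
    translationField U ∈ E.symmetryAlgebra U ∧ Module.finrank 𝕜 (E.symmetryAlgebra U) = 8 ∧
      E.SymmetryAlgebraIsoSl3 U ∧ ∀ z ∈ U, E.LinearizableAt z := by
  obtain ⟨D⟩ := exists_flatFrame hUc ha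
  exact ⟨translationField_mem hE ha dx_zero,
    (finrank_symmetryAlgebra hE ha dx_zero D.proj (D.injective_proj hUne)
      (D.isSymm_iff hUc)).trans finrank_specialLinear_three,
    symmetryAlgebraIsoSl3_of_flat hUne hUc hE D,
    fun z hz => linearizableAt_of_flat hUE hE D ⟨z, hz⟩⟩

end FlatEquation

end PlaneSymmetry

/-! ### The equations with eight-dimensional symmetry algebra. -/

namespace PlaneSymmetry

open TopologicalSpace SecondOrderODE SmoothFun Ince

variable {𝕜 : Type*} [RCLike 𝕜] {U : Opens (𝕜 × 𝕜)}

theorem maximal_I1 (hUne : (U : Set (𝕜 × 𝕜)).Nonempty) (hUc : Convex ℝ (U : Set (𝕜 × 𝕜)))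
    (hUE : (U : Set (𝕜 × 𝕜)) ⊆ (I1 (𝕜 := 𝕜)).domain) :
    translationField U ∈ (I1 (𝕜 := 𝕜)).symmetryAlgebra U ∧
      Module.finrank 𝕜 ((I1 (𝕜 := 𝕜)).symmetryAlgebra U) = 8 ∧
      (I1 (𝕜 := 𝕜)).SymmetryAlgebraIsoSl3 U ∧ ∀ z ∈ U, (I1 (𝕜 := 𝕜)).LinearizableAt z :=
  maximal_of_flat hUne hUc hUE (a := 0) dx_zero fun z p => by simp [I1]

theorem maximal_I11 (hUne : (U : Set (𝕜 × 𝕜)).Nonempty) (hUc : Convex ℝ (U : Set (𝕜 × 𝕜)))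
    (h0 : ∀ z ∈ U, z.2 ≠ (0 : 𝕜)) :
    translationField U ∈ (I11 (𝕜 := 𝕜)).symmetryAlgebra U ∧
      Module.finrank 𝕜 ((I11 (𝕜 := 𝕜)).symmetryAlgebra U) = 8 ∧
      (I11 (𝕜 := 𝕜)).SymmetryAlgebraIsoSl3 U ∧ ∀ z ∈ U, (I11 (𝕜 := 𝕜)).LinearizableAt z :=
  maximal_of_flat hUne hUc h0
    (a := poleAt 0 h0)
    (by simp) fun z p => by
      simp [I11]
      ring

theorem maximal_I17 (hUne : (U : Set (𝕜 × 𝕜)).Nonempty) (hUc : Convex ℝ (U : Set (𝕜 × 𝕜)))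
    (m : ℕ) (h0 : ∀ z ∈ U, z.2 ≠ (0 : 𝕜)) :
    translationField U ∈ (I17 (𝕜 := 𝕜) m).symmetryAlgebra U ∧
      Module.finrank 𝕜 ((I17 (𝕜 := 𝕜) m).symmetryAlgebra U) = 8 ∧
      (I17 (𝕜 := 𝕜) m).SymmetryAlgebraIsoSl3 U ∧ ∀ z ∈ U, (I17 (𝕜 := 𝕜) m).LinearizableAt z :=
  maximal_of_flat hUne hUc h0
    (a := algebraMap 𝕜 _ (((m : 𝕜) - 1) / m) * poleAt 0 h0)
    (by simp) fun z p => by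
      simp [I17, -mul_eq_mul_left_iff, -mul_eq_mul_right_iff]
      ring

theorem maximal_I37 (hUne : (U : Set (𝕜 × 𝕜)).Nonempty) (hUc : Convex ℝ (U : Set (𝕜 × 𝕜)))
    (hUE : (U : Set (𝕜 × 𝕜)) ⊆ (I37 (𝕜 := 𝕜)).domain) :
    translationField U ∈ (I37 (𝕜 := 𝕜)).symmetryAlgebra U ∧
      Module.finrank 𝕜 ((I37 (𝕜 := 𝕜)).symmetryAlgebra U) = 8 ∧
      (I37 (𝕜 := 𝕜)).SymmetryAlgebraIsoSl3 U ∧ ∀ z ∈ U, (I37 (𝕜 := 𝕜)).LinearizableAt z :=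
  maximal_of_flat hUne hUc hUE
    (a := algebraMap 𝕜 _ (1 / 2) * (poleAt 0 fun z hz => (hUE hz).1) + poleAt 1 fun z hz => (hUE hz).2)
    (by simp) fun z p => by
      simp [I37, -mul_eq_mul_left_iff, -mul_eq_mul_right_iff]
      ring

theorem maximal_I41 (hUne : (U : Set (𝕜 × 𝕜)).Nonempty) (hUc : Convex ℝ (U : Set (𝕜 × 𝕜)))
    (hUE : (U : Set (𝕜 × 𝕜)) ⊆ (I41 (𝕜 := 𝕜)).domain) :
    translationField U ∈ (I41 (𝕜 := 𝕜)).symmetryAlgebra U ∧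
      Module.finrank 𝕜 ((I41 (𝕜 := 𝕜)).symmetryAlgebra U) = 8 ∧
      (I41 (𝕜 := 𝕜)).SymmetryAlgebraIsoSl3 U ∧ ∀ z ∈ U, (I41 (𝕜 := 𝕜)).LinearizableAt z :=
  maximal_of_flat hUne hUc hUE
    (a := algebraMap 𝕜 _ (2 / 3) * ((poleAt 0 fun z hz => (hUE hz).1) + poleAt 1 fun z hz => (hUE hz).2))
    (by simp) fun z p => by
      simp [I41, -mul_eq_mul_left_iff, -mul_eq_mul_right_iff]

theorem maximal_I43 (hUne : (U : Set (𝕜 × 𝕜)).Nonempty) (hUc : Convex ℝ (U : Set (𝕜 × 𝕜)))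
    (hUE : (U : Set (𝕜 × 𝕜)) ⊆ (I43 (𝕜 := 𝕜)).domain) :
    translationField U ∈ (I43 (𝕜 := 𝕜)).symmetryAlgebra U ∧
      Module.finrank 𝕜 ((I43 (𝕜 := 𝕜)).symmetryAlgebra U) = 8 ∧
      (I43 (𝕜 := 𝕜)).SymmetryAlgebraIsoSl3 U ∧ ∀ z ∈ U, (I43 (𝕜 := 𝕜)).LinearizableAt z :=
  maximal_of_flat hUne hUc hUE
    (a := algebraMap 𝕜 _ (3 / 4) * ((poleAt 0 fun z hz => (hUE hz).1) + poleAt 1 fun z hz => (hUE hz).2))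
    (by simp) fun z p => by
      simp [I43, -mul_eq_mul_left_iff, -mul_eq_mul_right_iff]

end PlaneSymmetry

/-! ### Assembly of the table. -/

open PlaneSymmetry

theorem mainTheorem5 {𝕜 : Type*} [RCLike 𝕜] (E : SecondOrderODE 𝕜) (N : ℕ)
    (hE : Ince.AutonomousTable E N) (U : TopologicalSpace.Opens (𝕜 × 𝕜))
    (hUne : (U : Set (𝕜 × 𝕜)).Nonempty) (hUc : Convex ℝ (U : Set (𝕜 × 𝕜)))
    (hUE : (U : Set (𝕜 × 𝕜)) ⊆ E.domain) :
    (N = 1 ∨ N = 2 ∨ N = 3 ∨ N = 8) ∧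
    SecondOrderODE.translationField U ∈ E.symmetryAlgebra U ∧
    Module.finrank 𝕜 (E.symmetryAlgebra U) = N ∧
    (N = 8 → E.SymmetryAlgebraIsoSl3 U ∧ ∀ z ∈ U, E.LinearizableAt z) := by
  have assemble : ∀ (E : SecondOrderODE 𝕜) (N : ℕ), (N = 1 ∨ N = 2 ∨ N = 3) →
      SecondOrderODE.translationField U ∈ E.symmetryAlgebra U ∧
        Module.finrank 𝕜 (E.symmetryAlgebra U) = N →
      (N = 1 ∨ N = 2 ∨ N = 3 ∨ N = 8) ∧ SecondOrderODE.translationField U ∈ E.symmetryAlgebra U ∧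
        Module.finrank 𝕜 (E.symmetryAlgebra U) = N ∧
        (N = 8 → E.SymmetryAlgebraIsoSl3 U ∧ ∀ z ∈ U, E.LinearizableAt z) :=
    fun E N hN h => ⟨by omega, h.1, h.2, fun h8 => absurd h8 (by omega)⟩
  have assemble_eight : ∀ E : SecondOrderODE 𝕜,
      (SecondOrderODE.translationField U ∈ E.symmetryAlgebra U ∧
        Module.finrank 𝕜 (E.symmetryAlgebra U) = 8 ∧
        E.SymmetryAlgebraIsoSl3 U ∧ ∀ z ∈ U, E.LinearizableAt z) →
      (8 = 1 ∨ 8 = 2 ∨ 8 = 3 ∨ 8 = 8) ∧ SecondOrderODE.translationField U ∈ E.symmetryAlgebra U ∧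
        Module.finrank 𝕜 (E.symmetryAlgebra U) = 8 ∧
        (8 = 8 → E.SymmetryAlgebraIsoSl3 U ∧ ∀ z ∈ U, E.LinearizableAt z) :=
    fun E h => ⟨by simp, h.1, h.2.1, fun _ => h.2.2⟩
  cases hE with
  | I1 => exact assemble_eight _ (maximal_I1 hUne hUc hUE)
  | I2 => exact assemble _ _ (by simp) (dimension_I2 hUne hUc)
  | I3 => exact assemble _ _ (by simp) (dimension_I3 hUne hUc)
  | I7 => exact assemble _ _ (by simp) (dimension_I7 hUne hUc)
  | I8 β γ h => exact assemble _ _ (by simp) (dimension_I8 hUne hUc β γ h)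
  | I11 => exact assemble_eight _ (maximal_I11 hUne hUc hUE)
  | I12 α β γ δ h => exact assemble _ _ (by simp) (dimension_I12 hUne hUc hUE α β γ δ h)
  | I17 m hm => exact assemble_eight _ (maximal_I17 hUne hUc m hUE)
  | I18 => exact assemble _ _ (by simp) (dimension_I18 hUne hUc hUE)
  | I19 => exact assemble _ _ (by simp) (dimension_I19 hUne hUc hUE)
  | I21 => exact assemble _ _ (by simp) (dimension_I21 hUne hUc hUE)
  | I22 => exact assemble _ _ (by simp) (dimension_I22 hUne hUc hUE)
  | I23 α β h => exact assemble _ _ (by simp) (dimension_I23 hUne hUc hUE α β h)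
  | I29 => exact assemble _ _ (by simp) (dimension_I29 hUne hUc hUE)
  | I30 α β γ h => exact assemble _ _ (by simp) (dimension_I30 hUne hUc hUE α β γ h)
  | I32 => exact assemble _ _ (by simp) (dimension_I32 hUne hUc hUE)
  | I33 α => exact assemble _ _ (by simp) (dimension_I33 hUne hUc hUE α)
  | I37 => exact assemble_eight _ (maximal_I37 hUne hUc hUE)
  | I38 α β γ δ h =>
    exact assemble _ _ (by simp) (dimension_I38 hUne hUc (fun z hz => (hUE hz).1)
      (fun z hz => (hUE hz).2) α β γ δ h)
  | I41 => exact assemble_eight _ (maximal_I41 hUne hUc hUE)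
  | I43 => exact assemble_eight _ (maximal_I43 hUne hUc hUE)
  | I44 α β γ h =>
    exact assemble _ _ (by simp) (dimension_I44 hUne hUc (fun z hz => (hUE hz).1)
      (fun z hz => (hUE hz).2) α β γ h)
  | I49 a α β γ δ ha₀ ha₁ h =>
    exact assemble _ _ (by simp) (dimension_I49 hUne hUc (fun z hz => (hUE hz).1)
      (fun z hz => (hUE hz).2.1) a (fun z hz => (hUE hz).2.2) α β γ δ ha₀ ha₁ h)
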